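/- A 4-dimensional *graph-manifold* is a closed, connected, oriented 4-manifold $M$ glued from finitely many blocks $M_v$, $v\in V$, where each block $M_v=\Phi_v\times T^2$ is a trivial $T^2$-bundle over a compact connected oriented surface $\Phi_v$ with non-empty boundary, different from the disc and the annulus. The boundary tori of the blocks are glued in pairs by orientation-reversing diffeomorphisms (two boundary tori of the same block may be glued together) which do not identify the homotopy classes of the fibre tori. Let $W$ be the set of boundary tori $T_w$ of all the blocks, let $T_{-w}$ denote the torus glued to $T_w$, and let $\partial v\subset W$ be the set of boundary tori of $M_v$. Put $L_w=H_1(T_w;\mathbb Z)\cong\mathbb Z^3$ and $F_v=H_1(T^2;\mathbb Z)\cong\mathbb Z^2$ for the fibre $T^2$ of $M_v$, and let $F_w\subset L_w$ be the image of $F_v$ for $w\in\partial v$. The gluing gives an isomorphism $\hat g_w\colon L_{-w}\to L_w$, by which $L_{-w}$ and $L_w$ are identified. Choose a trivialization of each block and a basis $f_v=(f_v^1,f_v^2)$ of each $F_v$, and let $z_w$, $w\in\partial v$, be the classes of the boundary circles of $\Phi_v$; then $\hat g_w$ is described by a matrix $$(z_{-w},f_{-w})=(z_w,f_w)\begin{pmatrix}a_w&b_w\\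 c_w&d_w\end{pmatrix},\qquad b_w\in\mathbb Z^2\setminus\{0\}.$$ The *intersection number* $i_w$ is the greatest common divisor of the two entries of $b_w$. The *intersection lattice* of $w\in\partial v$ is $P_w=F_w\cap F_{-w}$, regarded as a subgroup of $F_v$. The *type* of $v$ is the number of different lattices among the $P_w$, $w\in\partial v$. The *secondary intersection number* $j_v$ is the index in $F_v$ of the subgroup generated by all $P_w$, $w\in\partial v$, if the type of $v$ is at least $2$, and $j_v=1$ if the type of $v$ is $1$. **Lemma.** For every 4-dimensional graph-manifold $M$ there are a 4-dimensional graph-manifold $N$ and a finite-sheeted covering $N\to M$ such that all intersection numbers $i_w$ and all secondary intersection numbers $j_v$ of $N$ are equal to $1$. Moreover, the fundamental groups $\pi_1(N)$ and $\pi_1(M)$ are finitely generated and quasi-isometric to each other with respect to word metrics of finite generating sets. -/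

import Mathlib

open scoped ContDiff

/-! ## Compact oriented surfaces with boundary -/

/-- A compact oriented surface with non-empty boundary, presented by polygons: a finite family of
polygons `b : B` with `len b` sides each, an open disc being removed from the interior of every
polygon, whose sides are glued in pairs by orientation-reversing identifications.  The polygons
correspond to the boundary components of the surface.  Every compact connected oriented surface
with non-empty boundary is of this form: after capping off the boundary circles it is a closed
surface with a cell decomposition that has one 2-cell for each boundary circle. -/
structure PolygonSurface where
  /-- The polygons, equivalently the boundary components. -/
  B : Type
  finite_B : Finite B
  /-- The number of sides of a polygon. -/
  len : B → ℕ
  len_pos : ∀ b, 0 < len b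
  /-- The pairing of the sides. -/
  pair : Equiv.Perm (Σ b, Fin (len b))
  pair_pair : ∀ s, pair (pair s) = s
  pair_ne : ∀ s, pair s ≠ s

namespace PolygonSurface

variable (S : PolygonSurface)

/-- The sides of the polygons; the sides of each polygon are cyclically ordered. -/
abbrev Side : Type := Σ b, Fin (S.len b)

/-- The union of the polygons with open discs removed: a polygon minus an open disc in its interior
is an annulus `ℝ/ℤ × [0,1]`, with the perimeter of the polygon as `ℝ/ℤ × {0}` and the boundary
circle of the surface as `ℝ/ℤ × {1}`. -/
abbrev PreSpace : Type := Σ _ : S.B, UnitAddCircle × unitInterval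

/-- The point at parameter `t ∈ [0,1]` of a side, the perimeter of a polygon with `n` sides being
`ℝ/ℤ` with `[k/n, (k+1)/n]` as its `k`-th side. -/
noncomputable def sidePoint (s : S.Side) (t : ℝ) : S.PreSpace :=
  ⟨s.1, ((((s.2 : ℕ) + t) / (S.len s.1) : ℝ) : UnitAddCircle), 0⟩

/-- Paired sides are identified with reversed direction. -/
inductive Rel : S.PreSpace → S.PreSpace → Prop
  | glue (s : S.Side) (t : ℝ) (ht : t ∈ Set.Icc (0 : ℝ) 1) :
      Rel (S.sidePoint s t) (S.sidePoint (S.pair s) (1 - t))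

/-- The surface, with the quotient topology. -/
abbrev Space : Type := Quot S.Rel

/-- The parametrized boundary circle of the surface that corresponds to `b`.  All these circles run
in the direction given by one orientation of the surface. -/
def boundaryPoint (b : S.B) (x : UnitAddCircle) : S.Space :=
  Quot.mk S.Rel ⟨b, x, 1⟩

/-- The permutation sending each side to the next side of the same polygon. -/
def next : Equiv.Perm S.Side :=
  Equiv.sigmaCongrRight fun b => finRotate (S.len b)

/-- The vertices of the polygonal decomposition of the surface.  If `s` starts at a vertex, then
`S.pair s` ends there, and so `S.next (S.pair s)` starts there; going around a vertex in this way
one meets all the sides that start at it. -/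
abbrev Vertex : Type :=
  Quotient (Equiv.Perm.SameCycle.setoid (S.pair.trans S.next))

/-- The edges of the polygonal decomposition: the sides up to pairing. -/
abbrev Edge : Type :=
  Quotient (Equiv.Perm.SameCycle.setoid S.pair)

/-- The Euler characteristic; the annular faces contribute `0`. -/
noncomputable def eulerChar : ℤ := (Nat.card S.Vertex : ℤ) - Nat.card S.Edge

end PolygonSurface

/-! ## Diffeomorphisms of the 3-torus and their action on first homology -/

/-- The 3-torus `ℝ³/ℤ³`; its first homology group is `ℤ³`. -/
abbrev Torus3 : Type := UnitAddTorus (Fin 3)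

/-- The universal covering `ℝ³ → ℝ³/ℤ³`. -/
def torusProj (x : Fin 3 → ℝ) : Torus3 := fun i => (x i : UnitAddCircle)

/-- The homeomorphism `h` of the 3-torus is a diffeomorphism, and acts on `H₁(T³; ℤ) = ℤ³` by the
integer matrix `A`: it lifts to a diffeomorphism `H` of `ℝ³`, and `A` describes the effect of `h`
on the deck transformations. -/
def IsTorusDiffeo (h : Torus3 ≃ₜ Torus3) (A : Matrix (Fin 3) (Fin 3) ℤ) : Prop :=
  ∃ H : (Fin 3 → ℝ) ≃ (Fin 3 → ℝ),
    ContDiff ℝ ∞ H ∧ ContDiff ℝ ∞ H.symm ∧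
    (∀ x, torusProj (H x) = h (torusProj x)) ∧
    ∀ (x : Fin 3 → ℝ) (n : Fin 3 → ℤ),
      H (x + fun i => (n i : ℝ)) = H x + fun i => ((A.mulVec n i : ℤ) : ℝ)

/-- The inclusion `F_v = H₁(T²) = ℤ² → L_w = H₁(S¹ × T²) = ℤ³` of the fibre group. -/
def fiberIncl : (Fin 2 → ℤ) →+ (Fin 3 → ℤ) where
  toFun f := ![0, f 0, f 1]
  map_zero' := by ext i; fin_cases i <;> rfl
  map_add' f g := by ext i; fin_cases i <;> rfl

/-- The fibre group `F_w` as a subgroup of `L_w`. -/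
def fiberGroup : AddSubgroup (Fin 3 → ℤ) := fiberIncl.range

/-- The image in `L_w` of the fibre group `F_{-w}` under the isomorphism `L_{-w} → L_w` with
matrix `A`. -/
def fiberImage (A : Matrix (Fin 3) (Fin 3) ℤ) : AddSubgroup (Fin 3 → ℤ) :=
  fiberGroup.map A.mulVecLin.toAddMonoidHom

/-! ## 4-dimensional graph-manifolds -/

/-- Gluing data for a 4-dimensional graph-manifold with trivialized oriented blocks
`M_v = Φ_v × T²`.  The boundary tori of the blocks (the directed edges `w` of the dual graph) are
`γ_w × T²`, `γ_w` running over the boundary circles of `Φ_v`; through the parametrization of `γ_w`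
they are identified with `ℝ³/ℤ³`, the coordinate `0` being the one along `γ_w`. -/
structure GraphGluing where
  /-- The set of blocks, that is, of vertices of the dual graph. -/
  V : Type
  finite_V : Finite V
  /-- The base surfaces of the blocks. -/
  surf : V → PolygonSurface
  surf_connected : ∀ v, ConnectedSpace (surf v).Space
  /-- The base surface is neither a disc nor an annulus: among the compact connected oriented
  surfaces with non-empty boundary these are the ones with Euler characteristic `1` and `0`,
  and all others have negative Euler characteristic. -/
  surf_eulerChar : ∀ v, (surf v).eulerChar < 0
  /-- The map `w ↦ -w` on boundary tori of blocks: `w` and `-w` are glued to each other. -/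
  op : (Σ v, (surf v).B) → (Σ v, (surf v).B)
  op_op : ∀ w, op (op w) = w
  op_ne : ∀ w, op w ≠ w
  /-- The gluing diffeomorphism `T_{-w} → T_w`. -/
  glue : (Σ v, (surf v).B) → (Torus3 ≃ₜ Torus3)
  glue_op : ∀ w, glue (op w) = (glue w).symm
  /-- The matrix of the isomorphism `L_{-w} → L_w` induced by the gluing: its columns are the
  coordinates of `z_{-w}, f¹_{-w}, f²_{-w}` with respect to `z_w, f¹_w, f²_w`. -/
  mat : (Σ v, (surf v).B) → Matrix (Fin 3) (Fin 3) ℤ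
  glue_diffeo : ∀ w, IsTorusDiffeo (glue w) (mat w)
  /-- The gluings reverse the boundary orientations, so that the orientations of the blocks fit
  together to an orientation of the manifold. -/
  det_mat : ∀ w, (mat w).det = -1
  /-- The gluings do not identify the homotopy classes of the fibre tori. -/
  fiber_ne : ∀ w, fiberImage (mat w) ≠ fiberGroup

namespace GraphGluing

variable (M : GraphGluing)

/-- The directed edges of the dual graph, that is, the boundary tori of the blocks. -/
abbrev W : Type := Σ v, (M.surf v).B

/-- The disjoint union of the blocks `Φ_v × T²`. -/
abbrev Blocks : Type := Σ v, (M.surf v).Space × UnitAddTorus (Fin 2)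

/-- The parametrized boundary torus `T_w` of a block. -/
def boundaryTorus (w : M.W) (x : Torus3) : M.Blocks :=
  ⟨w.1, (M.surf w.1).boundaryPoint w.2 (x 0), ![x 1, x 2]⟩

/-- A point `x` of `T_{-w}` is glued to its image in `T_w`. -/
inductive Rel : M.Blocks → M.Blocks → Prop
  | glue (w : M.W) (x : Torus3) :
      Rel (M.boundaryTorus (M.op w) x) (M.boundaryTorus w (M.glue w x))

/-- The closed 4-manifold glued from the blocks, with the quotient topology. -/
abbrev Space : Type := Quot M.Rel

/-- The intersection number `i_w`: the greatest common divisor of the row `b_w` of the gluing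
matrix. -/
def intersectionNumber (w : M.W) : ℕ := Int.gcd (M.mat w 0 1) (M.mat w 0 2)

/-- The intersection lattice `P_{|w|} = F_w ∩ F_{-w}` as a subgroup of the fibre group
`F_v = ℤ²` of the block `v` that `w` belongs to. -/
def intersectionLattice (w : M.W) : AddSubgroup (Fin 2 → ℤ) :=
  (fiberGroup ⊓ fiberImage (M.mat w)).comap fiberIncl

/-- The type of a block: the maximal number of pairwise non-parallel edges at `v`, that is,
the number of different intersection lattices at `v`. -/
noncomputable def type (v : M.V) : ℕ :=
  (Set.range fun b : (M.surf v).B => M.intersectionLattice ⟨v, b⟩).ncard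

open Classical in
/-- The group `P_v`: the subgroup of `F_v` generated by the intersection lattices at `v` if these
are at least two, and the whole of `F_v` otherwise. -/
noncomputable def fiberIntersectionGroup (v : M.V) : AddSubgroup (Fin 2 → ℤ) :=
  if 2 ≤ M.type v then ⨆ b : (M.surf v).B, M.intersectionLattice ⟨v, b⟩ else ⊤

/-- The secondary intersection number `j_v = (F_v : P_v)`. -/
noncomputable def secondaryIntersectionNumber (v : M.V) : ℕ :=
  (M.fiberIntersectionGroup v).index

end GraphGluing

/-- A (connected) 4-dimensional graph-manifold. -/
structure GraphManifold extends GraphGluing where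
  connected : ConnectedSpace toGraphGluing.Space

/-! ## Quasi-isometry of finitely generated groups -/

/-- The word length of `g` with respect to `S`. -/
noncomputable def wordLength {G : Type*} [Group G] (S : Set G) (g : G) : ℕ :=
  sInf {n | ∃ l : List G, (∀ s ∈ l, s ∈ S ∨ s⁻¹ ∈ S) ∧ l.prod = g ∧ l.length = n}

/-- `G` and `H` are finitely generated, and quasi-isometric with respect to the word metrics
`d(a, b) = |a⁻¹ b|` of finite generating sets. -/
def QuasiIsometricGroups (G H : Type*) [Group G] [Group H] : Prop :=
  ∃ (S : Set G) (T : Set H), S.Finite ∧ T.Finite ∧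
    Subgroup.closure S = ⊤ ∧ Subgroup.closure T = ⊤ ∧
    ∃ (f : G → H) (K C : ℝ), 1 ≤ K ∧ 0 ≤ C ∧
      (∀ a b : G,
        K⁻¹ * (wordLength S (a⁻¹ * b) : ℝ) - C ≤ wordLength T ((f a)⁻¹ * f b) ∧
        (wordLength T ((f a)⁻¹ * f b) : ℝ) ≤ K * wordLength S (a⁻¹ * b) + C) ∧
      ∀ h : H, ∃ a : G, (wordLength T ((f a)⁻¹ * h) : ℝ) ≤ C

/-! ## Word metrics and subgroups of finite index -/

section WordMetric

variable {G H : Type*} [Group G] [Group H]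

/-! Let `P_v` be the subgroup of `F_v` generated by the intersection lattices at `v`, or `F_v`
itself if these lattices all agree. It has finite index, because two different intersection lattices
span `ℚ²`. For a boundary torus `w` of `v` that is glued to a torus of `v'`, put `Λ_w = P_v +
P_{v'}` inside `L_w`. The gluing carries `Λ_{-w}` to `Λ_w`, and `Λ_w ∩ F_w = P_v`, because `P_w ⊆
P_v`. Suppose that `N` covers every `T_w` with lattice `n Λ_w` and every fibre with lattice `n P_v`.
Upstairs the two fibre groups generate the homology of the torus, so `i_w = 1`. If the type is at
least two, the intersection lattices generate the fibre group, so `j_v = 1`. The common factor `n`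
cancels from the gluing matrices.

To build `N`, write a basis of `Λ_w` as `blk k f C`, with the columns of `C` spanning `P_v`. A block
is covered by a product of a surface covering, of degree `n k` on the circles over `w`, and the
fibre covering `n C`, sheared by a map from the surface to `T²` of degree `n f` on the boundary
circles. Such a map exists when the vectors `f` sum to zero. Each `f` is free modulo `P_v`, and the
sum can be corrected once the number of circles over each circle is divisible by an exponent `e`
with `e F_v ⊆ P_v` (`exists_twist_values`, `exists_twist`).

The surface coverings are built combinatorially (`RibbonGraph.exists_cover`). Negative Euler
characteristic leaves two edges off a spanning tree. They support a double covering in which a given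
face lifts to two faces, and a flow between these two faces gives the prescribed degree on that
face. A fibre product treats all faces at once.

The index `k det C` of `Λ_w` is the same on both sides of a gluing. Hence suitable numbers of copies
of the blocks have equally many tori over `w` and `-w`, and can be glued; a connected component is
`N`. Positive determinants preserve orientations.

Finally, `π₁(N)` embeds in `π₁(M)` with finite index. The group `π₁(M)` is finitely generated
because `M` is compact and every point has a neighbourhood contractible in `M`. Schreier rewriting
gives the quasi-isometry. -/

theorem wordLength_prod_le {S : Set G} {l : List G} (hl : ∀ s ∈ l, s ∈ S ∨ s⁻¹ ∈ S) :
    wordLength S l.prod ≤ l.length :=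
  Nat.sInf_le ⟨l, hl, rfl, rfl⟩

theorem exists_list_wordLength {S : Set G} (hS : Subgroup.closure S = ⊤) (g : G) :
    ∃ l : List G, (∀ s ∈ l, s ∈ S ∨ s⁻¹ ∈ S) ∧ l.prod = g ∧ l.length = wordLength S g := by
  have hne : {n | ∃ l : List G, (∀ s ∈ l, s ∈ S ∨ s⁻¹ ∈ S) ∧ l.prod = g ∧ l.length = n}.Nonempty := by
    have hg : g ∈ (Subgroup.closure S).toSubmonoid := by simp [hS]
    rw [Subgroup.closure_toSubmonoid] at hg
    obtain ⟨l, hl, hg⟩ := Submonoid.exists_list_of_mem_closure hg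
    exact ⟨_, l, fun s hs => by simpa using hl s hs, hg, rfl⟩
  exact Nat.sInf_mem hne

theorem wordLength_mul_le {S : Set G} (hS : Subgroup.closure S = ⊤) (a b : G) :
    wordLength S (a * b) ≤ wordLength S a + wordLength S b := by
  obtain ⟨l, hl, rfl, h1⟩ := exists_list_wordLength hS a
  obtain ⟨l', hl', rfl, h2⟩ := exists_list_wordLength hS b
  rw [← List.prod_append, ← h1, ← h2, ← List.length_append]
  refine wordLength_prod_le fun s hs => ?_
  rcases List.mem_append.1 hs with h | h
  exacts [hl s h, hl' s h]

theorem wordLength_inv_le {S : Set G} (hS : Subgroup.closure S = ⊤) (a : G) :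
    wordLength S a⁻¹ ≤ wordLength S a := by
  obtain ⟨l, hl, rfl, h1⟩ := exists_list_wordLength hS a
  rw [List.prod_inv_reverse, ← h1]
  refine (wordLength_prod_le fun s hs => ?_).trans (by simp)
  simp only [List.mem_reverse, List.mem_map] at hs
  obtain ⟨t, ht, rfl⟩ := hs
  simpa using (hl t ht).symm

theorem wordLength_list_prod_le {S : Set G} (hS : Subgroup.closure S = ⊤) {K : ℕ} (l : List G)
    (hl : ∀ s ∈ l, wordLength S s ≤ K) : wordLength S l.prod ≤ K * l.length := by
  induction l with
  | nil => simpa using wordLength_prod_le (S := S) (l := []) (by simp)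
  | cons a l ih =>
    rw [List.prod_cons, List.length_cons]
    have h1 := wordLength_mul_le hS a l.prod
    have h2 := hl a (by simp)
    have h3 := ih fun s hs => hl s (by simp [hs])
    nlinarith

/-- Schreier rewriting: a product of letters `t` telescopes into a product of the elements
`r h * t * (r (h * t))⁻¹`. -/
theorem exists_schreier_list {T : Set H} (r : H → H) (l : List H)
    (hl : ∀ t ∈ l, t ∈ T ∨ t⁻¹ ∈ T) (h : H) :
    ∃ l' : List H, l'.length = l.length ∧ l'.prod = r h * l.prod * (r (h * l.prod))⁻¹ ∧
      ∀ s ∈ l', ∃ a t, (t ∈ T ∨ t⁻¹ ∈ T) ∧ s = r a * t * (r (a * t))⁻¹ := by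
  induction l generalizing h with
  | nil => exact ⟨[], rfl, by simp, by simp⟩
  | cons t l ih =>
    obtain ⟨l', h1, h2, h3⟩ := ih (fun s hs => hl s (by simp [hs])) (h * t)
    refine ⟨(r h * t * (r (h * t))⁻¹) :: l', by simp [h1], ?_, ?_⟩
    · rw [List.prod_cons, h2, List.prod_cons, mul_assoc h t]; group
    · intro s hs
      rcases List.mem_cons.1 hs with rfl | hs
      · exact ⟨h, t, hl t (by simp), rfl⟩
      · exact h3 s hs

/-- A finitely generated group is quasi-isometric to its subgroups of finite index. -/
theorem quasiIsometricGroups_of_finiteIndex (φ : G →* H) (hφ : Function.Injective φ)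
    (hfin : φ.range.FiniteIndex) (hH : Group.FG H) : QuasiIsometricGroups G H := by
  classical
  obtain ⟨T, hT, hTf⟩ := (Group.fg_iff (G := H)).1 hH
  have hQ : Finite (H ⧸ φ.range) := inferInstance
  -- The two inversions turn left cosets into right ones: `r h` represents `φ.range * h`.
  let r : H → H := fun h => (Quotient.out (QuotientGroup.mk h⁻¹ : H ⧸ φ.range))⁻¹
  have hr : ∀ h, h * (r h)⁻¹ ∈ φ.range := by
    intro h
    obtain ⟨k, hk⟩ := QuotientGroup.mk_out_eq_mul φ.range h⁻¹
    have : h * (r h)⁻¹ = k := by simp [r, hk]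
    rw [this]; exact k.2
  have hrf : (Set.range r).Finite := by
    have : Set.range r ⊆ Set.range fun q : H ⧸ φ.range => (Quotient.out q)⁻¹ := by
      rintro _ ⟨h, rfl⟩; exact ⟨_, rfl⟩
    exact (Set.finite_range _).subset this
  have hr1 : ∀ h ∈ φ.range, r h = r 1 := by
    intro h hh
    have : (QuotientGroup.mk h⁻¹ : H ⧸ φ.range) = QuotientGroup.mk (1 : H)⁻¹ := by
      rw [QuotientGroup.eq]; simpa using hh
    simp only [r, this]
  have hr1m : r 1 ∈ φ.range := by simpa using hr 1
  let T' : Set H := T ∪ T⁻¹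
  have hT'f : T'.Finite := hTf.union hTf.inv
  -- Schreier generators together with `r 1`, which need not be the identity.
  let U : Set H := {r 1} ∪ Set.image2 (fun a b => a * b) (Set.image2 (fun a b => a * b) (Set.range r) T')
    ((Set.range r)⁻¹)
  have hUf : U.Finite := (Set.finite_singleton _).union ((hrf.image2 _ hT'f).image2 _ hrf.inv)
  let S : Set G := φ ⁻¹' U
  have hSf : S.Finite := hUf.preimage hφ.injOn
  have key : ∀ g : G, ∃ l : List G, (∀ s ∈ l, s ∈ S ∨ s⁻¹ ∈ S) ∧ l.prod = g ∧
      l.length ≤ wordLength T (φ g) + 2 := by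
    intro g
    obtain ⟨l, hl, hlp, hll⟩ := exists_list_wordLength hT (φ g)
    obtain ⟨l', h1, h2, h3⟩ := exists_schreier_list r l hl 1
    have h4 : ∀ s ∈ l', s ∈ U ∧ s ∈ φ.range := by
      intro s hs
      obtain ⟨a, t, ht, rfl⟩ := h3 s hs
      refine ⟨Or.inr ⟨_, ⟨_, ⟨a, rfl⟩, t, ?_, rfl⟩, _, ?_, rfl⟩, ?_⟩
      · rcases ht with h | h
        · exact Or.inl h
        · exact Or.inr h
      · simp
      · have e : r a * t * (r (a * t))⁻¹ = (a * (r a)⁻¹)⁻¹ * ((a * t) * (r (a * t))⁻¹) := by group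
        rw [e]; exact mul_mem (inv_mem (hr _)) (hr _)
    obtain ⟨g0, hg0⟩ := hr1m
    choose! ψ hψ using fun (s : H) (hs : s ∈ φ.range) => hs
    -- The rewritten word has value `r 1 * φ g * (r 1)⁻¹`. The letter `g0` over `r 1` undoes this
    -- conjugation and accounts for the additive constant 2.
    refine ⟨g0⁻¹ :: (l'.map ψ ++ [g0]), ?_, ?_, ?_⟩
    · intro s hs
      simp only [List.mem_cons, List.mem_append, List.mem_map, List.not_mem_nil, or_false] at hs
      have hg0S : g0 ∈ S := Or.inl hg0
      rcases hs with rfl | ⟨s, hs, rfl⟩ | rfl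
      · right; simpa using hg0S
      · left
        change φ _ ∈ U
        rw [hψ s (h4 s hs).2]; exact (h4 s hs).1
      · exact Or.inl hg0S
    · apply hφ
      have : (l'.map ψ).map φ = l' := by
        rw [List.map_map]
        conv_rhs => rw [← List.map_id l']
        exact List.map_congr_left fun s hs => hψ s (h4 s hs).2
      rw [List.prod_cons, List.prod_append, map_mul, map_mul, map_list_prod, this, h2, hlp, one_mul,
        hr1 (φ g) ⟨g, rfl⟩, List.prod_singleton, map_inv, hg0]
      group
    · simp only [List.length_cons, List.length_append, List.length_map, List.length_nil]
      omega
  have hS : Subgroup.closure S = ⊤ := by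
    rw [eq_top_iff]
    rintro g -
    obtain ⟨l, hl, rfl, -⟩ := key g
    refine list_prod_mem fun s hs => ?_
    rcases hl s hs with h | h
    · exact Subgroup.subset_closure h
    · simpa using inv_mem (Subgroup.subset_closure h)
  obtain ⟨K1, hK1⟩ : ∃ K : ℕ, ∀ s ∈ S, wordLength T (φ s) ≤ K := by
    obtain ⟨K, hK⟩ := (hSf.image fun s => wordLength T (φ s)).bddAbove
    exact ⟨K, fun s hs => hK ⟨s, hs, rfl⟩⟩
  obtain ⟨K2, hK2⟩ : ∃ K : ℕ, ∀ h, wordLength T (r h) ≤ K := by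
    obtain ⟨K, hK⟩ := (hrf.image fun s => wordLength T s).bddAbove
    exact ⟨K, fun h => hK ⟨_, ⟨h, rfl⟩, rfl⟩⟩
  have upper : ∀ g, wordLength T (φ g) ≤ K1 * wordLength S g := by
    intro g
    obtain ⟨l, hl, rfl, h1⟩ := exists_list_wordLength hS g
    rw [← h1, map_list_prod]
    refine (wordLength_list_prod_le hT (K := K1) (l.map φ) ?_).trans (by simp)
    intro s hs
    obtain ⟨s, hs', rfl⟩ := List.mem_map.1 hs
    rcases hl s hs' with h | h
    · exact hK1 s h
    · have := wordLength_inv_le hT (φ s⁻¹)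
      rw [map_inv, inv_inv] at this
      exact this.trans (by simpa using hK1 _ h)
  have lower : ∀ g, wordLength S g ≤ wordLength T (φ g) + 2 := by
    intro g
    obtain ⟨l, hl, rfl, h1⟩ := key g
    exact (wordLength_prod_le hl).trans h1
  refine ⟨S, T, hSf, hTf, hS, hT, φ, K1 + 1, K2 + 2, by simp, by positivity, fun a b => ?_, fun h => ?_⟩
  · rw [← map_inv, ← map_mul]
    have h1 : (wordLength T (φ (a⁻¹ * b)) : ℝ) ≤ K1 * wordLength S (a⁻¹ * b) := by
      exact_mod_cast upper _
    have h2 : (wordLength S (a⁻¹ * b) : ℝ) ≤ wordLength T (φ (a⁻¹ * b)) + 2 := by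
      exact_mod_cast lower _
    have h0 : (0 : ℝ) ≤ wordLength S (a⁻¹ * b) := by positivity
    have hK2 : (0 : ℝ) ≤ K2 := by positivity
    constructor
    · have h3 : ((K1 : ℝ) + 1)⁻¹ * wordLength S (a⁻¹ * b) ≤ 1 * wordLength S (a⁻¹ * b) := by
        apply mul_le_mul_of_nonneg_right _ h0
        exact inv_le_one_of_one_le₀ (by simp)
      linarith
    · linarith
  · obtain ⟨a, ha⟩ := hr h
    refine ⟨a, ?_⟩
    have : (φ a)⁻¹ * h = r h := by rw [ha]; group
    rw [this]
    have : (wordLength T (r h) : ℝ) ≤ K2 := by exact_mod_cast hK2 h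
    linarith

end WordMetric

/-! ## Fundamental groups of finite coverings -/

section Covering

variable {E X : Type*} [TopologicalSpace E] [TopologicalSpace X] {p : E → X}

/-- The stabilizer of `e` under monodromy has finite index because the fibre is finite. A loop in it
lifts to a loop at `e`, so the stabilizer lies in the image of the fundamental group upstairs. -/
theorem IsCoveringMap.finiteIndex_range_map (cov : IsCoveringMap p) (e : E)
    (hfin : (p ⁻¹' {p e}).Finite) :
    (FundamentalGroup.map ⟨p, cov.continuous⟩ e).range.FiniteIndex := by
  let := cov.fundamentalGroupMulAction (p e)
  have : Finite (p ⁻¹' {p e}) := hfin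
  have hst : (MulAction.stabilizer (FundamentalGroup X (p e)) (⟨e, rfl⟩ : p ⁻¹' {p e})).FiniteIndex := by
    refine Subgroup.finiteIndex_iff_finite_quotient.2 ?_
    exact Finite.of_injective _ (MulAction.injective_ofQuotientStabilizer _ _)
  refine Subgroup.finiteIndex_of_le (H := MulAction.stabilizer _ (⟨e, rfl⟩ : p ⁻¹' {p e})) ?_
  intro γ hγ
  have hγ' : cov.monodromy γ ⟨e, rfl⟩ = ⟨e, rfl⟩ := hγ
  have hm := cov.map_liftPathQuotient γ ⟨e, rfl⟩
  generalize cov.liftPathQuotient γ ⟨e, rfl⟩ = Γ at hm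
  have h2 := (cov.monodromy γ ⟨e, rfl⟩).2
  revert Γ h2
  rw [hγ']
  intro Γ hm h2
  exact ⟨Γ, hm.trans (Path.Homotopic.Quotient.cast_rfl_rfl _)⟩

theorem IsCoveringMap.quasiIsometricGroups [PathConnectedSpace X] (cov : IsCoveringMap p)
    (hfin : ∀ x, (p ⁻¹' {x}).Finite) (e : E) (x : X) (hfg : Group.FG (FundamentalGroup X x)) :
    QuasiIsometricGroups (FundamentalGroup E e) (FundamentalGroup X x) := by
  let φ := FundamentalGroup.fundamentalGroupMulEquivOfPathConnected (p e) x
  have hfg' : Group.FG (FundamentalGroup X (p e)) :=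
    have := hfg
    Group.fg_of_surjective (f := φ.symm.toMonoidHom) φ.symm.surjective
  let ψ := FundamentalGroup.map ⟨p, cov.continuous⟩ e
  have hψ : Function.Injective ψ := cov.injective_path_homotopic_map e e
  have hψf : ψ.range.FiniteIndex := cov.finiteIndex_range_map e (hfin _)
  refine quasiIsometricGroups_of_finiteIndex (φ.toMonoidHom.comp ψ) (φ.injective.comp hψ) ?_ hfg
  rw [MonoidHom.range_comp]
  constructor
  have := Subgroup.index_map_equiv ψ.range φ
  erw [this]
  exact hψf.index_ne_zero

end Covering

/-! ### Finite generation of fundamental groups of compact spaces -/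

section FiniteGeneration

open CategoryTheory Topology Uniformity

variable {X : Type*} [TopologicalSpace X]

/-- The homotopy class of a path, as a morphism of the fundamental groupoid. -/
abbrev pathClass {a b : X} (γ : Path a b) : FundamentalGroupoid.mk a ⟶ FundamentalGroupoid.mk b :=
  Path.Homotopic.Quotient.mk γ

theorem pathClass_trans {a b c : X} (γ : Path a b) (γ' : Path b c) :
    pathClass (γ.trans γ') = pathClass γ ≫ pathClass γ' := rfl

theorem pathClass_symm {a b : X} (γ : Path a b) :
    pathClass γ.symm = Groupoid.inv (pathClass γ) := rfl

theorem pathClass_subpath_comp {a b : X} (γ : Path a b) (t₀ t₁ t₂ : unitInterval) :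
    pathClass (γ.subpath t₀ t₁) ≫ pathClass (γ.subpath t₁ t₂) = pathClass (γ.subpath t₀ t₂) :=
  Path.Homotopic.Quotient.eq.2 ⟨Path.Homotopy.subpathTransSubpath γ t₀ t₁ t₂⟩

/-- Homotopies of paths are controlled in `U`: any two paths in `U` with the same endpoints are
homotopic in the ambient space. -/
def PathsHomotopicIn (U : Set X) : Prop :=
  ∀ (a b : X) (γ γ' : Path a b), Set.range γ ⊆ U → Set.range γ' ⊆ U → γ.Homotopic γ'

theorem PathsHomotopicIn.mono {U V : Set X} (h : PathsHomotopicIn V) (hUV : U ⊆ V) :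
    PathsHomotopicIn U :=
  fun a b γ γ' h1 h2 => h a b γ γ' (h1.trans hUV) (h2.trans hUV)

/-- A Lebesgue entourage, halved twice, makes a chain of three neighbourhoods fit into one of the
given sets. -/
theorem exists_pathConnected_nhds_of_pathsHomotopicIn [CompactSpace X] [T2Space X]
    [LocallyPathConnectedSpace X] (h : ∀ x : X, ∃ U ∈ 𝓝 x, PathsHomotopicIn U) :
    ∃ V : X → Set X, (∀ x, IsOpen (V x)) ∧ (∀ x, V x ∈ 𝓝 x) ∧ (∀ x, IsPathConnected (V x)) ∧
      ∀ x y z, (V x ∩ V y).Nonempty → (V z ∩ V y).Nonempty →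
        PathsHomotopicIn (V x ∪ V y ∪ V z) := by
  let : UniformSpace X := uniformSpaceOfCompactR1
  choose U hU hUh using h
  obtain ⟨E, hE, hEU⟩ := lebesgue_number_lemma_nhds (K := (Set.univ : Set X)) isCompact_univ
    (U := U) fun x _ => hU x
  obtain ⟨E', hE', hEs, hEE⟩ := comp_symm_mem_uniformity_sets hE
  obtain ⟨E'', hE'', hEs', hEE'⟩ := comp_symm_mem_uniformity_sets hE'
  have hex : ∀ x : X, ∃ V, IsOpen V ∧ V ∈ 𝓝 x ∧ IsPathConnected V ∧
      V ⊆ UniformSpace.ball x E'' := by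
    intro x
    obtain ⟨V, ⟨h0, h1, h2⟩, h3⟩ := (isOpen_isPathConnected_basis x).mem_iff.1 (UniformSpace.ball_mem_nhds x hE'')
    exact ⟨V, h0, h0.mem_nhds h1, h2, h3⟩
  choose V hVo hV hVc hVE using hex
  have hsmall : ∀ x, ∀ a ∈ V x, ∀ b ∈ V x, (a, b) ∈ E' := by
    intro x a ha b hb
    exact hEE' ⟨x, SetRel.symm _ (hVE x ha), hVE x hb⟩
  refine ⟨V, hVo, hV, hVc, fun x y z ⟨a, hax, hay⟩ ⟨b, hbz, hby⟩ => ?_⟩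
  obtain ⟨u, hu⟩ := hEU y trivial
  have hy : y ∈ V y := mem_of_mem_nhds (hV y)
  refine (hUh u).mono (Set.Subset.trans ?_ hu)
  rintro c ((hc | hc) | hc)
  · exact hEE ⟨a, hsmall y y hy a hay, hsmall x a hax c hc⟩
  · exact hEE ⟨y, hsmall y y hy y hy, hsmall y y hy c hc⟩
  · exact hEE ⟨b, hsmall y y hy b hby, hsmall z b hbz c hc⟩

/-- The fundamental group of a compact connected space that is locally path connected and
semilocally simply connected is finitely generated. -/
theorem fundamentalGroup_fg [CompactSpace X] [T2Space X] [PathConnectedSpace X]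
    [LocallyPathConnectedSpace X] (h : ∀ x : X, ∃ U ∈ 𝓝 x, PathsHomotopicIn U) (x₀ : X) :
    Group.FG (FundamentalGroup X x₀) := by
  classical
  obtain ⟨V, hVo, hV, hVc, hVh⟩ := exists_pathConnected_nhds_of_pathsHomotopicIn h
  obtain ⟨s, hs⟩ := CompactSpace.elim_nhds_subcover V hV
  let P : ∀ i : X, FundamentalGroupoid.mk x₀ ⟶ FundamentalGroupoid.mk i := fun i =>
    pathClass (PathConnectedSpace.somePath x₀ i)
  -- For fixed `i`, `k`, `j` all admissible `τ` are homotopic, so there is at most one such element.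
  let gens : X → X → X → Set (FundamentalGroup X x₀) := fun i k j =>
    {g | PathsHomotopicIn (V i ∪ V k ∪ V j) ∧ ∃ τ : Path i j, Set.range τ ⊆ V i ∪ V k ∪ V j ∧
      g = P i ≫ pathClass τ ≫ Groupoid.inv (P j)}
  let S : Set (FundamentalGroup X x₀) := ⋃ i ∈ s, ⋃ k ∈ s, ⋃ j ∈ s, gens i k j
  have hSf : S.Finite := by
    refine s.finite_toSet.biUnion fun i _ => s.finite_toSet.biUnion fun k _ =>
      s.finite_toSet.biUnion fun j _ => Set.Subsingleton.finite ?_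
    rintro _ ⟨hg, τ, hτ, rfl⟩ _ ⟨-, τ', hτ', rfl⟩
    have : pathClass τ = pathClass τ' := Path.Homotopic.Quotient.eq.2 (hg _ _ τ τ' hτ hτ')
    rw [this]
  refine (Group.fg_iff).2 ⟨S, ?_, hSf⟩
  let K := Subgroup.closure S
  -- Goodness asks for every choice of end pieces `ra`, `rb`. This makes it stable under
  -- composition: an arbitrary detour through a centre can be inserted at the middle point.
  let good : ∀ {a b : X}, (FundamentalGroupoid.mk a ⟶ FundamentalGroupoid.mk b) → Prop :=
    fun {a b} f => ∀ i ∈ s, ∀ j ∈ s, ∀ (ra : Path a i) (rb : Path b j), Set.range ra ⊆ V i →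
      Set.range rb ⊆ V j →
      (P i ≫ Groupoid.inv (pathClass ra) ≫ f ≫ pathClass rb ≫ Groupoid.inv (P j) :
        FundamentalGroup X x₀) ∈ K
  have hcov : ∀ a : X, ∃ i ∈ s, ∃ r : Path a i, Set.range r ⊆ V i := by
    intro a
    have ha : a ∈ ⋃ x ∈ s, V x := by rw [hs]; trivial
    obtain ⟨i, hi, hai⟩ := Set.mem_iUnion₂.1 ha
    obtain ⟨γ, hγ⟩ := (hVc i).joinedIn a hai i (mem_of_mem_nhds (hV i))
    exact ⟨i, hi, γ, by rintro _ ⟨t, rfl⟩; exact hγ t⟩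
  have hcomp : ∀ {a b c : X} (f : FundamentalGroupoid.mk a ⟶ FundamentalGroupoid.mk b)
      (g : FundamentalGroupoid.mk b ⟶ FundamentalGroupoid.mk c), good f → good g → good (f ≫ g) := by
    intro a b c f g hf hg i hi j hj ra rc hra hrc
    obtain ⟨k, hk, rb, hrb⟩ := hcov b
    have h1 := hf i hi k hk ra rb hra hrb
    have h2 := hg k hk j hj rb rc hrb hrc
    -- The product of the fundamental group composes arrows from right to left, so the factors are
    -- exchanged.
    have h3 := K.mul_mem h2 h1
    have h4 : ((P i ≫ Groupoid.inv (pathClass ra) ≫ f ≫ pathClass rb ≫ Groupoid.inv (P k)) ≫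
        (P k ≫ Groupoid.inv (pathClass rb) ≫ g ≫ pathClass rc ≫ Groupoid.inv (P j)) :
          FundamentalGroup X x₀) ∈ K := h3
    simpa using h4
  have hsmall : ∀ {a b : X} (γ : Path a b) (k : X), k ∈ s → Set.range γ ⊆ V k →
      good (pathClass γ) := by
    intro a b γ k hk hγ i hi j hj ra rb hra hrb
    refine Subgroup.subset_closure (Set.mem_biUnion hi (Set.mem_biUnion hk (Set.mem_biUnion hj ?_)))
    refine ⟨hVh i k j ⟨a, hra ⟨0, by simp⟩, hγ ⟨0, by simp⟩⟩ ⟨b, hrb ⟨0, by simp⟩, hγ ⟨1, by simp⟩⟩,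
      (ra.symm.trans γ).trans rb, ?_, ?_⟩
    · rw [Path.trans_range, Path.trans_range, Path.symm_range]
      exact Set.union_subset_union (Set.union_subset_union hra hγ) hrb
    · rw [pathClass_trans, pathClass_trans, pathClass_symm]
      simp
  have hall : ∀ γ : Path x₀ x₀, good (pathClass γ) := by
    intro γ
    obtain ⟨t, ht0, htm, ⟨n, hn⟩, htc⟩ := exists_monotone_Icc_subset_open_cover_unitInterval
      (c := fun i : s => γ ⁻¹' V i) (fun i => (hVo i).preimage γ.continuous) (by
        intro u _
        have ha : γ u ∈ ⋃ x ∈ s, V x := by rw [hs]; trivial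
        obtain ⟨i, hi, hai⟩ := Set.mem_iUnion₂.1 ha
        exact Set.mem_iUnion.2 ⟨⟨i, hi⟩, hai⟩)
    have hind : ∀ m, good (pathClass (γ.subpath 0 (t m))) := by
      intro m
      induction m with
      | zero =>
        obtain ⟨k, hk, r, hr⟩ := hcov (γ 0)
        rw [ht0]
        refine hsmall _ k hk ?_
        rw [Path.range_subpath]
        rintro _ ⟨u, hu, rfl⟩
        rw [Set.uIcc_self, Set.mem_singleton_iff] at hu
        exact hr ⟨0, by rw [hu, Path.source]⟩
      | succ m ih =>
        obtain ⟨i, hi⟩ := htc m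
        rw [← pathClass_subpath_comp γ 0 (t m)]
        refine hcomp _ _ ih (hsmall _ i i.2 ?_)
        rw [Path.range_subpath_of_le _ _ _ (htm (Nat.le_succ m))]
        rintro _ ⟨u, hu, rfl⟩
        exact hi hu
    have h1 := hind n
    rw [hn n le_rfl, Path.subpath_zero_one] at h1
    intro i hi j hj ra rb hra hrb
    have h2 := h1 i hi j hj (ra.cast γ.source rfl) (rb.cast γ.target rfl) hra hrb
    have h3 : ∀ {a b : X} (h0 : a = x₀) (h1 : b = x₀),
        (P i ≫ Groupoid.inv (pathClass (ra.cast h0 rfl)) ≫ pathClass (γ.cast h0 h1) ≫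
          pathClass (rb.cast h1 rfl) ≫ Groupoid.inv (P j) : FundamentalGroup X x₀) =
        P i ≫ Groupoid.inv (pathClass ra) ≫ pathClass γ ≫ pathClass rb ≫ Groupoid.inv (P j) := by
      rintro a b rfl rfl; rfl
    rwa [h3] at h2
  rw [eq_top_iff]
  rintro g -
  obtain ⟨i, hi, r, hr⟩ := hcov x₀
  let u : FundamentalGroup X x₀ := P i ≫ Groupoid.inv (pathClass r)
  -- Goodness puts a conjugate by `u` into the subgroup. Applying it to the oppositely conjugated
  -- loop returns `g` itself.
  obtain ⟨γ, hγ⟩ := Path.Homotopic.Quotient.mk_surjective (u * g * u⁻¹ : FundamentalGroup X x₀)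
  have h1 := hall γ i hi i hi r r hr hr
  have h2 : (P i ≫ Groupoid.inv (pathClass r) ≫ pathClass γ ≫ pathClass r ≫ Groupoid.inv (P i) :
      FundamentalGroup X x₀) = u⁻¹ * FundamentalGroup.fromArrow (pathClass γ) * u := by
    have : (u⁻¹ : FundamentalGroup X x₀) = pathClass r ≫ Groupoid.inv (P i) := by
      refine inv_eq_of_mul_eq_one_left ?_
      change u ≫ (pathClass r ≫ Groupoid.inv (P i)) = 𝟙 _
      simp [u]
    rw [this]
    change _ = u ≫ (pathClass γ ≫ (pathClass r ≫ Groupoid.inv (P i)))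
    simp [u]
  have h3 : FundamentalGroup.fromArrow (pathClass γ) = (u * g * u⁻¹ : FundamentalGroup X x₀) := hγ
  rw [h2, h3] at h1
  have h4 : u⁻¹ * (u * g * u⁻¹) * u = g := by group
  rwa [h4] at h1

end FiniteGeneration

/-! ### Quotients of compact spaces: separation, coverings, local contractions -/

section Quotients

open Topology Set

variable {A Y : Type*} [TopologicalSpace A] [TopologicalSpace Y]

/-- The quotient of a compact Hausdorff space by a closed equivalence relation is Hausdorff. -/
theorem t2Space_of_isQuotientMap_of_isClosed [CompactSpace A] [T2Space A] {q : A → Y}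
    (hq : IsQuotientMap q) (hc : IsClosed {x : A × A | q x.1 = q x.2}) : T2Space Y := by
  have hcl : IsClosedMap q := by
    intro C hC
    rw [← hq.isClosed_preimage]
    have : q ⁻¹' (q '' C) = Prod.snd '' ({x : A × A | q x.1 = q x.2} ∩ Prod.fst ⁻¹' C) := by
      ext a
      constructor
      · rintro ⟨c, hc, h⟩; exact ⟨(c, a), ⟨h, hc⟩, rfl⟩
      · rintro ⟨⟨c, a⟩, ⟨h, hc⟩, rfl⟩; exact ⟨c, hc, h⟩
    rw [this]
    exact ((hc.inter (hC.preimage continuous_fst)).isCompact.image continuous_snd).isClosed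
  refine ⟨fun y₁ y₂ hne => ?_⟩
  have hfib : ∀ y, IsClosed (q ⁻¹' {y}) := by
    intro y
    obtain ⟨a, rfl⟩ := hq.surjective y
    have : q ⁻¹' {q a} = (fun b => (b, a)) ⁻¹' {x : A × A | q x.1 = q x.2} := by ext; simp
    rw [this]; exact hc.preimage (by fun_prop)
  have hdis : Disjoint (q ⁻¹' {y₁}) (q ⁻¹' {y₂}) := by
    rw [Set.disjoint_left]; rintro a rfl h; exact hne h
  obtain ⟨U₁, U₂, h₁, h₂, hU₁, hU₂, hU⟩ := normal_separation (hfib y₁) (hfib y₂) hdis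
  refine ⟨kernImage q U₁, kernImage q U₂, isClosedMap_iff_kernImage.1 hcl h₁,
    isClosedMap_iff_kernImage.1 hcl h₂, fun a ha => hU₁ ha, fun a ha => hU₂ ha, ?_⟩
  rw [Set.disjoint_left]
  intro y hy1 hy2
  obtain ⟨a, rfl⟩ := hq.surjective y
  exact Set.disjoint_left.1 hU (hy1 rfl) (hy2 rfl)

/-- The relation is the image of a compact parameter space of equivalent pairs. -/
theorem isClosed_setOf_ker_of_compact {A Y : Type*} [TopologicalSpace A] [T2Space A] {K : Type*} [TopologicalSpace K]
    [CompactSpace K] {q : A → Y} {α β : K → A} (hα : Continuous α) (hβ : Continuous β)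
    (hker : ∀ a b, q a = q b ↔ ∃ k, α k = a ∧ β k = b) : IsClosed {x : A × A | q x.1 = q x.2} := by
  have : {x : A × A | q x.1 = q x.2} = Set.range fun k => (α k, β k) := by
    ext ⟨a, b⟩
    simp [hker]
  rw [this]
  exact (isCompact_range (by fun_prop)).isClosed

/-- An open, locally injective continuous map is a local homeomorphism; for compact Hausdorff source
and Hausdorff target such a map is a covering. -/
theorem isCoveringMap_of_open_of_locallyInjective {E X : Type*} [TopologicalSpace E]
    [TopologicalSpace X] [CompactSpace E] [T2Space E] [T2Space X] {p : E → X} (hc : Continuous p)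
    (ho : IsOpenMap p) (hi : IsLocallyInjective p) : IsCoveringMap p := by
  rw [← isLocalHomeomorph_iff_isCoveringMap, isLocalHomeomorph_iff_isOpenEmbedding_restrict]
  intro x
  obtain ⟨U, hU, hxU, hinj⟩ := hi x
  exact ⟨U, hU.mem_nhds hxU, .of_continuous_injective_isOpenMap (hc.comp continuous_subtype_val)
    (injOn_iff_injective.1 hinj) (ho.domRestrict hU)⟩

/-- A map between quotients of compact spaces is a covering if it is induced by an open, locally
injective map along which the two equivalence relations lift uniquely. -/
theorem isCoveringMap_of_quotient {A' Y' K : Type*} [TopologicalSpace A'] [TopologicalSpace Y']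
    [TopologicalSpace K] [CompactSpace K] [CompactSpace A'] [T2Space A'] [T2Space A]
    {q' : A' → Y'} {q : A → Y} (hq' : IsQuotientMap q') (hq : IsQuotientMap q)
    {pre : A' → A} (hpre : Continuous pre) (hpreo : IsOpenMap pre) (hprei : IsLocallyInjective pre)
    (hpres : Function.Surjective pre) {p : Y' → Y} (hp : ∀ a, p (q' a) = q (pre a))
    {α β : K → A'} (hα : Continuous α) (hβ : Continuous β)
    (hker : ∀ a b, q' a = q' b ↔ ∃ k, α k = a ∧ β k = b)
    (hlift : ∀ a c, q (pre a) = q c → ∃ k, α k = a ∧ pre (β k) = c)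
    (huniq : ∀ a b, q' a = q' b → pre a = pre b → a = b) :
    T2Space Y' ∧ T2Space Y ∧ IsCoveringMap p := by
  have hT' : T2Space Y' :=
    t2Space_of_isQuotientMap_of_isClosed hq' (isClosed_setOf_ker_of_compact hα hβ hker)
  have hpc : Continuous p := by
    rw [hq'.continuous_iff]
    have : p ∘ q' = q ∘ pre := funext hp
    rw [this]; exact hq.continuous.comp hpre
  have hself : ∀ k, q' (α k) = q' (β k) := fun k => (hker _ _).2 ⟨k, rfl, rfl⟩
  have hpo : IsOpenMap p := by
    intro U hU
    rw [← hq.isOpen_preimage]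
    have : q ⁻¹' (p '' U) = pre '' (q' ⁻¹' U) := by
      ext a
      constructor
      · rintro ⟨u, hu, h⟩
        obtain ⟨b, rfl⟩ := hq'.surjective u
        rw [hp] at h
        obtain ⟨k, rfl, rfl⟩ := hlift b a h
        exact ⟨β k, by rw [mem_preimage, ← hself]; exact hu, rfl⟩
      · rintro ⟨b, hb, rfl⟩; exact ⟨q' b, hb, hp b⟩
    rw [this]
    exact hpreo _ (hU.preimage hq'.continuous)
  have hps : Function.Surjective p := by
    intro y
    obtain ⟨a, rfl⟩ := hq.surjective y
    obtain ⟨b, rfl⟩ := hpres a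
    exact ⟨q' b, hp b⟩
  -- Two distinct points with the same image never lie in a common open set on which `pre` is
  -- injective, so the squares of such sets cut out this set.
  have hNE : IsClosed {x : A' × A' | pre x.1 = pre x.2 ∧ x.1 ≠ x.2} := by
    have h1 : IsClosed {x : A' × A' | pre x.1 = pre x.2} := isClosed_eq (by fun_prop) (by fun_prop)
    have h2 : {x : A' × A' | pre x.1 = pre x.2 ∧ x.1 ≠ x.2} = {x : A' × A' | pre x.1 = pre x.2} ∩
        (⋃ U : {U : Set A' // IsOpen U ∧ U.InjOn pre}, (U : Set A') ×ˢ (U : Set A'))ᶜ := by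
      ext ⟨a, b⟩
      simp only [mem_ofPred_eq, mem_inter_iff, mem_compl_iff, mem_iUnion, mem_prod, not_exists]
      refine and_congr_right fun hab => ⟨?_, ?_⟩
      · rintro hne ⟨U, hU, hUi⟩ ⟨ha, hb⟩
        exact hne (hUi ha hb hab)
      · rintro h rfl
        obtain ⟨U, hU, hxU, hinj⟩ := hprei a
        exact h ⟨U, hU, hinj⟩ ⟨hxU, hxU⟩
    rw [h2]
    exact h1.inter (isOpen_iUnion fun U => U.2.1.prod U.2.1).isClosed_compl
  -- If `u ≠ v` have the same image, a representative of `u` can be changed until it has the same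
  -- `pre`-image as a given representative of `v`. Hence the set is the image of a compact set. It
  -- misses the diagonal, which gives local injectivity of `p`.
  have hNE' : IsClosed {x : Y' × Y' | p x.1 = p x.2 ∧ x.1 ≠ x.2} := by
    have h1 : {x : Y' × Y' | p x.1 = p x.2 ∧ x.1 ≠ x.2} =
        (fun x : K × A' => (q' (α x.1), q' x.2)) ''
          ((fun x : K × A' => (β x.1, x.2)) ⁻¹' {x : A' × A' | pre x.1 = pre x.2 ∧ x.1 ≠ x.2}) := by
      ext ⟨u, v⟩
      constructor
      · rintro ⟨h, hne⟩
        obtain ⟨a, rfl⟩ := hq'.surjective u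
        obtain ⟨b, rfl⟩ := hq'.surjective v
        simp only [hp] at h
        obtain ⟨k, rfl, hk⟩ := hlift a (pre b) h
        refine ⟨(k, b), ⟨hk, ?_⟩, rfl⟩
        intro (hb : β k = b)
        exact hne ((hself k).trans (congrArg q' hb))
      · rintro ⟨⟨k, b⟩, ⟨h, hne⟩, h2⟩
        simp only [Prod.mk.injEq] at h2
        obtain ⟨rfl, rfl⟩ := h2
        refine ⟨?_, fun h3 => hne (huniq _ _ ?_ h)⟩
        · simp only [hself k, hp]; exact congrArg q h
        · exact (hself k).symm.trans h3
    rw [h1]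
    refine ((hNE.preimage (by fun_prop)).isCompact.image ?_).isClosed
    have := hq'.continuous
    fun_prop
  have hpi : IsLocallyInjective p := by
    intro y
    have h1 : (y, y) ∈ {x : Y' × Y' | p x.1 = p x.2 ∧ x.1 ≠ x.2}ᶜ := by simp
    obtain ⟨U, V, hU, hV, hyU, hyV, hUV⟩ := isOpen_prod_iff.1 hNE'.isOpen_compl y y h1
    refine ⟨U ∩ V, hU.inter hV, ⟨hyU, hyV⟩, fun a ha b hb hab => ?_⟩
    by_contra hne
    exact hUV (mk_mem_prod ha.1 hb.2) ⟨hab, hne⟩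
  have hcY : CompactSpace Y' := ⟨by
    rw [← hq'.surjective.range_eq]; exact isCompact_range hq'.continuous⟩
  -- For the open surjection `p` it suffices that its kernel is closed, and the kernel is the closed
  -- set just found together with the diagonal.
  have hT : T2Space Y := by
    rw [t2Space_iff_of_isOpenQuotientMap ⟨hps, hpc, hpo⟩]
    have : {x : Y' × Y' | p x.1 = p x.2} = {x : Y' × Y' | p x.1 = p x.2 ∧ x.1 ≠ x.2} ∪ diagonal Y' := by
      ext ⟨u, v⟩
      by_cases h : u = v <;> simp [h]
    rw [this]
    exact hNE'.union isClosed_diagonal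
  exact ⟨hT', hT, isCoveringMap_of_open_of_locallyInjective hpc hpo hpi⟩

theorem IsCoveringMap.finite_fiber {E X : Type*} [TopologicalSpace E]
    [TopologicalSpace X] [CompactSpace E] [T1Space X] {p : E → X} (cov : IsCoveringMap p) (x : X) :
    (p ⁻¹' {x}).Finite := by
  have h1 : IsCompact (p ⁻¹' {x}) := (isClosed_singleton.preimage cov.continuous).isCompact
  have : DiscreteTopology (p ⁻¹' {x}) := (cov x).discreteTopology_fiber
  exact h1.finite (isDiscrete_iff_discreteTopology.2 this)

/-- Monodromy along a path is a bijection between the fibres over its ends. -/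
theorem IsCoveringMap.exists_ncard_fiber {E X : Type*} [TopologicalSpace E] [Nonempty E]
    [TopologicalSpace X] [CompactSpace E] [T1Space X] [PathConnectedSpace X] {p : E → X}
    (cov : IsCoveringMap p) : ∃ d : ℕ, 0 < d ∧ ∀ y : X, (p ⁻¹' {y}).ncard = d := by
  obtain ⟨e⟩ := ‹Nonempty E›
  refine ⟨(p ⁻¹' {p e}).ncard, (ncard_pos (cov.finite_fiber _)).2 ⟨e, rfl⟩, fun y => ?_⟩
  have := cov.monodromy_bijective (.mk (PathConnectedSpace.somePath y (p e)))
  rw [← Nat.card_coe_set_eq, ← Nat.card_coe_set_eq]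
  exact Nat.card_congr (Equiv.ofBijective _ this)

/-- A set that can be deformed to a point inside the ambient space. -/
theorem pathsHomotopicIn_of_nullhomotopy {U : Set Y} (F : U × unitInterval → Y) (hF : Continuous F)
    (h0 : ∀ u, F (u, 0) = u) (z : Y) (h1 : ∀ u, F (u, 1) = z) : PathsHomotopicIn U := by
  intro a b γ γ' hγ hγ'
  have haU : a ∈ U := hγ ⟨0, γ.source⟩
  have hbU : b ∈ U := hγ ⟨1, γ.target⟩
  let f : C(U, Y) := ⟨Subtype.val, continuous_subtype_val⟩
  let g : C(U, Y) := ContinuousMap.const U z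
  let H : ContinuousMap.Homotopy f g :=
    { toFun := fun x => F (x.2, x.1)
      continuous_toFun := by fun_prop
      map_zero_left := h0
      map_one_left := h1 }
  have key : ∀ δ : Path a b, Set.range δ ⊆ U →
      Path.Homotopic (δ.trans (H.evalAt ⟨b, hbU⟩)) ((H.evalAt ⟨a, haU⟩).trans (Path.refl z)) := by
    intro δ hδ
    let δ' : Path (⟨a, haU⟩ : U) ⟨b, hbU⟩ :=
      { toFun := fun t => ⟨δ t, hδ ⟨t, rfl⟩⟩
        continuous_toFun := by fun_prop
        source' := by simp
        target' := by simp }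
    have h2 := Path.Homotopic.map_trans_evalAt H δ'
    have e2 : δ'.map g.continuous = Path.refl z := by ext; rfl
    rw [e2] at h2
    exact h2
  -- Both paths, followed by the track of `b` under the homotopy, are homotopic to the track of `a`,
  -- and the track of `b` can be cancelled.
  have h3 : pathClass γ = pathClass γ' := by
    have h4 := (key γ hγ).trans (key γ' hγ').symm
    have h5 : pathClass (γ.trans (H.evalAt ⟨b, hbU⟩)) = pathClass (γ'.trans (H.evalAt ⟨b, hbU⟩)) :=
      Path.Homotopic.Quotient.eq.2 h4
    rw [pathClass_trans, pathClass_trans] at h5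
    exact (CategoryTheory.cancel_mono _).1 h5
  exact Path.Homotopic.Quotient.eq.1 h3

/-- If a neighbourhood of a fibre of a quotient map can be deformed into the fibre, compatibly with
the equivalence relation, then the point of the quotient has a neighbourhood that is contractible
in the quotient. -/
theorem exists_pathsHomotopicIn_of_contraction [CompactSpace A] [T2Space Y] {q : A → Y}
    (hq : Continuous q) (hqs : Function.Surjective q) (z : Y) {N : Set A} (hN : IsOpen N)
    (h : A → unitInterval → A)
    (hc : ContinuousOn (fun x : A × unitInterval => h x.1 x.2) (N ×ˢ univ))
    (h0 : ∀ a ∈ N, h a 0 = a) (h1 : ∀ a ∈ N, q (h a 1) = z)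
    (hcomp : ∀ a ∈ N, ∀ b ∈ N, q a = q b → ∀ t, q (h a t) = q (h b t)) (y : Y)
    (hfib : ∀ a, q a = y → a ∈ N) : ∃ U ∈ 𝓝 y, PathsHomotopicIn U := by
  have hqp : IsProperMap q := hq.isProperMap
  let U : Set Y := kernImage q N
  have hU : IsOpen U := isClosedMap_iff_kernImage.1 hqp.isClosedMap hN
  refine ⟨U, hU.mem_nhds fun a ha => hfib a ha, ?_⟩
  have hUN : ∀ a, q a ∈ U → a ∈ N := fun a ha => ha rfl
  let σ : Y → A := Function.surjInv hqs
  have hσ : ∀ y, q (σ y) = y := Function.surjInv_eq hqs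
  -- The section `σ` is not continuous, but by `hcomp` the value does not depend on it.
  let F : U × unitInterval → Y := fun x => q (h (σ x.1) x.2)
  have hres : IsProperMap (U.restrictPreimage q) := by
    rw [isProperMap_iff_isClosedMap_and_compact_fibers]
    refine ⟨hq.restrictPreimage, hqp.isClosedMap.restrictPreimage U, fun y => ?_⟩
    have h2 := hqp.isCompact_preimage (isCompact_singleton (x := (y : Y)))
    rw [Subtype.isCompact_iff]
    convert h2
    ext a
    constructor
    · rintro ⟨⟨a, ha⟩, h3, rfl⟩; exact congrArg Subtype.val h3
    · intro ha
      exact ⟨⟨a, by rw [mem_preimage, show q a = y from ha]; exact y.2⟩, Subtype.ext ha, rfl⟩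
  -- Properness survives the product with the interval, so the deformation descends continuously to
  -- `U`.
  have hquot : IsQuotientMap (Prod.map (U.restrictPreimage q) (id : unitInterval → unitInterval)) := by
    have hpr := hres.prodMap (isProperMap_id (X := unitInterval))
    refine hpr.isClosedMap.isQuotientMap hpr.continuous ?_
    refine Function.Surjective.prodMap (fun y => ?_) Function.surjective_id
    obtain ⟨a, ha⟩ := hqs y
    exact ⟨⟨a, by rw [mem_preimage, ha]; exact y.2⟩, Subtype.ext ha⟩
  have hF : Continuous F := by
    rw [hquot.continuous_iff]
    have : F ∘ Prod.map (U.restrictPreimage q) id =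
        fun x : (q ⁻¹' U) × unitInterval => q (h x.1 x.2) := by
      funext ⟨⟨a, ha⟩, t⟩
      refine hcomp _ (hUN _ ?_) _ (hUN _ ha) ?_ t
      · rw [hσ]; exact ha
      · exact hσ _
    rw [this]
    refine hq.comp (hc.comp_continuous (f := fun x : (q ⁻¹' U) × unitInterval => ((x.1 : A), x.2))
      (by fun_prop) ?_)
    rintro ⟨⟨a, ha⟩, t⟩
    exact ⟨hUN a ha, trivial⟩
  refine pathsHomotopicIn_of_nullhomotopy F hF (fun u => ?_) z (fun u => ?_)
  · change q (h (σ u) 0) = u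
    rw [h0 _ (hUN _ (by rw [hσ]; exact u.2)), hσ]
  · exact h1 _ (hUN _ (by rw [hσ]; exact u.2))

end Quotients

/-! ## Ribbon graphs and their coverings -/

/-- A finite set of darts with a permutation `nx`, whose cycles are the faces, and a fixed point
free involution `pr`, whose orbits are the edges.  The cycles of `pr.trans nx` are the vertices. -/
structure RibbonGraph where
  D : Type
  finite_D : Finite D
  nx : Equiv.Perm D
  pr : Equiv.Perm D
  pr_pr : ∀ d, pr (pr d) = d
  pr_ne : ∀ d, pr d ≠ d

namespace RibbonGraph

instance (G : RibbonGraph) : Finite G.D := G.finite_D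

variable (G : RibbonGraph)

/-- The permutation that turns around the initial vertex of a dart. -/
def vx : Equiv.Perm G.D := G.pr.trans G.nx

theorem vx_apply (d : G.D) : G.vx d = G.nx (G.pr d) := rfl

theorem vx_pr (d : G.D) : G.vx (G.pr d) = G.nx d := by rw [vx_apply, G.pr_pr]

/-- A union of connected components. -/
def Closed (s : Set G.D) : Prop :=
  (∀ d, G.nx d ∈ s ↔ d ∈ s) ∧ ∀ d, G.pr d ∈ s ↔ d ∈ s

/-- Connectedness (the empty ribbon graph counts as connected). -/
def Conn : Prop := ∀ s : Set G.D, G.Closed s → s.Nonempty → s = Set.univ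

variable {G} in
theorem Closed.pow_nx {s : Set G.D} (hs : G.Closed s) (j : ℕ) (d : G.D) :
    (G.nx ^ j) d ∈ s ↔ d ∈ s := by
  induction j with
  | zero => simp
  | succ j ih => rw [pow_succ', Equiv.Perm.mul_apply, hs.1, ih]

variable {G} in
theorem Closed.compl {s : Set G.D} (hs : G.Closed s) : G.Closed sᶜ :=
  ⟨fun d => not_congr (hs.1 d), fun d => not_congr (hs.2 d)⟩

/-- A map of ribbon graphs. -/
structure Hom (G' G : RibbonGraph) where
  toFun : G'.D → G.D
  map_nx : ∀ d, toFun (G'.nx d) = G.nx (toFun d)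
  map_pr : ∀ d, toFun (G'.pr d) = G.pr (toFun d)

namespace Hom

variable {G} {G' G'' : RibbonGraph}

/-- The map is unramified over the vertices. -/
def Unramified (f : Hom G' G) : Prop :=
  ∀ d (j : ℕ), (G.vx ^ j) (f.toFun d) = f.toFun d → (G'.vx ^ j) d = d

theorem map_nx_pow (f : Hom G' G) (j : ℕ) (d : G'.D) :
    f.toFun ((G'.nx ^ j) d) = (G.nx ^ j) (f.toFun d) := by
  induction j with
  | zero => rfl
  | succ j ih => rw [pow_succ', pow_succ', Equiv.Perm.mul_apply, Equiv.Perm.mul_apply, f.map_nx, ih]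

theorem map_vx (f : Hom G' G) (d : G'.D) : f.toFun (G'.vx d) = G.vx (f.toFun d) := by
  rw [vx_apply, vx_apply, f.map_nx, f.map_pr]

theorem map_vx_pow (f : Hom G' G) (j : ℕ) (d : G'.D) :
    f.toFun ((G'.vx ^ j) d) = (G.vx ^ j) (f.toFun d) := by
  induction j with
  | zero => rfl
  | succ j ih => rw [pow_succ', pow_succ', Equiv.Perm.mul_apply, Equiv.Perm.mul_apply, f.map_vx, ih]

/-- The composition of maps of ribbon graphs. -/
def comp (f : Hom G' G) (g : Hom G'' G') : Hom G'' G where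
  toFun := f.toFun ∘ g.toFun
  map_nx d := by simp [f.map_nx, g.map_nx]
  map_pr d := by simp [f.map_pr, g.map_pr]

theorem card_fiber_nx (f : Hom G' G) (d : G.D) :
    Nat.card {d' // f.toFun d' = G.nx d} = Nat.card {d' // f.toFun d' = d} :=
  (Nat.card_congr (G'.nx.subtypeEquiv fun d' => by rw [f.map_nx]; simp)).symm

theorem card_fiber_pr (f : Hom G' G) (d : G.D) :
    Nat.card {d' // f.toFun d' = G.pr d} = Nat.card {d' // f.toFun d' = d} :=
  (Nat.card_congr (G'.pr.subtypeEquiv fun d' => by rw [f.map_pr]; simp)).symm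

/-- Both permutations carry fibres bijectively to fibres, so the size of a fibre is constant on
components. -/
theorem card_fiber_eq (f : Hom G' G) (hG : G.Conn) (d e : G.D) :
    Nat.card {d' // f.toFun d' = d} = Nat.card {d' // f.toFun d' = e} := by
  have h : {d | Nat.card {d' // f.toFun d' = d} = Nat.card {d' // f.toFun d' = e}} = Set.univ :=
    hG _ ⟨fun d => by simp only [Set.mem_ofPred_eq, f.card_fiber_nx],
      fun d => by simp only [Set.mem_ofPred_eq, f.card_fiber_pr]⟩ ⟨e, rfl⟩
  exact (h ▸ Set.mem_univ d : d ∈ {d | Nat.card {d' // f.toFun d' = d} = _})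

theorem surjective (f : Hom G' G) (hG : G.Conn) [Nonempty G'.D] : Function.Surjective f.toFun := by
  have : Set.range f.toFun = Set.univ := by
    refine hG _ ⟨fun d => ⟨?_, ?_⟩, fun d => ⟨?_, ?_⟩⟩ (Set.range_nonempty _)
    · rintro ⟨e, he⟩
      refine ⟨G'.nx.symm e, G.nx.injective ?_⟩
      rw [← f.map_nx, Equiv.apply_symm_apply, he]
    · rintro ⟨e, rfl⟩; exact ⟨_, f.map_nx e⟩
    · rintro ⟨e, he⟩
      exact ⟨G'.pr e, by rw [f.map_pr, he, G.pr_pr]⟩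
    · rintro ⟨e, rfl⟩; exact ⟨_, f.map_pr e⟩
  exact Set.range_eq_univ.1 this

end Hom

/-! ### Connected components -/

/-- The connected component of a dart. -/
def compSet (d₀ : G.D) : Set G.D := {d | ∀ s, G.Closed s → d₀ ∈ s → d ∈ s}

theorem mem_compSet (d₀ : G.D) : d₀ ∈ G.compSet d₀ := fun _ _ h => h

theorem closed_compSet (d₀ : G.D) : G.Closed (G.compSet d₀) :=
  ⟨fun d => forall_congr' fun _ => forall_congr' fun hs => forall_congr' fun _ => hs.1 d,
    fun d => forall_congr' fun _ => forall_congr' fun hs => forall_congr' fun _ => hs.2 d⟩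

/-- The connected component of a dart as a ribbon graph. -/
abbrev component (d₀ : G.D) : RibbonGraph where
  D := G.compSet d₀
  finite_D := inferInstance
  nx := G.nx.subtypePerm (G.closed_compSet d₀).1
  pr := G.pr.subtypePerm (G.closed_compSet d₀).2
  pr_pr d := Subtype.ext (G.pr_pr d)
  pr_ne d h := G.pr_ne d (congrArg Subtype.val h)

/-- The inclusion of a connected component. -/
def componentHom (d₀ : G.D) : Hom (G.component d₀) G where
  toFun := Subtype.val
  map_nx _ := rfl
  map_pr _ := rfl

theorem componentHom_injective (d₀ : G.D) : Function.Injective (G.componentHom d₀).toFun :=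
  Subtype.val_injective

theorem conn_component (d₀ : G.D) : (G.component d₀).Conn := by
  intro s hs hne
  have key : ∀ s : Set (G.component d₀).D, (G.component d₀).Closed s →
      (⟨d₀, G.mem_compSet d₀⟩ : G.compSet d₀) ∈ s → s = Set.univ := by
    intro s hs h0
    have hcl : G.Closed (Subtype.val '' s : Set G.D) := by
      constructor
      · intro d
        constructor
        · rintro ⟨⟨e, he⟩, hes, h⟩
          have hd : d ∈ G.compSet d₀ := ((G.closed_compSet d₀).1 d).1 (h ▸ he)
          refine ⟨⟨d, hd⟩, (hs.1 _).1 ?_, rfl⟩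
          convert hes using 1
          exact Subtype.ext h.symm
        · rintro ⟨e, hes, rfl⟩
          exact ⟨_, (hs.1 e).2 hes, rfl⟩
      · intro d
        constructor
        · rintro ⟨⟨e, he⟩, hes, h⟩
          have hd : d ∈ G.compSet d₀ := ((G.closed_compSet d₀).2 d).1 (h ▸ he)
          refine ⟨⟨d, hd⟩, (hs.2 _).1 ?_, rfl⟩
          convert hes using 1
          exact Subtype.ext h.symm
        · rintro ⟨e, hes, rfl⟩
          exact ⟨_, (hs.2 e).2 hes, rfl⟩
    ext ⟨d, hd⟩
    simp only [Set.mem_univ, iff_true]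
    obtain ⟨e, he, h⟩ := hd _ hcl ⟨_, h0, rfl⟩
    convert he
    exact h.symm
  by_cases h0 : (⟨d₀, G.mem_compSet d₀⟩ : G.compSet d₀) ∈ s
  · exact key s hs h0
  · have := key sᶜ hs.compl h0
    rw [Set.compl_univ_iff] at this
    exact absurd this hne.ne_empty

/-! ### Coverings from voltages -/

/-- The covering with fibre `X` whose monodromy along the dart `d` is `ρ d`. -/
abbrev voltage (X : Type) [Finite X] (ρ : G.D → Equiv.Perm X) (hρ : ∀ d, ρ (G.pr d) = (ρ d)⁻¹) :
    RibbonGraph where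
  D := G.D × X
  finite_D := inferInstance
  nx := (Equiv.prodShear G.nx ρ)
  pr := (Equiv.prodShear G.pr ρ)
  pr_pr d := by
    ext1
    · exact G.pr_pr _
    · change ρ (G.pr d.1) (ρ d.1 d.2) = d.2
      rw [hρ]; simp
  pr_ne d h := G.pr_ne d.1 (congrArg Prod.fst h)

section Voltage

variable {X : Type} [Finite X] (ρ : G.D → Equiv.Perm X) (hρ : ∀ d, ρ (G.pr d) = (ρ d)⁻¹)

/-- The projection of a voltage covering. -/
def voltageHom : Hom (G.voltage X ρ hρ) G where
  toFun := Prod.fst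
  map_nx _ := rfl
  map_pr _ := rfl

theorem voltage_nx (d : G.D) (x : X) : (G.voltage X ρ hρ).nx (d, x) = (G.nx d, ρ d x) := rfl

theorem voltage_pr (d : G.D) (x : X) : (G.voltage X ρ hρ).pr (d, x) = (G.pr d, ρ d x) := rfl

/-- The voltage picked up on crossing the edge is lost again by `nx`, which is applied to the
reversed dart. Voltage coverings are therefore unramified at vertices and ramify only over faces,
where discs have been removed. -/
theorem voltage_vx (d : G.D) (x : X) : (G.voltage X ρ hρ).vx (d, x) = (G.vx d, x) := by
  rw [vx_apply, voltage_pr, voltage_nx, hρ, vx_apply]; simp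

theorem voltage_vx_pow (d : G.D) (x : X) (j : ℕ) :
    ((G.voltage X ρ hρ).vx ^ j) (d, x) = ((G.vx ^ j) d, x) := by
  induction j with
  | zero => rfl
  | succ j ih =>
    rw [pow_succ', pow_succ', Equiv.Perm.mul_apply, Equiv.Perm.mul_apply, ih, voltage_vx]

theorem voltageHom_unramified : (G.voltageHom ρ hρ).Unramified := by
  rintro ⟨d, x⟩ j h
  change (G.vx ^ j) d = d at h
  rw [voltage_vx_pow, h]

end Voltage

/-- Two edges (through `d₁` and `d₂`) whose complement in the graph of vertices and edges is still
connected. -/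
def ConnOff (d₁ d₂ : G.D) : Prop :=
  ∀ s : Set G.D, (∀ d, G.vx d ∈ s ↔ d ∈ s) →
    (∀ d, d ≠ d₁ → d ≠ G.pr d₁ → d ≠ d₂ → d ≠ G.pr d₂ → (G.pr d ∈ s ↔ d ∈ s)) →
    s.Nonempty → s = Set.univ

/-- Off the two edges the voltage is trivial and the graph is still connected, so each sheet lies in
one component. The voltages on the remaining edges act transitively on the sheets. -/
theorem voltage_conn {d₁ d₂ : G.D} (hoff : G.ConnOff d₁ d₂) {X : Type} [Finite X]
    (ρ : G.D → Equiv.Perm X) (hρ : ∀ d, ρ (G.pr d) = (ρ d)⁻¹)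
    (htriv : ∀ d, d ≠ d₁ → d ≠ G.pr d₁ → d ≠ d₂ → d ≠ G.pr d₂ → ρ d = 1)
    (htrans : ∀ T : Set X, T.Nonempty → (∀ d, ∀ x ∈ T, ρ d x ∈ T) → T = Set.univ) :
    (G.voltage X ρ hρ).Conn := by
  rintro s hs ⟨⟨d₀, x₀⟩, h0⟩
  have hvx : ∀ d x, ((G.vx d, x) : G.D × X) ∈ s ↔ ((d, x) : G.D × X) ∈ s := by
    intro d x
    rw [← G.voltage_vx ρ hρ, vx_apply]
    exact (hs.1 _).trans (hs.2 _)
  have hslice : ∀ x, (∃ d, ((d, x) : G.D × X) ∈ s) → ∀ d, ((d, x) : G.D × X) ∈ s := by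
    rintro x ⟨d, hd⟩
    have := hoff {d | ((d, x) : G.D × X) ∈ s} (fun d => hvx d x) (fun d h1 h2 h3 h4 => by
      have := hs.2 (d, x)
      rw [voltage_pr, htriv d h1 h2 h3 h4] at this
      exact this) ⟨d, hd⟩
    intro e
    exact (this ▸ Set.mem_univ e : e ∈ {d | ((d, x) : G.D × X) ∈ s})
  have hT := htrans {x | ∃ d, ((d, x) : G.D × X) ∈ s} ⟨x₀, d₀, h0⟩ (by
    rintro d x hx
    have h1 := hslice x hx d
    exact ⟨G.pr d, (hs.2 (d, x)).2 h1⟩)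
  ext ⟨d, x⟩
  simp only [Set.mem_univ, iff_true]
  exact hslice x (hT ▸ Set.mem_univ x : x ∈ {x | ∃ d, ((d, x) : G.D × X) ∈ s}) d

/-- The vertices of a ribbon graph. -/
abbrev Vert : Type := Quotient (Equiv.Perm.SameCycle.setoid G.vx)

/-- A linear algebra version of removing a spanning tree. Edges whose boundary vectors form a basis
of the boundary space number at most `V - 1`. The hypothesis says `E > V`, so at least two edges
remain outside. -/
theorem exists_connOff (hG : G.Conn) (hχ : 2 * Nat.card G.Vert < Nat.card G.D) :
    ∃ d₁ d₂, d₂ ≠ d₁ ∧ d₂ ≠ G.pr d₁ ∧ G.ConnOff d₁ d₂ := by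
  classical
  have := Fintype.ofFinite G.D
  have := Fintype.ofFinite G.Vert
  let st : G.D → G.Vert := fun d => Quotient.mk _ d
  let v : G.D → (G.Vert → ℚ) := fun d => Pi.single (st (G.pr d)) 1 - Pi.single (st d) 1
  obtain ⟨κ, a, ha, hspan, hli⟩ := exists_linearIndependent' ℚ v
  have hκ : Finite κ := Finite.of_injective a ha
  have := Fintype.ofFinite κ
  have hne : Nonempty G.D := by
    by_contra h
    rw [not_nonempty_iff] at h
    simp at hχ
  obtain ⟨e₀⟩ := hne
  let sm : (G.Vert → ℚ) →ₗ[ℚ] ℚ := ∑ i, LinearMap.proj i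
  have hsm : ∀ f, sm f = ∑ i, f i := fun f => by simp [sm]
  have hcard : Fintype.card κ + 1 ≤ Fintype.card G.Vert := by
    have h1 : Submodule.span ℚ (Set.range (v ∘ a)) ≤ LinearMap.ker sm := by
      rw [Submodule.span_le]
      rintro _ ⟨i, rfl⟩
      simp [v, hsm, Finset.sum_sub_distrib]
    have h2 := Submodule.finrank_mono h1
    rw [finrank_span_eq_card hli] at h2
    have h3 := LinearMap.finrank_range_add_finrank_ker sm
    have h4 : LinearMap.range sm = ⊤ := by
      rw [LinearMap.range_eq_top]
      intro c
      exact ⟨Pi.single (st e₀) c, by simp [hsm]⟩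
    rw [h4, finrank_top, Module.finrank_self, Module.finrank_pi] at h3
    omega
  let T : Finset G.D := Finset.univ.image a ∪ (Finset.univ.image a).image G.pr
  have hTc : T.card ≤ 2 * Fintype.card κ := by
    refine (Finset.card_union_le _ _).trans ?_
    have h1 : (Finset.univ.image a).card ≤ Fintype.card κ := Finset.card_image_le
    have h2 : ((Finset.univ.image a).image G.pr).card ≤ (Finset.univ.image a).card :=
      Finset.card_image_le
    omega
  rw [Nat.card_eq_fintype_card, Nat.card_eq_fintype_card] at hχ
  obtain ⟨d₁, hd₁⟩ : ∃ d, d ∉ T := by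
    by_contra! h
    have : Finset.univ ⊆ T := fun d _ => h d
    have := Finset.card_le_card this
    rw [Finset.card_univ] at this
    omega
  obtain ⟨d₂, hd₂⟩ : ∃ d, d ∉ T ∪ {d₁, G.pr d₁} := by
    by_contra! h
    have : Finset.univ ⊆ T ∪ {d₁, G.pr d₁} := fun d _ => h d
    have := Finset.card_le_card this
    rw [Finset.card_univ] at this
    have h2 := Finset.card_union_le T {d₁, G.pr d₁}
    have h3 : ({d₁, G.pr d₁} : Finset G.D).card ≤ 2 := Finset.card_le_two
    omega
  simp only [Finset.mem_union, Finset.mem_insert, Finset.mem_singleton, not_or] at hd₂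
  have hTpr : ∀ d, d ∉ T → G.pr d ∉ T := by
    intro d hd h
    apply hd
    simp only [T, Finset.mem_union, Finset.mem_image, Finset.mem_univ, true_and] at h ⊢
    rcases h with ⟨i, hi⟩ | ⟨e, ⟨i, rfl⟩, hi⟩
    · right; exact ⟨_, ⟨i, rfl⟩, by rw [hi, G.pr_pr]⟩
    · left; exact ⟨i, G.pr.injective hi⟩
  refine ⟨d₁, d₂, hd₂.2.1, hd₂.2.2, fun s hvx hpr hsne => ?_⟩
  have hvxz : ∀ (i : ℤ) d, (G.vx ^ i) d ∈ s ↔ d ∈ s := by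
    intro i
    induction i using Int.induction_on with
    | zero => simp
    | succ i ih =>
      intro d; rw [zpow_add_one, Equiv.Perm.mul_apply, ih, hvx]
    | pred i ih =>
      intro d
      rw [zpow_sub_one, Equiv.Perm.mul_apply, ih, ← hvx (G.vx⁻¹ d)]; simp
  let f : G.Vert → ℚ := fun q => if ∃ d, st d = q ∧ d ∈ s then 1 else 0
  have hf : ∀ d, f (st d) = if d ∈ s then 1 else 0 := by
    intro d
    have : (∃ e, st e = st d ∧ e ∈ s) ↔ d ∈ s := by
      constructor
      · rintro ⟨e, he, hes⟩
        obtain ⟨i, rfl⟩ : G.vx.SameCycle e d := Quotient.exact he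
        rwa [hvxz]
      · intro h; exact ⟨d, rfl, h⟩
    simp only [f, this]
  -- Pairing with the indicator of `s`. It vanishes on the chosen basis, hence on all edge vectors,
  -- so `s` is also closed under crossing `d₁` and `d₂`.
  let φ : (G.Vert → ℚ) →ₗ[ℚ] ℚ := ∑ i, f i • LinearMap.proj i
  have hφ : ∀ d, φ (v d) = f (st (G.pr d)) - f (st d) := by
    intro d
    simp [φ, v, mul_sub, Finset.sum_sub_distrib, Pi.single_apply]
  have hφ0 : Submodule.span ℚ (Set.range v) ≤ LinearMap.ker φ := by
    rw [← hspan, Submodule.span_le]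
    rintro _ ⟨i, rfl⟩
    have hi : a i ∈ T := by simp [T]
    have hne : ∀ d, d ∉ T → a i ≠ d := by rintro d hd rfl; exact hd hi
    have := hpr (a i) (hne _ hd₁) (hne _ (hTpr _ hd₁)) (hne _ hd₂.1) (hne _ (hTpr _ hd₂.1))
    simp [hφ, hf, this]
  have hpr' : ∀ d, G.pr d ∈ s ↔ d ∈ s := by
    intro d
    have h1 : φ (v d) = 0 := hφ0 (Submodule.subset_span ⟨d, rfl⟩)
    rw [hφ, hf, hf, sub_eq_zero] at h1
    by_cases h2 : d ∈ s <;> by_cases h3 : G.pr d ∈ s <;> simp_all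
  refine hG s ⟨fun d => ?_, hpr'⟩ hsne
  rw [← vx_pr, hvx, hpr']

/-! ### Flows -/

/-- On a connected ribbon graph every function on the faces with sum zero is the boundary of a
flow. -/
theorem exists_flow (hG : G.Conn) {A Q : Type*} [AddCommGroup A] [Fintype Q] [DecidableEq Q]
    [Fintype G.D] (ℓ : G.D → Q) (hℓ : ∀ d, ℓ (G.nx d) = ℓ d) (hℓs : Function.Surjective ℓ)
    (a : Q → A) (ha : ∑ q, a q = 0) :
    ∃ β : G.D → A, (∀ d, β (G.pr d) = - β d) ∧ ∀ q, ∑ d with ℓ d = q, β d = a q := by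
  classical
  rcases isEmpty_or_nonempty Q with hQ | ⟨⟨q₀⟩⟩
  · exact ⟨fun _ => 0, by simp, fun q => hQ.elim q⟩
  obtain ⟨d₀, hd₀⟩ := hℓs q₀
  let P : G.D → Prop := fun d => ∀ g : A, ∃ β : G.D → A, (∀ d, β (G.pr d) = - β d) ∧
    ∀ q, ∑ e with ℓ e = q, β e = (if ℓ d = q then g else 0) - (if q₀ = q then g else 0)
  have hnx : ∀ d, P (G.nx d) ↔ P d := fun d => by simp only [P, hℓ]
  have hpr1 : ∀ d, P d → P (G.pr d) := by
    intro d hd g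
    obtain ⟨β, h1, h2⟩ := hd g
    -- An elementary flow through the edge of `d` carries the amount `g` from the face of `d` to the
    -- face of `G.pr d`.
    refine ⟨fun e => β e + ((if e = G.pr d then g else 0) - (if e = d then g else 0)), ?_, ?_⟩
    · intro e
      have h3 : G.pr e = G.pr d ↔ e = d := G.pr.injective.eq_iff
      have h4 : G.pr e = d ↔ e = G.pr d := by
        constructor
        · rintro rfl; rw [G.pr_pr]
        · rintro rfl; rw [G.pr_pr]
      simp only [h1, h3, h4]; abel
    · intro q
      rw [Finset.sum_add_distrib, Finset.sum_sub_distrib, h2]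
      simp only [Finset.sum_ite_eq', Finset.mem_filter, Finset.mem_univ, true_and]
      abel
  have hP : {d | P d} = Set.univ := by
    refine hG _ ⟨hnx, fun d => ⟨fun h => ?_, hpr1 d⟩⟩ ⟨d₀, fun g => ⟨fun _ => 0, by simp, by simp [hd₀]⟩⟩
    have := hpr1 _ h
    rwa [G.pr_pr] at this
  choose r hr using hℓs
  have hP' : ∀ q, P (r q) := fun q => (hP ▸ Set.mem_univ (r q) : r q ∈ {d | P d})
  choose β h1 h2 using fun q => hP' q (a q)
  -- Each summand brings `a q` from `q₀` to `q`; the total taken from `q₀` is zero by `ha`.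
  refine ⟨fun d => ∑ q, β q d, fun d => by simp [h1], fun q => ?_⟩
  rw [Finset.sum_comm]
  simp only [h2, hr, Finset.sum_sub_distrib, Finset.sum_ite_eq', Finset.mem_univ, if_true]
  by_cases h : q₀ = q <;> simp [h, ha]

end RibbonGraph

/-! ### Coverings of ribbon graphs with prescribed degrees on the faces -/

namespace RibbonGraph

variable (G : RibbonGraph)

/-- The size of the face of a dart. -/
noncomputable abbrev per (d : G.D) : ℕ := Function.minimalPeriod G.nx d

theorem nx_pow_eq_iff (d : G.D) (j : ℕ) : (G.nx ^ j) d = d ↔ G.per d ∣ j := by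
  rw [← Function.isPeriodicPt_iff_minimalPeriod_dvd, Function.IsPeriodicPt, Function.IsFixedPt,
    Equiv.Perm.iterate_eq_pow]

theorem per_pos (d : G.D) : 0 < G.per d := by
  obtain ⟨n, hn, h⟩ := (isOfFinOrder_of_finite G.nx).exists_pow_eq_one
  refine Nat.pos_of_ne_zero fun h0 => ?_
  have := (G.nx_pow_eq_iff d n).1 (by rw [h]; rfl)
  rw [h0, zero_dvd_iff] at this
  omega

theorem nx_pow_mod (d : G.D) (j : ℕ) : (G.nx ^ (j % G.per d)) d = (G.nx ^ j) d := by
  conv_rhs => rw [← Nat.mod_add_div j (G.per d), pow_add, Equiv.Perm.mul_apply,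
    (G.nx_pow_eq_iff d _).2 (dvd_mul_right _ _)]

theorem sum_range_per {A : Type*} [AddCommMonoid A] [Fintype G.D]
    [DecidableRel G.nx.SameCycle] (f : G.D → A) (d : G.D) :
    ∑ i ∈ Finset.range (G.per d), f ((G.nx ^ i) d) = ∑ e with G.nx.SameCycle d e, f e := by
  refine Finset.sum_bij (fun i _ => (G.nx ^ i) d) ?_ ?_ ?_ ?_
  · intro i _
    simp only [Finset.mem_filter, Finset.mem_univ, true_and]
    exact ⟨i, by simp⟩
  · intro i hi j hj h
    simp only [Finset.mem_range] at hi hj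
    refine Function.iterate_injOn_Iio_minimalPeriod (f := G.nx) (x := d) hi hj ?_
    simpa [Equiv.Perm.iterate_eq_pow] using h
  · intro e he
    simp only [Finset.mem_filter, Finset.mem_univ, true_and] at he
    obtain ⟨i, rfl⟩ := he.exists_nat_pow_eq
    exact ⟨i % G.per d, Finset.mem_range.2 (Nat.mod_lt _ (G.per_pos d)), G.nx_pow_mod d i⟩
  · intro _ _; rfl

theorem sum_range_mul_per {A : Type*} [AddCommMonoid A] (f : G.D → A) (d : G.D) (r : ℕ) :
    ∑ i ∈ Finset.range (r * G.per d), f ((G.nx ^ i) d) =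
      r • ∑ i ∈ Finset.range (G.per d), f ((G.nx ^ i) d) := by
  induction r with
  | zero => simp
  | succ r ih =>
    rw [Nat.succ_mul, Finset.sum_range_add, ih, succ_nsmul]
    congr 1
    refine Finset.sum_congr rfl fun i _ => ?_
    rw [add_comm, pow_add, Equiv.Perm.mul_apply, (G.nx_pow_eq_iff d _).2 (dvd_mul_left _ _)]

section AddVoltage

variable {A : Type} [AddCommGroup A] (v : G.D → A) (hv : ∀ d, v (G.pr d) = - v d)

/-- The permutation voltage given by translations. -/
def trVoltage (d : G.D) : Equiv.Perm A := Equiv.addRight (v d)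

theorem trVoltage_pr (hv : ∀ d, v (G.pr d) = - v d) (d : G.D) : G.trVoltage v (G.pr d) = (G.trVoltage v d)⁻¹ := by
  ext x
  rw [Equiv.Perm.eq_inv_iff_eq]
  simp [trVoltage, hv]

theorem trVoltage_nx_pow [Finite A] (d : G.D) (x : A) (j : ℕ) :
    ((G.voltage A (G.trVoltage v) (G.trVoltage_pr v hv)).nx ^ j) (d, x) =
      ((G.nx ^ j) d, x + ∑ i ∈ Finset.range j, v ((G.nx ^ i) d)) := by
  induction j with
  | zero => simp
  | succ j ih =>
    rw [pow_succ', Equiv.Perm.mul_apply, ih, voltage_nx, pow_succ', Equiv.Perm.mul_apply,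
      Finset.sum_range_succ, ← add_assoc]
    rfl

/-- One turn around a face translates the fibre by the total voltage of the face, so the degree over
the face is the order of that total. -/
theorem trVoltage_fixed_iff [Finite A] (d : G.D) (x : A) (j : ℕ) :
    ((G.voltage A (G.trVoltage v) (G.trVoltage_pr v hv)).nx ^ j) (d, x) = (d, x) ↔
      ∃ r, j = r * G.per d ∧ r • ∑ i ∈ Finset.range (G.per d), v ((G.nx ^ i) d) = 0 := by
  rw [trVoltage_nx_pow _ v hv, Prod.mk.injEq, add_eq_left, nx_pow_eq_iff]
  constructor
  · rintro ⟨⟨r, rfl⟩, h⟩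
    rw [mul_comm] at h
    exact ⟨r, mul_comm _ _, by rwa [← sum_range_mul_per]⟩
  · rintro ⟨r, rfl, h⟩
    exact ⟨dvd_mul_left _ _, by rwa [sum_range_mul_per]⟩

end AddVoltage

/-- A map of voltage coverings. -/
def voltageMap {X Y : Type} [Finite X] [Finite Y] (ρ : G.D → Equiv.Perm X)
    (hρ : ∀ d, ρ (G.pr d) = (ρ d)⁻¹) (σ : G.D → Equiv.Perm Y) (hσ : ∀ d, σ (G.pr d) = (σ d)⁻¹)
    (f : X → Y) (hf : ∀ d x, f (ρ d x) = σ d (f x)) :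
    Hom (G.voltage X ρ hρ) (G.voltage Y σ hσ) where
  toFun x := (x.1, f x.2)
  map_nx x := Prod.ext rfl (hf x.1 x.2)
  map_pr x := Prod.ext rfl (hf x.1 x.2)

/-- A connected double covering in which a given face lifts to two faces. -/
theorem exists_double_cover {d₁ d₂ : G.D} (h12 : d₂ ≠ d₁) (h12' : d₂ ≠ G.pr d₁)
    (hoff : G.ConnOff d₁ d₂) (b : G.D) : ∃ (ε : G.D → ZMod 2) (hε : ∀ d, ε (G.pr d) = - ε d),
      (G.voltage (ZMod 2) (G.trVoltage ε) (G.trVoltage_pr ε hε)).Conn ∧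
      ∑ i ∈ Finset.range (G.per b), ε ((G.nx ^ i) b) = 0 := by
  classical
  let e : G.D → G.D → ZMod 2 := fun c d => if d = c ∨ d = G.pr c then 1 else 0
  have hpr : ∀ c d, G.pr d = c ↔ d = G.pr c := fun c d => by
    constructor
    · rintro rfl; rw [G.pr_pr]
    · rintro rfl; rw [G.pr_pr]
  have he : ∀ c d, e c (G.pr d) = - e c d := by
    intro c d
    have : (G.pr d = c ∨ G.pr d = G.pr c) ↔ (d = c ∨ d = G.pr c) := by
      rw [hpr, G.pr.injective.eq_iff, or_comm]
    simp only [e, this, CharTwo.neg_eq]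
  have hself : ∀ c, e c c = 1 := fun c => by simp [e]
  have h12e : e d₂ d₁ = 0 := by
    have h1 : d₁ ≠ d₂ := h12.symm
    have h2 : d₁ ≠ G.pr d₂ := fun h => h12' (by rw [h, G.pr_pr])
    simp [e, h1, h2]
  have key : ∀ (ε : G.D → ZMod 2) (hε : ∀ d, ε (G.pr d) = - ε d),
      (∀ d, d ≠ d₁ → d ≠ G.pr d₁ → d ≠ d₂ → d ≠ G.pr d₂ → ε d = 0) → (∃ d, ε d = 1) →
      (G.voltage (ZMod 2) (G.trVoltage ε) (G.trVoltage_pr ε hε)).Conn := by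
    intro ε hε htriv ⟨c, hc⟩
    refine G.voltage_conn hoff _ _ (fun d a b c' d' => ?_) (fun T ⟨x, hx⟩ hT => ?_)
    · ext x; simp [trVoltage, htriv d a b c' d']
    · have h1 : x + 1 ∈ T := by
        have := hT c x hx
        simpa [trVoltage, hc] using this
      ext y
      simp only [Set.mem_univ, iff_true]
      have h2 : ∀ x y : ZMod 2, y = x ∨ y = x + 1 := by decide
      rcases h2 x y with rfl | rfl
      exacts [hx, h1]
  let S : (G.D → ZMod 2) → ZMod 2 := fun ε => ∑ i ∈ Finset.range (G.per b), ε ((G.nx ^ i) b)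
  have h01 : ∀ x : ZMod 2, x = 0 ∨ x = 1 := by decide
  have e1t : ∀ d, d ≠ d₁ → d ≠ G.pr d₁ → e d₁ d = 0 := fun d h1 h2 => by simp [e, h1, h2]
  have e2t : ∀ d, d ≠ d₂ → d ≠ G.pr d₂ → e d₂ d = 0 := fun d h1 h2 => by simp [e, h1, h2]
  -- Three connected double coverings are available: by the first edge, by the second, and by both.
  -- Their sums over the face are `S (e d₁)`, `S (e d₂)` and the sum of these two, so they cannot
  -- all be `1`.
  rcases h01 (S (e d₁)) with h1 | h1
  · exact ⟨e d₁, he d₁, key _ (he d₁) (fun d a b _ _ => e1t d a b) ⟨d₁, hself _⟩, h1⟩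
  rcases h01 (S (e d₂)) with h2 | h2
  · exact ⟨e d₂, he d₂, key _ (he d₂) (fun d _ _ a b => e2t d a b) ⟨d₂, hself _⟩, h2⟩
  have h3 : ∀ d, e d₁ (G.pr d) + e d₂ (G.pr d) = -(e d₁ d + e d₂ d) := fun d => by
    rw [he, he]; ring
  refine ⟨fun d => e d₁ d + e d₂ d, h3,
    key (fun d => e d₁ d + e d₂ d) h3 (fun d a b a' b' => by rw [e1t d a b, e2t d a' b', add_zero])
      ⟨d₁, by rw [hself, h12e, add_zero]⟩, ?_⟩
  rw [Finset.sum_add_distrib]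
  change S (e d₁) + S (e d₂) = 0
  rw [h1, h2]; rfl

/-- A covering that has degree `m` on all faces over a given one, and degree at most two on the
other faces. -/
theorem exists_voltage_face {d₁ d₂ : G.D} (h12 : d₂ ≠ d₁) (h12' : d₂ ≠ G.pr d₁)
    (hoff : G.ConnOff d₁ d₂) (b : G.D) (m : ℕ) [NeZero m] :
    ∃ (ρ : G.D → Equiv.Perm (ZMod 2 × ZMod m)) (hρ : ∀ d, ρ (G.pr d) = (ρ d)⁻¹),
      (∀ d x j, G.nx.SameCycle b d →
        (((G.voltage _ ρ hρ).nx ^ j) (d, x) = (d, x) ↔ m * G.per d ∣ j)) ∧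
      ∀ d x j, ¬ G.nx.SameCycle b d → 2 * G.per d ∣ j → ((G.voltage _ ρ hρ).nx ^ j) (d, x) = (d, x) := by
  classical
  obtain ⟨ε, hε, hconn, hsum⟩ := G.exists_double_cover h12 h12' hoff b
  let G₁ := G.voltage (ZMod 2) (G.trVoltage ε) (G.trVoltage_pr ε hε)
  have := Fintype.ofFinite G.D
  have hfin : Fintype G₁.D := inferInstanceAs (Fintype (G.D × ZMod 2))
  let Q := Quotient (Equiv.Perm.SameCycle.setoid G₁.nx)
  let ℓ : G₁.D → Q := fun e => Quotient.mk _ e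
  have hℓe : ∀ e e', ℓ e = ℓ e' ↔ G₁.nx.SameCycle e e' := fun e e' => Quotient.eq
  have hfQ : Fintype Q := Fintype.ofFinite Q
  have hpow : ∀ d x j, ((G₁.nx ^ j) (d, x) : G.D × ZMod 2) =
      ((G.nx ^ j) d, x + ∑ i ∈ Finset.range j, ε ((G.nx ^ i) d)) := G.trVoltage_nx_pow ε hε
  have hcyc : ∀ d d', G.nx.SameCycle d d' → ∑ i ∈ Finset.range (G.per d), ε ((G.nx ^ i) d) =
      ∑ i ∈ Finset.range (G.per d'), ε ((G.nx ^ i) d') := by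
    intro d d' h
    rw [sum_range_per, sum_range_per]
    refine Finset.sum_congr ?_ fun _ _ => rfl
    ext e
    simp only [Finset.mem_filter, Finset.mem_univ, true_and]
    exact ⟨fun h' => h.symm.trans h', fun h' => h.trans h'⟩
  let qp : Q := ℓ (b, 0)
  let qm : Q := ℓ (b, 1)
  have hqq : qp ≠ qm := by
    intro h
    obtain ⟨i, hi⟩ := ((hℓe _ _).1 h).exists_nat_pow_eq
    have hi' : ((G₁.nx ^ i) (b, 0) : G.D × ZMod 2) = (b, 1) := hi
    rw [hpow, Prod.mk.injEq, nx_pow_eq_iff] at hi'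
    obtain ⟨⟨r, rfl⟩, h2⟩ := hi'
    rw [mul_comm, sum_range_mul_per, hsum] at h2
    simp at h2
  -- A boundary must have sum zero, so a single face cannot carry voltage alone. The two lifts of
  -- the face can: they receive `1` and `-1`, both of order `m`.
  obtain ⟨β, hβ, hβs⟩ := G₁.exists_flow hconn ℓ (fun d => (hℓe _ _).2 ⟨-1, by simp⟩)
    Quotient.mk_surjective (fun q => (if q = qp then (1 : ZMod m) else 0) - (if q = qm then 1 else 0))
    (by
      rw [Finset.sum_sub_distrib, Finset.sum_eq_single qp (fun q _ h => if_neg h) (by simp),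
        Finset.sum_eq_single qm (fun q _ h => if_neg h) (by simp), if_pos rfl, if_pos rfl, sub_self])
  let ρ : G.D → Equiv.Perm (ZMod 2 × ZMod m) := fun d =>
    Equiv.prodShear (Equiv.addRight (ε d)) fun x => Equiv.addRight (β (d, x))
  have hρ : ∀ d, ρ (G.pr d) = (ρ d)⁻¹ := by
    intro d
    ext1 ⟨x, a⟩
    rw [Equiv.Perm.eq_inv_iff_eq]
    have h1 := hβ (d, x + ε (G.pr d))
    have h2 : G₁.pr (d, x + ε (G.pr d)) = (G.pr d, x) := by
      change ((G.pr d, x + ε (G.pr d) + ε d) : G.D × ZMod 2) = _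
      rw [hε, neg_add_cancel_right]
    rw [h2] at h1
    ext1
    · change x + ε (G.pr d) + ε d = x
      rw [hε, neg_add_cancel_right]
    · change a + β (G.pr d, x) + β (d, x + ε (G.pr d)) = a
      rw [h1]; simp
  let G₂ := G₁.voltage (ZMod m) (G₁.trVoltage β) (G₁.trVoltage_pr β hβ)
  let f : Hom (G.voltage _ ρ hρ) G₂ :=
    { toFun := fun x => ((x.1, x.2.1), x.2.2)
      map_nx := fun x => rfl
      map_pr := fun x => rfl }
  have hf : Function.Injective f.toFun := by
    rintro ⟨d, x, a⟩ ⟨d', x', a'⟩ h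
    simp only [f] at h
    obtain ⟨⟨rfl, rfl⟩, rfl⟩ := h
    rfl
  have hfix : ∀ d x a j, (((G.voltage _ ρ hρ).nx ^ j) (d, x, a) = (d, x, a)) ↔
      ∃ r, j = r * G₁.per (d, x) ∧
        r • ∑ i ∈ Finset.range (G₁.per (d, x)), β ((G₁.nx ^ i) (d, x)) = 0 := by
    intro d x a j
    rw [← hf.eq_iff, f.map_nx_pow]
    exact G₁.trVoltage_fixed_iff β hβ (d, x) a j
  have hS : ∀ e, ∑ i ∈ Finset.range (G₁.per e), β ((G₁.nx ^ i) e) =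
      (if ℓ e = qp then (1 : ZMod m) else 0) - (if ℓ e = qm then 1 else 0) := by
    intro e
    rw [sum_range_per, ← hβs]
    refine Finset.sum_congr ?_ fun _ _ => rfl
    ext e'
    simp only [Finset.mem_filter, Finset.mem_univ, true_and]
    rw [hℓe]
    exact ⟨fun h => h.symm, fun h => h.symm⟩
  have hcase : ∀ d x y, ℓ (d, x) = ℓ (b, y) → G.nx.SameCycle b d := by
    intro d x y h
    obtain ⟨i, hi⟩ := ((hℓe _ _).1 h).exists_nat_pow_eq
    have hi' : ((G₁.nx ^ i) (d, x) : G.D × ZMod 2) = (b, y) := hi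
    rw [hpow, Prod.mk.injEq] at hi'
    exact Equiv.Perm.SameCycle.symm ⟨i, by simpa using hi'.1⟩
  refine ⟨ρ, hρ, ?_, ?_⟩
  · rintro d ⟨x, a⟩ j hbd
    have hper : G₁.per (d, x) = G.per d := by
      refine Nat.dvd_antisymm ?_ ?_
      · rw [← nx_pow_eq_iff]
        rw [hpow, (G.nx_pow_eq_iff d _).2 dvd_rfl, ← hcyc b d hbd, hsum, add_zero]
      · rw [← nx_pow_eq_iff]
        have h1 : ((G₁.nx ^ _) (d, x) : G.D × ZMod 2) = (d, x) := (G₁.nx_pow_eq_iff (d, x) _).2 dvd_rfl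
        rw [hpow, Prod.mk.injEq] at h1
        exact h1.1
    have hS1 : ∃ u : (ZMod m)ˣ, ∑ i ∈ Finset.range (G₁.per (d, x)), β ((G₁.nx ^ i) (d, x)) = u := by
      rw [hS]
      obtain ⟨i, hi⟩ := hbd.exists_nat_pow_eq
      have h2 : ℓ (d, x) = ℓ (b, x - ∑ i ∈ Finset.range i, ε ((G.nx ^ i) b)) := by
        rw [hℓe]
        refine Equiv.Perm.SameCycle.symm ⟨i, ?_⟩
        change ((G₁.nx ^ i) (b, _) : G.D × ZMod 2) = (d, x)
        rw [hpow, hi, sub_add_cancel]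
      have h01 : ∀ x : ZMod 2, x = 0 ∨ x = 1 := by decide
      rcases h01 (x - ∑ i ∈ Finset.range i, ε ((G.nx ^ i) b)) with h3 | h3
      · rw [h2, h3]
        exact ⟨1, by simp [qp, qm] at hqq ⊢; simp [hqq]⟩
      · rw [h2, h3]
        exact ⟨-1, by simp [qp, qm] at hqq ⊢; simp [Ne.symm hqq]⟩
    obtain ⟨u, hu⟩ := hS1
    rw [hfix, hu, hper]
    constructor
    · rintro ⟨r, rfl, h⟩
      rw [nsmul_eq_mul, Units.mul_left_eq_zero, ZMod.natCast_eq_zero_iff] at h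
      exact Nat.mul_dvd_mul_right h _
    · rintro ⟨r, rfl⟩
      refine ⟨m * r, by ring, ?_⟩
      rw [nsmul_eq_mul]; simp
  -- Over the other faces `β` has total zero, so only the double covering contributes; this is the
  -- factor 2.
  · rintro d ⟨x, a⟩ j hbd ⟨r, rfl⟩
    rw [hfix, hS]
    have h1 : ℓ (d, x) ≠ qp := fun h => hbd (hcase _ _ _ h)
    have h2 : ℓ (d, x) ≠ qm := fun h => hbd (hcase _ _ _ h)
    have h3 : G₁.per (d, x) ∣ 2 * G.per d * r := by
      rw [← nx_pow_eq_iff]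
      have h4 : 2 * G.per d * r = (2 * r) * G.per d := by ring
      rw [hpow, h4, sum_range_mul_per, (G.nx_pow_eq_iff d _).2 (dvd_mul_left _ _), mul_comm 2 r,
        mul_smul, two_nsmul, CharTwo.add_self_eq_zero, smul_zero, add_zero]
    obtain ⟨c, hc⟩ := h3
    exact ⟨c, by rw [hc, mul_comm], by simp [h1, h2]⟩

/-- A connected covering with group `(ℤ/n)²`. -/
theorem exists_voltage_conn {d₁ d₂ : G.D} (h12 : d₂ ≠ d₁) (h12' : d₂ ≠ G.pr d₁)
    (hoff : G.ConnOff d₁ d₂) (n : ℕ) [NeZero n] :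
    ∃ (v : G.D → ZMod n × ZMod n) (hv : ∀ d, v (G.pr d) = - v d),
      (G.voltage _ (G.trVoltage v) (G.trVoltage_pr v hv)).Conn := by
  classical
  let e : G.D → G.D → ZMod n := fun c d => (if d = c then 1 else 0) - (if d = G.pr c then 1 else 0)
  have hpr : ∀ c d, G.pr d = c ↔ d = G.pr c := fun c d => by
    constructor
    · rintro rfl; rw [G.pr_pr]
    · rintro rfl; rw [G.pr_pr]
  have he : ∀ c d, e c (G.pr d) = - e c d := by
    intro c d
    simp only [e, hpr, G.pr_pr]; ring
  have hself : ∀ c, e c c = 1 := fun c => by simp [e, (G.pr_ne c).symm]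
  have e0 : ∀ c d, d ≠ c → d ≠ G.pr c → e c d = 0 := fun c d h1 h2 => by simp [e, h1, h2]
  have h12e : e d₂ d₁ = 0 := e0 _ _ h12.symm fun h => h12' (by rw [h, G.pr_pr])
  have h21e : e d₁ d₂ = 0 := e0 _ _ h12 h12'
  refine ⟨fun d => (e d₁ d, e d₂ d), fun d => by simp [he], ?_⟩
  refine G.voltage_conn hoff _ _ (fun d a b a' b' => ?_) (fun T ⟨x, hx⟩ hT => ?_)
  · ext x <;> simp [trVoltage, e0 _ _ a b, e0 _ _ a' b']
  · have h1 : ∀ r : ℕ, ∀ x ∈ T, x + (((r : ZMod n)), 0) ∈ T := by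
      intro r
      induction r with
      | zero => intro x hx; simpa [← Prod.zero_eq_mk] using hx
      | succ r ih =>
        intro x hx
        have := hT d₁ _ (ih x hx)
        simpa [trVoltage, hself, h12e, add_assoc] using this
    have h2 : ∀ r : ℕ, ∀ x ∈ T, x + (0, ((r : ZMod n))) ∈ T := by
      intro r
      induction r with
      | zero => intro x hx; simpa [← Prod.zero_eq_mk] using hx
      | succ r ih =>
        intro x hx
        have := hT d₂ _ (ih x hx)
        simpa [trVoltage, hself, h21e, add_assoc] using this
    ext y
    simp only [Set.mem_univ, iff_true]
    have h3 := h2 (y.2 - x.2).val _ (h1 (y.1 - x.1).val x hx)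
    have h4 : x + (((y.1 - x.1).val : ZMod n), 0) + (0, ((y.2 - x.2).val : ZMod n)) = y := by
      ext <;> simp
    rwa [h4] at h3

/-- Coverings of surfaces of negative Euler characteristic with prescribed degrees on the boundary
components. -/
theorem exists_cover (hG : G.Conn) (hχ : 2 * Nat.card G.Vert < Nat.card G.D) (k : G.D → ℕ)
    (hk : ∀ d, 0 < k d) (hkn : ∀ d, k (G.nx d) = k d) (n : ℕ) (hn : 0 < n) (hn2 : 2 ∣ n) :
    ∃ (G' : RibbonGraph) (π : Hom G' G), π.Unramified ∧ G'.Conn ∧ Nonempty G'.D ∧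
      (∀ d j, (G'.nx ^ j) d = d ↔ n * k (π.toFun d) * G.per (π.toFun d) ∣ j) ∧
      ∀ d, n ^ 2 ∣ Nat.card {d' // π.toFun d' = d} := by
  classical
  obtain ⟨d₁, d₂, h12, h12', hoff⟩ := G.exists_connOff hG hχ
  have hn0 : NeZero n := ⟨hn.ne'⟩
  have hm0 : ∀ b, NeZero (n * k b) := fun b => ⟨(Nat.mul_pos hn (hk b)).ne'⟩
  choose ρ hρ hρ1 hρ2 using fun b => G.exists_voltage_face h12 h12' hoff b (n * k b)
  obtain ⟨v, hv, hvc⟩ := G.exists_voltage_conn h12 h12' hoff n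
  -- The fibre product of one covering for each `b`, which fixes the degree on the face of `b`, and
  -- of a connected `(ℤ/n)²`-covering, which serves only to make the degree divisible by `n²`.
  let X := (∀ b, ZMod 2 × ZMod (n * k b)) × (ZMod n × ZMod n)
  let σ : G.D → Equiv.Perm X := fun d => Equiv.prodCongr (Equiv.piCongrRight fun b => ρ b d) (G.trVoltage v d)
  have hσ : ∀ d, σ (G.pr d) = (σ d)⁻¹ := by
    intro d
    ext1 x
    rw [Equiv.Perm.eq_inv_iff_eq]
    refine Prod.ext (funext fun b => ?_) ?_
    · change ρ b d (ρ b (G.pr d) (x.1 b)) = x.1 b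
      rw [hρ]; simp
    · change G.trVoltage v d (G.trVoltage v (G.pr d) x.2) = x.2
      rw [G.trVoltage_pr v hv]; simp
  let GX := G.voltage X σ hσ
  let fb : ∀ b, Hom GX (G.voltage _ (ρ b) (hρ b)) := fun b =>
    G.voltageMap σ hσ (ρ b) (hρ b) (fun x => x.1 b) fun _ _ => rfl
  let fz : Hom GX (G.voltage _ (G.trVoltage v) (G.trVoltage_pr v hv)) :=
    G.voltageMap σ hσ _ _ (fun x => x.2) fun _ _ => rfl
  have hkc : ∀ b d, G.nx.SameCycle b d → k b = k d := by
    intro b d h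
    obtain ⟨i, rfl⟩ := h.exists_nat_pow_eq
    clear h
    induction i with
    | zero => rfl
    | succ i ih => rw [pow_succ', Equiv.Perm.mul_apply, hkn, ih]
  have hfix : ∀ d x j, ((GX.nx ^ j) (d, x) = (d, x)) ↔ n * k d * G.per d ∣ j := by
    intro d x j
    constructor
    · intro h
      rw [← hρ1 d d (x.1 d) j (Equiv.Perm.SameCycle.refl _ _)]
      have := (fb d).map_nx_pow j (d, x)
      rw [h] at this
      exact this.symm
    · intro h
      -- Evenness of `n` absorbs the degree at most two that the coverings made for other faces have
      -- here.
      obtain ⟨n', rfl⟩ := hn2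
      have h1 : ∀ b, ((G.voltage _ (ρ b) (hρ b)).nx ^ j) (d, x.1 b) = (d, x.1 b) := by
        intro b
        by_cases hb : G.nx.SameCycle b d
        · rw [hρ1 b d _ _ hb, hkc b d hb]; exact h
        · refine hρ2 b d _ _ hb (Dvd.dvd.trans ⟨n' * k d, by ring⟩ h)
      have h2 : ((G.voltage _ (G.trVoltage v) (G.trVoltage_pr v hv)).nx ^ j) (d, x.2) = (d, x.2) := by
        rw [trVoltage_fixed_iff _ v hv]
        obtain ⟨c, rfl⟩ := h
        refine ⟨2 * n' * (k d * c), by ring, ?_⟩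
        rw [nsmul_eq_mul]
        have h3 : ((2 * n' * (k d * c) : ℕ) : ZMod (2 * n')) = 0 := by
          rw [ZMod.natCast_eq_zero_iff]; exact dvd_mul_right _ _
        ext
        · rw [Prod.fst_mul, Prod.fst_natCast, h3, zero_mul]; rfl
        · rw [Prod.snd_mul, Prod.snd_natCast, h3, zero_mul]; rfl
      have h3 : ∀ b, ((GX.nx ^ j) (d, x)).2.1 b = x.1 b := by
        intro b
        have := (fb b).map_nx_pow j (d, x)
        exact (congrArg Prod.snd this).trans (congrArg Prod.snd (h1 b))
      have h4 : ((GX.nx ^ j) (d, x)).2.2 = x.2 := by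
        have := fz.map_nx_pow j (d, x)
        exact (congrArg Prod.snd this).trans (congrArg Prod.snd h2)
      have h5 : ((GX.nx ^ j) (d, x)).1 = d := by
        have := fz.map_nx_pow j (d, x)
        exact (congrArg Prod.fst this).trans (congrArg Prod.fst h2)
      exact Prod.ext h5 (Prod.ext (funext h3) h4)
  let g₀ : GX.D := (d₁, default)
  let ι := GX.componentHom g₀
  let π : Hom (GX.component g₀) G := (G.voltageHom σ hσ).comp ι
  have hι : Function.Injective ι.toFun := GX.componentHom_injective g₀
  refine ⟨GX.component g₀, π, ?_, GX.conn_component g₀, ⟨⟨g₀, GX.mem_compSet g₀⟩⟩, ?_, ?_⟩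
  · intro d j h
    apply hι
    rw [ι.map_vx_pow]
    exact G.voltageHom_unramified σ hσ (ι.toFun d) j h
  · intro d j
    rw [← hι.eq_iff, ι.map_nx_pow]
    exact hfix (ι.toFun d).1 (ι.toFun d).2 j
  · intro d
    let F := fz.comp ι
    -- The chosen component maps to the connected `(ℤ/n)²`-covering with fibres of constant size, so
    -- its degree is `n²` times that size.
    have e : {d' // π.toFun d' = d} ≃ Σ z : ZMod n × ZMod n, {d' // F.toFun d' = (d, z)} :=
      { toFun := fun d' => ⟨(F.toFun d'.1).2, d'.1, Prod.ext d'.2 rfl⟩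
        invFun := fun x => ⟨x.2.1, (congrArg Prod.fst x.2.2 :)⟩
        left_inv := fun d' => rfl
        right_inv := by
          rintro ⟨z, d', hd'⟩
          have : z = (F.toFun d').2 := (congrArg Prod.snd hd').symm
          subst this
          rfl }
    rw [Nat.card_congr e, Nat.card_sigma]
    rw [Finset.sum_congr rfl fun z _ => F.card_fiber_eq hvc (d, z) (d, 0)]
    rw [Finset.sum_const, smul_eq_mul]
    refine Dvd.dvd.mul_right ?_ _
    rw [Finset.card_univ, Fintype.card_prod, ZMod.card, sq]

end RibbonGraph

/-! ### The topology of a polygon surface in terms of its ribbon graph -/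

namespace PolygonSurface

variable (S : PolygonSurface)

instance : Finite S.B := S.finite_B

instance (b : S.B) : NeZero (S.len b) := ⟨(S.len_pos b).ne'⟩

/-- The ribbon graph formed by the sides of the polygons. -/
abbrev ribbon : RibbonGraph where
  D := S.Side
  finite_D := inferInstance
  nx := S.next
  pr := S.pair
  pr_pr := S.pair_pair
  pr_ne := S.pair_ne

theorem next_apply (b : S.B) (i : Fin (S.len b)) : S.next ⟨b, i⟩ = ⟨b, finRotate _ i⟩ := rfl

theorem finRotate_val {n : ℕ} (i : Fin n) : ((finRotate n i : Fin n) : ℕ) = (i + 1) % n := by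
  cases n with
  | zero => exact i.elim0
  | succ n => simp [finRotate_apply, Fin.val_add]

theorem next_pow (b : S.B) (i : Fin (S.len b)) (j : ℕ) :
    (S.next ^ j) ⟨b, i⟩ = ⟨b, ⟨(i + j) % S.len b, Nat.mod_lt _ (S.len_pos b)⟩⟩ := by
  induction j with
  | zero => simp [Nat.mod_eq_of_lt i.2]
  | succ j ih =>
    rw [pow_succ', Equiv.Perm.mul_apply, ih, next_apply]
    congr 1
    ext
    rw [finRotate_val]
    simp [← add_assoc]

theorem next_pow_zero (b : S.B) (i : Fin (S.len b)) :
    (S.next ^ (i : ℕ)) ⟨b, 0⟩ = ⟨b, i⟩ := by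
  rw [next_pow]
  congr 1
  ext
  simp [Nat.mod_eq_of_lt i.2]

theorem next_pow_eq_iff (s : S.Side) (j : ℕ) : (S.next ^ j) s = s ↔ S.len s.1 ∣ j := by
  obtain ⟨b, i⟩ := s
  rw [next_pow]
  constructor
  · intro h
    have h1 : (i + j) % S.len b = i := by
      have := (Sigma.mk.inj h).2
      exact congrArg Fin.val (eq_of_heq this)
    have h2 : (i + j : ℕ) ≡ i + 0 [MOD S.len b] := by
      rw [Nat.ModEq, h1, add_zero, Nat.mod_eq_of_lt i.2]
    exact (Nat.modEq_zero_iff_dvd).1 (Nat.ModEq.add_left_cancel' _ h2)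
  · rintro ⟨c, rfl⟩
    congr 1
    ext
    simp [Nat.mod_eq_of_lt i.2]

theorem per_ribbon (s : S.Side) : S.ribbon.per s = S.len s.1 := by
  refine Nat.dvd_antisymm ?_ ?_
  · exact (S.ribbon.nx_pow_eq_iff s _).1 ((S.next_pow_eq_iff s _).2 dvd_rfl)
  · exact (S.next_pow_eq_iff s _).1 ((S.ribbon.nx_pow_eq_iff s _).2 dvd_rfl)

theorem sidePoint_one (s : S.Side) : S.sidePoint s 1 = S.sidePoint (S.next s) 0 := by
  obtain ⟨b, i⟩ := s
  have hb : (0 : ℝ) < S.len b := by exact_mod_cast S.len_pos b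
  simp only [sidePoint, next_apply, finRotate_val]
  congr 2
  have h : (i : ℕ) + 1 ≤ S.len b := i.2
  rcases h.lt_or_eq with h | h
  · rw [Nat.mod_eq_of_lt h]; push_cast; simp
  · rw [h, Nat.mod_self]
    have : ((i : ℕ) : ℝ) + 1 = S.len b := by exact_mod_cast h
    rw [this, div_self hb.ne']
    simp

/-- With half-open parameters every perimeter point has unique side coordinates; the end of a side
counts as the start of the next. -/
theorem sidePoint_inj {s s' : S.Side} {t t' : ℝ} (ht : t ∈ Set.Ico (0 : ℝ) 1)
    (ht' : t' ∈ Set.Ico (0 : ℝ) 1) (h : S.sidePoint s t = S.sidePoint s' t') : s = s' ∧ t = t' := by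
  obtain ⟨b, i⟩ := s
  obtain ⟨b', i'⟩ := s'
  simp only [sidePoint] at h
  obtain ⟨rfl, h⟩ := Sigma.mk.inj h
  have h := congrArg Prod.fst (eq_of_heq h)
  simp only at h
  have hb : (0 : ℝ) < S.len b := by exact_mod_cast S.len_pos b
  have hIco : ∀ (i : Fin (S.len b)) (t : ℝ), t ∈ Set.Ico (0 : ℝ) 1 →
      ((i : ℕ) + t) / (S.len b : ℝ) ∈ Set.Ico (0 : ℝ) (0 + 1) := by
    intro i t ht
    have : ((i : ℕ) : ℝ) + 1 ≤ S.len b := by exact_mod_cast i.2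
    refine ⟨by have := ht.1; positivity, ?_⟩
    rw [div_lt_iff₀ hb]
    linarith [ht.2]
  rw [AddCircle.coe_eq_coe_iff_of_mem_Ico (hIco i t ht) (hIco i' t' ht')] at h
  rw [div_left_inj' hb.ne'] at h
  have hi : (i : ℕ) = i' := by
    have h1 : ⌊((i : ℕ) : ℝ) + t⌋ = ⌊((i' : ℕ) : ℝ) + t'⌋ := by rw [h]
    rw [Int.floor_natCast_add, Int.floor_natCast_add, Int.floor_eq_zero_iff.2 ht,
      Int.floor_eq_zero_iff.2 ht'] at h1
    omega
  refine ⟨by congr 1; ext; exact hi, ?_⟩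
  rw [hi] at h
  linarith

theorem exists_sidePoint (b : S.B) (x : UnitAddCircle) :
    ∃ (i : Fin (S.len b)) (t : ℝ), t ∈ Set.Ico (0 : ℝ) 1 ∧
      S.sidePoint ⟨b, i⟩ t = ⟨b, x, 0⟩ := by
  have hb : (0 : ℝ) < S.len b := by exact_mod_cast S.len_pos b
  obtain ⟨r, hr, rfl⟩ : ∃ r ∈ Set.Ico (0 : ℝ) 1, (r : UnitAddCircle) = x := by
    have := AddCircle.coe_image_Ico_eq (p := (1 : ℝ)) (a := 0)
    have hx : x ∈ ((↑) : ℝ → AddCircle (1 : ℝ)) '' Set.Ico 0 (0 + 1) := by rw [this]; trivial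
    simpa using hx
  have h0 : 0 ≤ r * S.len b := mul_nonneg hr.1 hb.le
  have h1 : r * S.len b < S.len b := by nlinarith [hr.2]
  refine ⟨⟨⌊r * S.len b⌋₊, (Nat.floor_lt h0).2 h1⟩, r * S.len b - ⌊r * S.len b⌋₊,
    ⟨by linarith [Nat.floor_le h0], by linarith [Nat.lt_floor_add_one (r * S.len b)]⟩, ?_⟩
  simp only [sidePoint]
  congr 3
  field_simp
  ring

/-- The equivalence relation generated by the identifications of the sides. -/
def Equ (a b : S.PreSpace) : Prop :=
  a = b ∨ ∃ (s s' : S.Side) (t t' : ℝ), t ∈ Set.Ico (0 : ℝ) 1 ∧ t' ∈ Set.Ico (0 : ℝ) 1 ∧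
    a = S.sidePoint s t ∧ b = S.sidePoint s' t' ∧
      ((t = 0 ∧ t' = 0 ∧ S.ribbon.vx.SameCycle s s') ∨ (0 < t ∧ s' = S.pair s ∧ t' = 1 - t))

theorem equ_symm {a b : S.PreSpace} (h : S.Equ a b) : S.Equ b a := by
  rcases h with rfl | ⟨s, s', t, t', ht, ht', rfl, rfl, h | h⟩
  · exact Or.inl rfl
  · exact Or.inr ⟨s', s, t', t, ht', ht, rfl, rfl, Or.inl ⟨h.2.1, h.1, h.2.2.symm⟩⟩
  · obtain ⟨h0, rfl, rfl⟩ := h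
    exact Or.inr ⟨_, _, _, _, ht', ht, rfl, rfl, Or.inr ⟨by linarith [ht.2], by rw [S.pair_pair],
      by ring⟩⟩

theorem equ_trans {a b c : S.PreSpace} (h : S.Equ a b) (h' : S.Equ b c) : S.Equ a c := by
  rcases h with rfl | ⟨s, s', t, t', ht, ht', rfl, rfl, h⟩
  · exact h'
  rcases h' with rfl | ⟨u, u', r, r', hr, hr', hb, rfl, h'⟩
  · exact Or.inr ⟨s, s', t, t', ht, ht', rfl, rfl, h⟩
  obtain ⟨rfl, rfl⟩ := S.sidePoint_inj ht' hr hb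
  rcases h with ⟨h1, h2, h3⟩ | ⟨h1, rfl, rfl⟩
  · rcases h' with ⟨h4, h5, h6⟩ | ⟨h4, -, -⟩
    · exact Or.inr ⟨s, u', t, r', ht, hr', rfl, rfl, Or.inl ⟨h1, h5, h3.trans h6⟩⟩
    · linarith
  · rcases h' with ⟨h4, -, -⟩ | ⟨-, rfl, rfl⟩
    · linarith [ht.2]
    · left; rw [S.pair_pair]; congr 1; ring

theorem equ_of_rel {a b : S.PreSpace} (h : S.Rel a b) : S.Equ a b := by
  obtain ⟨s, t, ht⟩ := h
  have h00 : (0 : ℝ) ∈ Set.Ico (0 : ℝ) 1 := by simp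
  rcases ht.1.eq_or_lt with rfl | h0
  · right
    refine ⟨s, S.next (S.pair s), 0, 0, h00, h00, rfl, by rw [sub_zero, sidePoint_one], Or.inl ⟨rfl, rfl, 1, ?_⟩⟩
    rfl
  rcases ht.2.eq_or_lt with rfl | h1
  · right
    refine ⟨S.next s, S.pair s, 0, 0, h00, h00, by rw [sidePoint_one], by rw [sub_self],
      Or.inl ⟨rfl, rfl, -1, ?_⟩⟩
    rw [zpow_neg, zpow_one, Equiv.Perm.inv_eq_iff_eq]
    exact (S.ribbon.vx_pr s).symm
  · exact Or.inr ⟨s, S.pair s, t, 1 - t, ⟨h0.le, h1⟩, ⟨by linarith, by linarith⟩, rfl, rfl,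
      Or.inr ⟨h0, rfl, rfl⟩⟩

theorem mk_sidePoint_pair (s : S.Side) {t : ℝ} (ht : t ∈ Set.Icc (0 : ℝ) 1) :
    (Quot.mk S.Rel (S.sidePoint s t)) = Quot.mk S.Rel (S.sidePoint (S.pair s) (1 - t)) :=
  Quot.sound (.glue s t ht)

theorem mk_sidePoint_vx (s : S.Side) :
    (Quot.mk S.Rel (S.sidePoint s 0)) = Quot.mk S.Rel (S.sidePoint (S.ribbon.vx s) 0) := by
  rw [S.mk_sidePoint_pair s (by simp), sub_zero, sidePoint_one]
  rfl

theorem mk_sidePoint_sameCycle {s s' : S.Side} (h : S.ribbon.vx.SameCycle s s') :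
    (Quot.mk S.Rel (S.sidePoint s 0)) = Quot.mk S.Rel (S.sidePoint s' 0) := by
  obtain ⟨j, rfl⟩ := h.exists_nat_pow_eq
  clear h
  induction j with
  | zero => rfl
  | succ j ih => rw [ih, mk_sidePoint_vx, pow_succ', Equiv.Perm.mul_apply]

/-- `Equ` is already an equivalence relation: interior points of sides are identified in pairs, and
corners along the cycles of `vx`. The kernel of the quotient map is thereby explicit. -/
theorem mk_eq_mk_iff (a b : S.PreSpace) : Quot.mk S.Rel a = Quot.mk S.Rel b ↔ S.Equ a b := by
  constructor
  · intro h
    have h1 := Quot.eqvGen_exact h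
    clear h
    induction h1 with
    | rel _ _ h => exact S.equ_of_rel h
    | refl _ => exact Or.inl rfl
    | symm _ _ _ ih => exact S.equ_symm ih
    | trans _ _ _ _ _ ih1 ih2 => exact S.equ_trans ih1 ih2
  · rintro (rfl | ⟨s, s', t, t', ht, ht', rfl, rfl, ⟨rfl, rfl, h⟩ | ⟨-, rfl, rfl⟩⟩)
    · rfl
    · exact S.mk_sidePoint_sameCycle h
    · exact S.mk_sidePoint_pair s ⟨ht.1, ht.2.le⟩

/-- The parameter space of the pairs of equivalent points. -/
abbrev RelParam : Type :=
  S.PreSpace ⊕ (Σ _ : S.Side, unitInterval) ⊕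
    (Σ _ : {x : S.Side × S.Side // S.ribbon.vx.SameCycle x.1 x.2}, Unit)

/-- The first of two equivalent points. -/
noncomputable def relFst : S.RelParam → S.PreSpace
  | .inl a => a
  | .inr (.inl x) => S.sidePoint x.1 x.2
  | .inr (.inr x) => S.sidePoint x.1.1.1 0

/-- The second of two equivalent points. -/
noncomputable def relSnd : S.RelParam → S.PreSpace
  | .inl a => a
  | .inr (.inl x) => S.sidePoint (S.pair x.1) (1 - x.2)
  | .inr (.inr x) => S.sidePoint x.1.1.2 0

theorem continuous_sidePoint (s : S.Side) : Continuous (S.sidePoint s) := by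
  unfold sidePoint
  refine continuous_sigmaMk.comp (Continuous.prodMk ?_ continuous_const)
  exact (AddCircle.continuous_mk' 1).comp (by fun_prop)

theorem continuous_relFst : Continuous S.relFst := by
  refine continuous_sum_dom.2 ⟨continuous_id, continuous_sum_dom.2 ⟨?_, ?_⟩⟩
  · exact continuous_sigma fun s => (S.continuous_sidePoint s).comp continuous_subtype_val
  · exact continuous_sigma fun s => continuous_of_discreteTopology

theorem continuous_relSnd : Continuous S.relSnd := by
  refine continuous_sum_dom.2 ⟨continuous_id, continuous_sum_dom.2 ⟨?_, ?_⟩⟩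
  · exact continuous_sigma fun s => (S.continuous_sidePoint (S.pair s)).comp
      (f := fun t : unitInterval => 1 - (t : ℝ)) (by fun_prop)
  · exact continuous_sigma fun s => continuous_of_discreteTopology

theorem equ_iff_exists (a b : S.PreSpace) :
    S.Equ a b ↔ ∃ k, S.relFst k = a ∧ S.relSnd k = b := by
  constructor
  · rintro (rfl | ⟨s, s', t, t', ht, ht', rfl, rfl, ⟨rfl, rfl, h⟩ | ⟨-, rfl, rfl⟩⟩)
    · exact ⟨.inl a, rfl, rfl⟩
    · exact ⟨.inr (.inr ⟨⟨(s, s'), h⟩, ()⟩), rfl, rfl⟩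
    · exact ⟨.inr (.inl ⟨s, ⟨t, ht.1, ht.2.le⟩⟩), rfl, rfl⟩
  · rintro ⟨k, rfl, rfl⟩
    rw [← mk_eq_mk_iff]
    match k with
    | .inl a => rfl
    | .inr (.inl x) => exact S.mk_sidePoint_pair x.1 x.2.2
    | .inr (.inr x) => exact S.mk_sidePoint_sameCycle x.1.2

instance : T2Space S.Space :=
  t2Space_of_isQuotientMap_of_isClosed isQuotientMap_quot_mk
    (isClosed_setOf_ker_of_compact S.continuous_relFst S.continuous_relSnd fun a b => by
      rw [mk_eq_mk_iff, equ_iff_exists])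

instance : CompactSpace S.Space := Quot.compactSpace

/-! ### Connectedness -/

/-- A closed set of darts consists of whole polygons and respects the pairing, so its indicator is a
continuous function on the connected surface. -/
theorem conn_ribbon [ConnectedSpace S.Space] : S.ribbon.Conn := by
  classical
  intro s hs ⟨⟨b₀, i₀⟩, h0⟩
  have hall : ∀ (b : S.B) (i i' : Fin (S.len b)), (⟨b, i⟩ : S.Side) ∈ s → (⟨b, i'⟩ : S.Side) ∈ s := by
    intro b i i' h
    rw [← S.next_pow_zero b i] at h
    rw [← S.next_pow_zero b i']
    exact (hs.pow_nx _ _).2 ((hs.pow_nx _ _).1 h)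
  let T : Set S.B := {b | (⟨b, 0⟩ : S.Side) ∈ s}
  have hT : ∀ x : S.Side, x ∈ s ↔ x.1 ∈ T := fun x => ⟨hall _ _ _, hall _ _ _⟩
  let f : S.Space → Bool := Quot.lift (fun a => decide (a.1 ∈ T)) (by
    rintro _ _ ⟨x, t, ht⟩
    have := hs.2 x
    rw [hT, hT] at this
    simp only [sidePoint]
    exact decide_eq_decide.2 this.symm)
  have hf : Continuous f := continuous_quot_lift _ (continuous_sigma fun b => by
    show Continuous fun _ => decide (b ∈ T)
    exact continuous_const)
  have hconst : ∀ b, b ∈ T := by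
    intro b
    have := PreconnectedSpace.constant inferInstance hf (x := Quot.mk _ ⟨b, 0, 0⟩)
      (y := Quot.mk _ ⟨b₀, 0, 0⟩)
    have h1 : decide (b ∈ T) = decide (b₀ ∈ T) := this
    rw [decide_eq_decide] at h1
    exact h1.2 (hall _ _ _ h0)
  ext x
  simp [hT, hconst]

theorem connectedSpace_of_conn (h : S.ribbon.Conn) [Nonempty S.Side] : ConnectedSpace S.Space := by
  obtain ⟨s₀⟩ := ‹Nonempty S.Side›
  have : PreconnectedSpace S.Space := by
    refine preconnectedSpace_of_forall_constant fun f hf => ?_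
    have hconst : ∀ b (p p' : UnitAddCircle × unitInterval),
        f (Quot.mk _ ⟨b, p⟩) = f (Quot.mk _ ⟨b, p'⟩) := by
      intro b p p'
      have hc : Continuous fun p : UnitAddCircle × unitInterval =>
          f (Quot.mk S.Rel ⟨b, p⟩) := hf.comp (continuous_quot_mk.comp continuous_sigmaMk)
      exact PreconnectedSpace.constant inferInstance hc
    let g : S.B → Bool := fun b => f (Quot.mk _ ⟨b, 0, 0⟩)
    have hs := h {s | g s.1 = g s₀.1} ⟨fun s => Iff.rfl, fun s => by
      have : g (S.pair s).1 = g s.1 := by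
        have h1 := S.mk_sidePoint_pair s (t := 0) (by simp)
        have h2 := congrArg f h1
        simp only [sidePoint] at h2
        exact (hconst _ _ _).trans (h2.symm.trans (hconst _ _ _))
      simp [this]⟩ ⟨s₀, rfl⟩
    have hg : ∀ b, g b = g s₀.1 := fun b =>
      (hs ▸ Set.mem_univ (⟨b, 0⟩ : S.Side) : (⟨b, 0⟩ : S.Side) ∈ {s | g s.1 = g s₀.1})
    rintro ⟨b, p⟩ ⟨b', p'⟩
    exact (hconst _ _ _).trans (((hg b).trans (hg b').symm).trans (hconst _ _ _))
  exact { toNonempty := ⟨Quot.mk _ ⟨s₀.1, 0, 0⟩⟩ }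

/-! ### The Euler characteristic -/

theorem card_side_eq : Nat.card S.Side = 2 * Nat.card S.Edge := by
  classical
  have := Fintype.ofFinite S.Edge
  have e : S.Side ≃ Σ q : S.Edge, {s : S.Side // (Quotient.mk _ s : S.Edge) = q} :=
    (Equiv.sigmaFiberEquiv _).symm
  rw [Nat.card_congr e, Nat.card_sigma]
  rw [Finset.sum_congr rfl (g := fun _ => 2)]
  · simp [mul_comm, Nat.card_eq_fintype_card]
  · rintro q -
    obtain ⟨s, rfl⟩ := Quotient.exists_rep q
    have h : {s' : S.Side | (Quotient.mk _ s' : S.Edge) = Quotient.mk _ s} = {s, S.pair s} := by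
      ext s'
      constructor
      · intro h
        obtain ⟨j, rfl⟩ : S.pair.SameCycle s s' := (Quotient.exact h).symm
        have h2 : S.pair ^ (2 : ℤ) = 1 := by
          ext1 x
          rw [zpow_two]; exact S.pair_pair x
        rcases Int.even_or_odd' j with ⟨c, rfl | rfl⟩
        · left; rw [zpow_mul, h2]; simp
        · right; rw [zpow_add, zpow_mul, h2]; simp
      · rintro (rfl | rfl)
        · rfl
        · exact Quotient.sound ⟨-1, by simp⟩
    have := congrArg Set.ncard h
    rw [Set.ncard_pair (S.pair_ne s).symm, ← Nat.card_coe_set_eq] at this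
    exact this

theorem eulerChar_neg_iff : S.eulerChar < 0 ↔ 2 * Nat.card S.ribbon.Vert < Nat.card S.Side := by
  rw [card_side_eq, eulerChar]
  have : Nat.card S.Vertex = Nat.card S.ribbon.Vert := rfl
  omega

end PolygonSurface

/-! ### From ribbon graphs back to surfaces -/

namespace RibbonGraph

variable (G : RibbonGraph)

/-- The faces of a ribbon graph. -/
abbrev Face : Type := Quotient (Equiv.Perm.SameCycle.setoid G.nx)

variable {G} (base : G.Face → G.D)

/-- The dart at a given position of a face. -/
noncomputable def faceDart (s : Σ c : G.Face, Fin (G.per (base c))) : G.D :=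
  (G.nx ^ (s.2 : ℕ)) (base s.1)

theorem faceDart_bijective (hbase : ∀ c, (Quotient.mk _ (base c) : G.Face) = c) :
    Function.Bijective (faceDart base) := by
  constructor
  · rintro ⟨c, i⟩ ⟨c', i'⟩ h
    simp only [faceDart] at h
    obtain rfl : c = c' := by
      rw [← hbase c, ← hbase c']
      refine Quotient.sound (?_ : G.nx.SameCycle _ _)
      refine (show G.nx.SameCycle (base c) ((G.nx ^ (i : ℕ)) (base c)) from ⟨i, by simp⟩).trans ?_
      rw [h]
      exact (show G.nx.SameCycle (base c') ((G.nx ^ (i' : ℕ)) (base c')) from ⟨i', by simp⟩).symm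
    congr 1
    ext
    have hi := i.2
    have hi' := i'.2
    rw [← Equiv.Perm.iterate_eq_pow, ← Equiv.Perm.iterate_eq_pow] at h
    exact Function.iterate_injOn_Iio_minimalPeriod hi hi' h
  · intro d
    have h : G.nx.SameCycle (base (Quotient.mk _ d)) d := Quotient.exact (hbase (Quotient.mk _ d))
    obtain ⟨j, hj⟩ := h.exists_nat_pow_eq
    exact ⟨⟨Quotient.mk _ d, ⟨j % _, Nat.mod_lt _ (G.per_pos _)⟩⟩, by
      rw [faceDart, nx_pow_mod, hj]⟩

variable (hbase : ∀ c, (Quotient.mk _ (base c) : G.Face) = c)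

/-- The positions of the faces correspond to the darts. -/
noncomputable def faceEquiv : (Σ c : G.Face, Fin (G.per (base c))) ≃ G.D :=
  Equiv.ofBijective (faceDart base) (faceDart_bijective base hbase)

theorem faceEquiv_apply (s : Σ c : G.Face, Fin (G.per (base c))) :
    faceEquiv base hbase s = (G.nx ^ (s.2 : ℕ)) (base s.1) := rfl

/-- The surface with the given ribbon graph. -/
noncomputable abbrev toSurface : PolygonSurface where
  B := G.Face
  finite_B := inferInstance
  len c := G.per (base c)
  len_pos c := G.per_pos _
  pair := ((faceEquiv base hbase).trans G.pr).trans (faceEquiv base hbase).symm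
  pair_pair s := by simp [G.pr_pr]
  pair_ne s := by
    simp only [Equiv.trans_apply, ne_eq, Equiv.symm_apply_eq]
    exact G.pr_ne _

/-- The sides of the surface of a ribbon graph are its darts. -/
noncomputable def toSurfaceHom : Hom (toSurface base hbase).ribbon G where
  toFun := faceEquiv base hbase
  map_nx := by
    rintro ⟨c, i⟩
    show faceEquiv base hbase ⟨c, finRotate _ i⟩ = _
    rw [faceEquiv_apply, faceEquiv_apply]
    simp only [PolygonSurface.finRotate_val]
    rw [nx_pow_mod, pow_succ', Equiv.Perm.mul_apply]
  map_pr s := by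
    show faceEquiv base hbase ((faceEquiv base hbase).symm _) = _
    rw [Equiv.apply_symm_apply]
    rfl

theorem Hom.conn_of_injective {G' G : RibbonGraph} (f : Hom G' G)
    (hf : Function.Bijective f.toFun) (hG : G.Conn) : G'.Conn := by
  intro s hs hne
  have h := hG (f.toFun '' s) ⟨fun d => ?_, fun d => ?_⟩ (hne.image _)
  · rw [← Set.preimage_image_eq s hf.1, h, Set.preimage_univ]
  · obtain ⟨d, rfl⟩ := hf.2 d
    rw [← f.map_nx, hf.1.mem_set_image, hf.1.mem_set_image, hs.1]
  · obtain ⟨d, rfl⟩ := hf.2 d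
    rw [← f.map_pr, hf.1.mem_set_image, hf.1.mem_set_image, hs.2]

theorem Hom.Unramified.of_comp_injective {G'' G' G : RibbonGraph} {f : Hom G' G}
    (hf : f.Unramified) {g : Hom G'' G'} (hg : Function.Injective g.toFun) :
    (f.comp g).Unramified := by
  intro d j h
  apply hg
  rw [g.map_vx_pow]
  exact hf _ _ h

/-- Every vertex upstairs has a dart over the chosen dart of the vertex below it. This upper bound
already keeps the Euler characteristic negative, because the number of darts is multiplied by
exactly `N`. -/
theorem Hom.card_vert_le {G' G : RibbonGraph} (f : Hom G' G) (N : ℕ)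
    (hN : ∀ d, Nat.card {d' // f.toFun d' = d} = N) :
    Nat.card G'.Vert ≤ Nat.card G.Vert * N := by
  have := Fintype.ofFinite G.Vert
  let rep : G.Vert → G.D := Quotient.out
  let g : (Σ q : G.Vert, {d' // f.toFun d' = rep q}) → G'.Vert := fun x => Quotient.mk _ x.2.1
  have hg : Function.Surjective g := by
    intro v
    obtain ⟨d, rfl⟩ := Quotient.exists_rep v
    have h : G.vx.SameCycle (f.toFun d) (rep (Quotient.mk _ (f.toFun d))) :=
      Equiv.Perm.SameCycle.symm ((Quotient.exact (Quotient.out_eq (Quotient.mk _ (f.toFun d))) :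
        (Equiv.Perm.SameCycle.setoid G.vx) _ _))
    obtain ⟨j, hj⟩ := h.exists_nat_pow_eq
    exact ⟨⟨_, (G'.vx ^ j) d, by rw [f.map_vx_pow, hj]⟩,
      Quotient.sound (show G'.vx.SameCycle _ _ from
        (show G'.vx.SameCycle d ((G'.vx ^ j) d) from ⟨j, by simp⟩).symm)⟩
  refine (Nat.card_le_card_of_surjective g hg).trans_eq ?_
  rw [Nat.card_sigma]
  simp [hN, Nat.card_eq_fintype_card]

theorem Hom.card_eq {G' G : RibbonGraph} (f : Hom G' G) (N : ℕ)
    (hN : ∀ d, Nat.card {d' // f.toFun d' = d} = N) : Nat.card G'.D = Nat.card G.D * N := by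
  have := Fintype.ofFinite G.D
  rw [Nat.card_congr (Equiv.sigmaFiberEquiv f.toFun).symm, Nat.card_sigma]
  simp [hN, Nat.card_eq_fintype_card]

end RibbonGraph

/-! ### Coverings of polygon surfaces -/

namespace PolygonSurface

/-- A covering of surfaces that is compatible with the polygonal decompositions: the annulus `c`
covers the annulus `φ c` with degree `m (φ c)`. -/
structure Cover (S' S : PolygonSurface) where
  f : RibbonGraph.Hom S'.ribbon S.ribbon
  φ : S'.B → S.B
  m : S.B → ℕ
  m_pos : ∀ b, 0 < m b
  len_eq : ∀ c, S'.len c = m (φ c) * S.len (φ c)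
  f_apply : ∀ c i, f.toFun ⟨c, i⟩ = ⟨φ c, ⟨i % S.len (φ c), Nat.mod_lt _ (S.len_pos _)⟩⟩
  unramified : f.Unramified

/-- Polygons of the surface upstairs are the faces of the covering ribbon graph. The final identity
counts the sides over polygon `b` in two ways, by polygons upstairs and by sides downstairs. -/
theorem exists_cover (S : PolygonSurface) [ConnectedSpace S.Space] (hχ : S.eulerChar < 0)
    (k : S.B → ℕ) (hk : ∀ b, 0 < k b) (n : ℕ) (hn : 0 < n) (hn2 : 2 ∣ n) :
    ∃ (S' : PolygonSurface) (π : Cover S' S) (N : ℕ), ConnectedSpace S'.Space ∧ S'.eulerChar < 0 ∧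
      (∀ b, π.m b = n * k b) ∧ 0 < N ∧ n ^ 2 ∣ N ∧
      ∀ b, Nat.card {c // π.φ c = b} * (n * k b) = N := by
  classical
  obtain ⟨G', π, hπ, hconn, hne, hper, hdvd⟩ := S.ribbon.exists_cover S.conn_ribbon
    (S.eulerChar_neg_iff.1 hχ) (fun s => k s.1) (fun s => hk _) (fun s => rfl) n hn hn2
  have hrep : ∀ c : G'.Face, ∃ d, (Quotient.mk _ d : G'.Face) = c ∧ (π.toFun d).2 = 0 := by
    intro c
    obtain ⟨d, rfl⟩ := Quotient.exists_rep c
    let i := (π.toFun d).2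
    -- Moving on by `len - i` reaches a dart over position `0`. With this starting point, position
    -- `i` upstairs lies over `i % len`.
    refine ⟨(G'.nx ^ (S.len (π.toFun d).1 - i)) d, Quotient.sound (show G'.nx.SameCycle _ _ from
      (show G'.nx.SameCycle d ((G'.nx ^ (S.len (π.toFun d).1 - i)) d) from
        ⟨((S.len (π.toFun d).1 - i : ℕ) : ℤ), by rw [zpow_natCast]⟩).symm), ?_⟩
    rw [π.map_nx_pow]
    have h := S.next_pow (π.toFun d).1 (π.toFun d).2 (S.len (π.toFun d).1 - i)
    have h' : (S.ribbon.nx ^ (S.len (π.toFun d).1 - i)) (π.toFun d) =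
      ⟨(π.toFun d).1, ⟨(i + (S.len (π.toFun d).1 - i)) % S.len (π.toFun d).1,
        Nat.mod_lt _ (S.len_pos _)⟩⟩ := h
    rw [h']
    ext
    simp only [Fin.val_zero]
    rw [Nat.add_sub_cancel' i.2.le, Nat.mod_self]
  choose base hbase hbase0 using hrep
  let S' : PolygonSurface := RibbonGraph.toSurface base hbase
  let e : RibbonGraph.Hom S'.ribbon G' := RibbonGraph.toSurfaceHom base hbase
  have he : Function.Bijective e.toFun := (RibbonGraph.faceEquiv base hbase).bijective
  let f := π.comp e
  let φ : S'.B → S.B := fun c => (π.toFun (base c)).1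
  have hlen : ∀ c, S'.len c = n * k (φ c) * S.len (φ c) := by
    intro c
    show G'.per (base c) = _
    have h1 : ∀ j, G'.per (base c) ∣ j ↔ n * k (φ c) * S.len (φ c) ∣ j := fun j => by
      rw [← RibbonGraph.nx_pow_eq_iff, hper, per_ribbon]
    exact Nat.dvd_antisymm ((h1 _).2 dvd_rfl) ((h1 _).1 dvd_rfl)
  have hbase1 : ∀ c, π.toFun (base c) = ⟨φ c, 0⟩ := fun c => Sigma.ext rfl (heq_of_eq (hbase0 c))
  have hf : ∀ c i, f.toFun ⟨c, i⟩ = ⟨φ c, ⟨i % S.len (φ c), Nat.mod_lt _ (S.len_pos _)⟩⟩ := by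
    intro c i
    show π.toFun ((G'.nx ^ (i : ℕ)) (base c)) = _
    rw [π.map_nx_pow, hbase1]
    refine (S.next_pow _ _ _).trans ?_
    simp
  have hconn' : S'.ribbon.Conn := e.conn_of_injective he hconn
  have hne' : Nonempty S'.Side := by
    obtain ⟨d⟩ := hne
    obtain ⟨s, -⟩ := he.2 d
    exact ⟨s⟩
  have hS : Nonempty S.Side := hne'.map f.toFun
  obtain ⟨s₀⟩ := hS
  set N := Nat.card {d' // f.toFun d' = s₀} with hNdef
  have hN : ∀ d, Nat.card {d' // f.toFun d' = d} = N := fun d => f.card_fiber_eq S.conn_ribbon _ _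
  have hNpos : 0 < N := by
    obtain ⟨x, hx⟩ := f.surjective S.conn_ribbon s₀
    have : Nonempty {d' // f.toFun d' = s₀} := ⟨⟨x, hx⟩⟩
    exact Nat.card_pos
  refine ⟨S', ⟨f, φ, fun b => n * k b, fun b => Nat.mul_pos hn (hk b), hlen, hf,
    hπ.of_comp_injective he.1⟩, N, S'.connectedSpace_of_conn hconn', ?_, fun b => rfl, hNpos,
    ?_, ?_⟩
  · rw [eulerChar_neg_iff]
    have h1 := f.card_vert_le N hN
    have h2 := f.card_eq N hN
    have h3 := S.eulerChar_neg_iff.1 hχ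
    have h4 : Nat.card S'.Side = Nat.card S.Side * N := h2
    rw [h4]
    nlinarith
  · have h := hdvd s₀
    have h2 : Nat.card {d' // π.toFun d' = s₀} = N := by
      rw [hNdef]
      refine Nat.card_congr ((Equiv.ofBijective _ he).subtypeEquiv fun d => Iff.rfl).symm
    rwa [h2] at h
  · intro b
    have hfib : Fintype {c // φ c = b} := Fintype.ofFinite _
    have h1 : Nat.card {s : S'.Side // φ s.1 = b} = Nat.card {c // φ c = b} * (n * k b * S.len b) := by
      have e1 : {s : S'.Side // φ s.1 = b} ≃ Σ c : {c // φ c = b}, Fin (S'.len c) :=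
        { toFun := fun s => ⟨⟨s.1.1, s.2⟩, s.1.2⟩
          invFun := fun s => ⟨⟨s.1.1, s.2⟩, s.1.2⟩
          left_inv := fun s => rfl
          right_inv := fun s => rfl }
      rw [Nat.card_congr e1, Nat.card_sigma, Finset.sum_congr rfl (g := fun _ => n * k b * S.len b)]
      · simp [Nat.card_eq_fintype_card]
      · rintro ⟨c, rfl⟩ -
        rw [hlen]; simp
    have h2 : Nat.card {s : S'.Side // φ s.1 = b} = S.len b * N := by
      have e1 : {s : S'.Side // φ s.1 = b} ≃ Σ i : Fin (S.len b), {s // f.toFun s = ⟨b, i⟩} :=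
        { toFun := fun s => ⟨⟨s.1.2 % S.len b, Nat.mod_lt _ (S.len_pos _)⟩, s.1, by
            obtain ⟨⟨c, i⟩, rfl⟩ := s
            exact hf c i⟩
          invFun := fun s => ⟨s.2.1, by
            have h1 := s.2.2
            obtain ⟨i, ⟨c, j⟩, h⟩ := s
            rw [hf] at h1
            exact congrArg Sigma.fst h1⟩
          left_inv := fun s => rfl
          right_inv := by
            rintro ⟨i, ⟨c, j⟩, h⟩
            have h1 := h
            rw [hf] at h1
            obtain ⟨rfl, h1⟩ := Sigma.mk.inj h1
            have h1 := eq_of_heq h1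
            subst h1
            rfl }
      rw [Nat.card_congr e1, Nat.card_sigma]
      simp [hN]
    rw [h1] at h2
    have := S.len_pos b
    refine Nat.eq_of_mul_eq_mul_left this ?_
    rw [← h2]
    ring

namespace Cover

variable {S' S : PolygonSurface} (π : S'.Cover S)

/-- The covering of the annuli. -/
def annMap (a : S'.PreSpace) : S.PreSpace := ⟨π.φ a.1, π.m (π.φ a.1) • a.2.1, a.2.2⟩

theorem continuous_annMap : Continuous π.annMap :=
  continuous_sigma fun c => (continuous_sigmaMk (σ := fun _ : S.B => UnitAddCircle × unitInterval)
    (i := π.φ c)).comp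
    (((continuous_nsmul (π.m (π.φ c))).comp continuous_fst).prodMk continuous_snd)

theorem annMap_sidePoint (s : S'.Side) (t : ℝ) :
    π.annMap (S'.sidePoint s t) = S.sidePoint (π.f.toFun s) t := by
  obtain ⟨c, i⟩ := s
  rw [π.f_apply]
  simp only [annMap, sidePoint]
  congr 2
  rw [← AddCircle.coe_nsmul, ← sub_eq_zero, ← AddCircle.coe_sub, AddCircle.coe_eq_zero_iff]
  refine ⟨(i / S.len (π.φ c) : ℕ), ?_⟩
  have h1 : (0 : ℝ) < S.len (π.φ c) := by exact_mod_cast S.len_pos _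
  have h2 : (0 : ℝ) < π.m (π.φ c) := by exact_mod_cast π.m_pos _
  have h3 : ((i : ℕ) : ℝ) = (i % S.len (π.φ c) : ℕ) + S.len (π.φ c) * (i / S.len (π.φ c) : ℕ) := by
    exact_mod_cast (Nat.mod_add_div _ _).symm
  have h4 : (S'.len c : ℝ) = π.m (π.φ c) * S.len (π.φ c) := by exact_mod_cast π.len_eq c
  rw [h4, h3]
  simp only [nsmul_eq_mul, zsmul_eq_mul, Int.cast_natCast]
  field_simp
  ring

/-- An identification at a corner lifts by the same power of `vx`, one inside a side lifts by the
pairing. -/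
theorem equ_lift {a : S'.PreSpace} {b : S.PreSpace} (h : S.Equ (π.annMap a) b) :
    ∃ a', S'.Equ a a' ∧ π.annMap a' = b := by
  rcases h with rfl | ⟨s, s', t, t', ht, ht', h1, rfl, h⟩
  · exact ⟨a, Or.inl rfl, rfl⟩
  obtain ⟨c, x, y⟩ := a
  have hy : y = 0 := by
    have h2 := h1
    simp only [annMap, sidePoint] at h2
    obtain ⟨-, h2⟩ := Sigma.mk.inj h2
    rw [Sigma.ext_iff] at h1
    have := h1.2
    simp only [annMap, sidePoint, heq_eq_eq, Prod.mk.injEq] at this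
    exact this.2
  subst hy
  obtain ⟨i, r, hr, hi⟩ := S'.exists_sidePoint c x
  rw [← hi, annMap_sidePoint] at h1
  obtain ⟨rfl, rfl⟩ := S.sidePoint_inj hr ht h1
  rw [← hi]
  rcases h with ⟨rfl, rfl, h⟩ | ⟨h0, rfl, rfl⟩
  · obtain ⟨j, rfl⟩ := h.exists_nat_pow_eq
    refine ⟨S'.sidePoint ((S'.ribbon.vx ^ j) ⟨c, i⟩) 0, Or.inr ⟨_, _, 0, 0, hr, hr, rfl, rfl,
      Or.inl ⟨rfl, rfl, j, by simp⟩⟩, ?_⟩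
    rw [annMap_sidePoint]
    congr 1
    exact π.f.map_vx_pow j _
  · refine ⟨S'.sidePoint (S'.pair ⟨c, i⟩) (1 - r), Or.inr ⟨_, _, r, 1 - r, hr, ht', rfl, rfl,
      Or.inr ⟨h0, rfl, rfl⟩⟩, ?_⟩
    rw [annMap_sidePoint]
    congr 1
    exact π.f.map_pr _

/-- At corners this is unramifiedness over the vertices; inside a side it would force a side
downstairs to be paired with itself. -/
theorem equ_unique {a b : S'.PreSpace} (h : S'.Equ a b) (hab : π.annMap a = π.annMap b) : a = b := by
  rcases h with rfl | ⟨s, s', t, t', ht, ht', rfl, rfl, h⟩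
  · rfl
  rw [annMap_sidePoint, annMap_sidePoint] at hab
  obtain ⟨h1, rfl⟩ := S.sidePoint_inj ht ht' hab
  congr 1
  rcases h with ⟨rfl, -, h⟩ | ⟨h0, rfl, -⟩
  · obtain ⟨j, rfl⟩ := h.exists_nat_pow_eq
    refine (π.unramified s j ?_).symm
    rw [← π.f.map_vx_pow]
    exact h1.symm
  · exact absurd ((π.f.map_pr s).symm.trans h1.symm) (S.pair_ne _)

theorem equ_annMap {a b : S'.PreSpace} (h : S'.Equ a b) : S.Equ (π.annMap a) (π.annMap b) := by
  rcases h with rfl | ⟨s, s', t, t', ht, ht', rfl, rfl, h⟩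
  · exact Or.inl rfl
  rw [annMap_sidePoint, annMap_sidePoint]
  refine Or.inr ⟨_, _, t, t', ht, ht', rfl, rfl, ?_⟩
  rcases h with ⟨rfl, rfl, h⟩ | ⟨h0, rfl, rfl⟩
  · obtain ⟨j, rfl⟩ := h.exists_nat_pow_eq
    exact Or.inl ⟨rfl, rfl, j, by rw [zpow_natCast]; exact (π.f.map_vx_pow j s).symm⟩
  · exact Or.inr ⟨h0, π.f.map_pr s, rfl⟩

/-- The covering of the surfaces. -/
def map : S'.Space → S.Space :=
  Quot.lift (fun a => Quot.mk _ (π.annMap a)) fun _ _ h =>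
    (S.mk_eq_mk_iff _ _).2 (π.equ_annMap (S'.equ_of_rel h))

end Cover

end PolygonSurface

/-! ### Locally injective maps -/

section LocallyInjective

open Topology Set

variable {X Y Z W : Type*} [TopologicalSpace X] [TopologicalSpace Y] [TopologicalSpace Z]

theorem IsLocalHomeomorph.isLocallyInjective' {f : X → Y} (hf : IsLocalHomeomorph f) :
    IsLocallyInjective f := by
  intro x
  obtain ⟨e, hx, rfl⟩ := hf x
  exact ⟨e.source, e.open_source, hx, e.injOn⟩

theorem IsLocallyInjective.comp' {g : Y → W} {f : X → Y} (hg : IsLocallyInjective g)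
    (hf : IsLocallyInjective f) (hc : Continuous f) : IsLocallyInjective (g ∘ f) := by
  intro x
  obtain ⟨U, hU, hxU, hi⟩ := hf x
  obtain ⟨V, hV, hxV, hj⟩ := hg (f x)
  exact ⟨U ∩ f ⁻¹' V, hU.inter (hV.preimage hc), ⟨hxU, hxV⟩,
    fun a ha b hb h => hi ha.1 hb.1 (hj ha.2 hb.2 h)⟩

theorem IsLocallyInjective.prodMap' {Z' : Type*} {f : X → W} {g : Y → Z'}
    (hf : IsLocallyInjective f) (hg : IsLocallyInjective g) :
    IsLocallyInjective (Prod.map f g) := by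
  rintro ⟨x, y⟩
  obtain ⟨U, hU, hxU, hi⟩ := hf x
  obtain ⟨V, hV, hxV, hj⟩ := hg y
  refine ⟨U ×ˢ V, hU.prod hV, ⟨hxU, hxV⟩, fun a ha b hb h => ?_⟩
  simp only [Prod.map, Prod.mk.injEq] at h
  exact Prod.ext (hi ha.1 hb.1 h.1) (hj ha.2 hb.2 h.2)

theorem isLocallyInjective_sigmaMap {ι κ : Type*} {σ : ι → Type*} {τ : κ → Type*}
    [∀ i, TopologicalSpace (σ i)] (f₁ : ι → κ) (f₂ : ∀ i, σ i → τ (f₁ i))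
    (h : ∀ i, IsLocallyInjective (f₂ i)) : IsLocallyInjective (Sigma.map f₁ f₂) := by
  rintro ⟨i, x⟩
  obtain ⟨U, hU, hxU, hi⟩ := h i x
  refine ⟨Sigma.mk i '' U, isOpenMap_sigmaMk _ hU, ⟨x, hxU, rfl⟩, ?_⟩
  rintro _ ⟨a, ha, rfl⟩ _ ⟨b, hb, rfl⟩ hab
  simp only [Sigma.map, Sigma.mk.injEq, heq_eq_eq, true_and] at hab
  rw [hi ha hb hab]

/-- A finite kernel omits a punctured neighbourhood of zero, so nearby points with equal image have
difference zero. -/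
theorem AddMonoidHom.isLocallyInjective_of_finite_ker {G H : Type*} [AddGroup G] [AddGroup H]
    [TopologicalSpace G] [IsTopologicalAddGroup G] [T1Space G] (f : G →+ H)
    (hf : (f.ker : Set G).Finite) : IsLocallyInjective f := by
  rw [isLocallyInjective_iff_nhds]
  intro x
  have h1 : ((f.ker : Set G) \ {0})ᶜ ∈ 𝓝 (x - x) :=
    (hf.subset sdiff_subset).isClosed.isOpen_compl.mem_nhds (by simp)
  have h2 : Filter.Tendsto (fun p : G × G => p.1 - p.2) (𝓝 x ×ˢ 𝓝 x) (𝓝 (x - x)) := by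
    rw [← nhds_prod_eq]; exact continuous_sub.tendsto (x, x)
  obtain ⟨U, hU, h3⟩ := Filter.mem_prod_self_iff.1 (h2 h1)
  refine ⟨U, hU, fun a ha b hb hab => ?_⟩
  have h4 := h3 (mk_mem_prod ha hb)
  simp only [mem_preimage, mem_compl_iff, mem_sdiff, SetLike.mem_coe, AddMonoidHom.mem_ker,
    map_sub, hab, sub_self, true_and, mem_singleton_iff, not_not, sub_eq_zero] at h4
  exact h4

end LocallyInjective

/-! ### The covering map of surfaces, and maps from surfaces to the torus -/

namespace PolygonSurface

namespace Cover

variable {S' S : PolygonSurface} (π : Cover S' S)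

theorem isLocalHomeomorph_nsmul {m : ℕ} (hm : 0 < m) :
    IsLocalHomeomorph fun x : UnitAddCircle => m • x := by
  have : NeZero m := ⟨hm.ne'⟩
  exact (AddCircle.isAddQuotientCoveringMap_nsmul_of_ne_zero (1 : ℝ) m).isCoveringMap.isLocalHomeomorph

theorem annMap_eq : π.annMap = Sigma.map π.φ fun c =>
    Prod.map (fun x : UnitAddCircle => π.m (π.φ c) • x) (id : unitInterval → unitInterval) := rfl

theorem nsmul_surjective {m : ℕ} (hm : 0 < m) :
    Function.Surjective fun x : UnitAddCircle => m • x := by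
  intro x
  induction x using QuotientAddGroup.induction_on with
  | H r =>
    refine ⟨((r / m : ℝ) : UnitAddCircle), ?_⟩
    have : (m : ℝ) ≠ 0 := by exact_mod_cast hm.ne'
    simp only [← AddCircle.coe_nsmul, nsmul_eq_mul, mul_div_cancel₀ r this]

theorem map_boundaryPoint (c : S'.B) (x : UnitAddCircle) :
    π.map (S'.boundaryPoint c x) = S.boundaryPoint (π.φ c) (π.m (π.φ c) • x) := rfl

theorem isCoveringMap_map (hφ : Function.Surjective π.φ) : IsCoveringMap π.map := by
  refine (isCoveringMap_of_quotient (A := S.PreSpace) (A' := S'.PreSpace) (K := S'.RelParam)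
    isQuotientMap_quot_mk isQuotientMap_quot_mk π.continuous_annMap ?_ ?_ ?_ (fun a => rfl)
    S'.continuous_relFst S'.continuous_relSnd
    (fun a b => (S'.mk_eq_mk_iff a b).trans (S'.equ_iff_exists a b)) ?_ ?_).2.2
  · rw [annMap_eq, isOpenMap_sigma_map]
    exact fun c => (isLocalHomeomorph_nsmul (π.m_pos _)).isOpenMap.prodMap IsOpenMap.id
  · rw [annMap_eq]
    exact isLocallyInjective_sigmaMap _ _ fun c =>
      (isLocalHomeomorph_nsmul (π.m_pos _)).isLocallyInjective'.prodMap'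
        Function.injective_id.IsLocallyInjective
  · rintro ⟨b, x, s⟩
    obtain ⟨c, rfl⟩ := hφ b
    obtain ⟨y, rfl⟩ := nsmul_surjective (π.m_pos (π.φ c)) x
    exact ⟨⟨c, y, s⟩, rfl⟩
  · intro a c h
    rw [mk_eq_mk_iff] at h
    obtain ⟨a', h1, rfl⟩ := π.equ_lift h
    obtain ⟨k, rfl, rfl⟩ := (S'.equ_iff_exists _ _).1 h1
    exact ⟨k, rfl, rfl⟩
  · intro a b h hab
    exact π.equ_unique ((S'.mk_eq_mk_iff _ _).1 h) hab

end Cover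

variable (S : PolygonSurface)

theorem boundaryPoint_inj {b b' : S.B} {x x' : UnitAddCircle}
    (h : S.boundaryPoint b x = S.boundaryPoint b' x') : b = b' ∧ x = x' := by
  rcases (S.mk_eq_mk_iff _ _).1 h with h | ⟨s, s', t, t', ht, ht', h1, h2, h⟩
  · obtain ⟨rfl, h1⟩ := Sigma.mk.inj h
    exact ⟨rfl, congrArg Prod.fst (eq_of_heq h1)⟩
  · rw [Sigma.ext_iff] at h1
    have := h1.2
    simp only [sidePoint, heq_eq_eq, Prod.mk.injEq] at this
    exact absurd this.2 one_ne_zero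

theorem Cover.exists_of_map_eq_boundaryPoint {S' S : PolygonSurface} (π : Cover S' S)
    {y : S'.Space} {b : S.B} {x : UnitAddCircle} (h : π.map y = S.boundaryPoint b x) :
    ∃ c x', y = S'.boundaryPoint c x' ∧ π.φ c = b ∧ π.m b • x' = x := by
  induction y using Quot.ind with
  | mk a =>
    obtain ⟨c, x', s⟩ := a
    rcases (S.mk_eq_mk_iff _ _).1 h with h | ⟨s, s', t, t', ht, ht', h1, h2, h⟩
    · simp only [annMap] at h
      obtain ⟨rfl, h0⟩ := Sigma.mk.inj h
      simp only [heq_eq_eq, Prod.mk.injEq] at h0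
      obtain ⟨h1, rfl⟩ := h0
      exact ⟨c, x', rfl, rfl, h1⟩
    · rw [Sigma.ext_iff] at h2
      have := h2.2
      simp only [sidePoint, heq_eq_eq, Prod.mk.injEq] at this
      exact absurd this.2 one_ne_zero

/-! ### Maps to the torus with prescribed boundary values -/

/-- The projection of the real line to the unit interval. -/
def clamp (x : ℝ) : ℝ := max 0 (min 1 x)

theorem continuous_clamp : Continuous clamp := by unfold clamp; fun_prop

theorem clamp_of_le {x : ℝ} (h : x ≤ 0) : clamp x = 0 := by
  unfold clamp
  rw [min_eq_right (by linarith), max_eq_left h]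

theorem clamp_of_ge {x : ℝ} (h : 1 ≤ x) : clamp x = 1 := by
  unfold clamp
  rw [min_eq_left h, max_eq_right zero_le_one]

theorem clamp_of_mem {x : ℝ} (h : x ∈ Set.Icc (0 : ℝ) 1) : clamp x = x := by
  unfold clamp
  rw [min_eq_right h.2, max_eq_right h.1]

/-- A piecewise linear function that grows by `a i` on `[i/n, (i+1)/n]`. -/
noncomputable def stepSum {n : ℕ} (a : Fin n → ℤ) (x : ℝ) : ℝ :=
  ∑ i : Fin n, a i * clamp (n * x - (i : ℕ))

theorem continuous_stepSum {n : ℕ} (a : Fin n → ℤ) : Continuous (stepSum a) := by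
  unfold stepSum
  have := continuous_clamp
  fun_prop

theorem stepSum_zero {n : ℕ} (a : Fin n → ℤ) : stepSum a 0 = 0 := by
  unfold stepSum
  refine Finset.sum_eq_zero fun i _ => ?_
  rw [clamp_of_le, mul_zero]
  simp

theorem stepSum_one {n : ℕ} (a : Fin n → ℤ) : stepSum a 1 = ((∑ i, a i : ℤ) : ℝ) := by
  unfold stepSum
  push_cast
  refine Finset.sum_congr rfl fun i _ => ?_
  rw [clamp_of_ge, mul_one]
  have : ((i : ℕ) : ℝ) + 1 ≤ n := by exact_mod_cast i.2
  linarith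

theorem stepSum_side {n : ℕ} (a : Fin n → ℤ) (i : Fin n) {t : ℝ} (ht : t ∈ Set.Icc (0 : ℝ) 1) :
    ∃ z : ℤ, stepSum a (((i : ℕ) + t) / n) = z + t * a i := by
  have hn : (0 : ℝ) < n := by exact_mod_cast i.pos
  refine ⟨∑ k : Fin n, if k < i then a k else 0, ?_⟩
  have h : (t * a i : ℝ) = ∑ k : Fin n, if k = i then t * a i else 0 := by simp
  rw [h]
  push_cast
  rw [← Finset.sum_add_distrib]
  unfold stepSum
  refine Finset.sum_congr rfl fun k _ => ?_
  rw [mul_div_cancel₀ _ hn.ne']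
  rcases lt_trichotomy k i with h | rfl | h
  · have : ((k : ℕ) : ℝ) + 1 ≤ (i : ℕ) := by exact_mod_cast h
    rw [clamp_of_ge (by linarith [ht.1]), if_pos h, if_neg h.ne]; simp
  · rw [show ((k : ℕ) + t - (k : ℕ) : ℝ) = t by ring, clamp_of_mem ht]; simp [mul_comm]
  · have : ((i : ℕ) : ℝ) + 1 ≤ (k : ℕ) := by exact_mod_cast h
    rw [clamp_of_le (by linarith [ht.2]), if_neg h.not_gt, if_neg h.ne']; simp

/-- The deviation of a piecewise linear map of degree `∑ i, a i` from a linear one. -/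
noncomputable def stepDev {n : ℕ} (a : Fin n → ℤ) : UnitAddCircle → ℝ :=
  AddCircle.liftIco 1 0 fun x => stepSum a x - x * ((∑ i, a i : ℤ) : ℝ)

theorem continuous_stepDev {n : ℕ} (a : Fin n → ℤ) : Continuous (stepDev a) := by
  refine AddCircle.liftIco_continuous ?_ ?_
  · rw [zero_add, stepSum_zero, stepSum_one]; ring
  · exact ((continuous_stepSum a).sub (by fun_prop)).continuousOn

/-- The growth on earlier sides is an integer and disappears in the circle, so only the slope on the
current side remains. -/
theorem stepDev_side {n : ℕ} (a : Fin n → ℤ) (i : Fin n) {t : ℝ} (ht : t ∈ Set.Ico (0 : ℝ) 1) :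
    (∑ i, a i) • ((((i : ℕ) + t) / n : ℝ) : UnitAddCircle) +
      ((stepDev a ((((i : ℕ) + t) / n : ℝ) : UnitAddCircle) : ℝ) : UnitAddCircle) =
        ((t * a i : ℝ) : UnitAddCircle) := by
  have hn : (0 : ℝ) < n := by exact_mod_cast i.pos
  have hx : ((i : ℕ) + t) / (n : ℝ) ∈ Set.Ico (0 : ℝ) (0 + 1) := by
    have : ((i : ℕ) : ℝ) + 1 ≤ n := by exact_mod_cast i.2
    refine ⟨by have := ht.1; positivity, ?_⟩
    rw [div_lt_iff₀ hn]
    linarith [ht.2]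
  obtain ⟨z, hz⟩ := stepSum_side a i ⟨ht.1, ht.2.le⟩
  rw [stepDev, AddCircle.liftIco_coe_apply hx, hz, ← AddCircle.coe_zsmul, ← AddCircle.coe_add,
    ← sub_eq_zero, ← AddCircle.coe_sub, AddCircle.coe_eq_zero_iff]
  refine ⟨z, ?_⟩
  simp only [zsmul_eq_mul]
  ring

/-- Topologically, integral boundary values with sum zero extend to a class in `H¹(S; ℤ²)`. A flow
with boundary `f` is a cocycle for this class, with all vertices mapped to zero. -/
theorem exists_twist [ConnectedSpace S.Space] [Fintype S.B] (f : S.B → Fin 2 → ℤ)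
    (hf : ∑ c, f c = 0) :
    ∃ θ : S.Space → UnitAddTorus (Fin 2), Continuous θ ∧
      ∀ c x j, θ (S.boundaryPoint c x) j = f c j • x := by
  classical
  have : Fintype S.ribbon.D := inferInstanceAs (Fintype S.Side)
  obtain ⟨α, hα, hsum⟩ := S.ribbon.exists_flow S.conn_ribbon (Sigma.fst : S.Side → S.B)
    (fun _ => rfl) (fun b => ⟨⟨b, 0⟩, rfl⟩) f hf
  have hsum' : ∀ c j, ∑ i, α ⟨c, i⟩ j = f c j := by
    intro c j
    rw [← hsum c]
    rw [Finset.sum_apply]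
    refine Finset.sum_bij (fun i _ => ⟨c, i⟩) ?_ ?_ ?_ ?_
    · intro i _; simp
    · intro i _ i' _ h; simpa using h
    · rintro ⟨c', i⟩ h
      simp only [Finset.mem_filter, Finset.mem_univ, true_and] at h
      subst h
      exact ⟨i, Finset.mem_univ _, rfl⟩
    · intro _ _; rfl
  -- On the boundary circle the map is linear. Across the annulus it is deformed to the map with
  -- slope `α` on every side of the perimeter.
  let θ₀ : S.PreSpace → UnitAddTorus (Fin 2) := fun a j =>
    (∑ i, α ⟨a.1, i⟩ j) • a.2.1 +
      (((1 - (a.2.2 : ℝ)) * stepDev (fun i => α ⟨a.1, i⟩ j) a.2.1 : ℝ) : UnitAddCircle)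
  have hside : ∀ (s : S.Side) (t : ℝ), t ∈ Set.Icc (0 : ℝ) 1 → ∀ j,
      θ₀ (S.sidePoint s t) j = ((t * α s j : ℝ) : UnitAddCircle) := by
    have h1 : ∀ (s : S.Side) (t : ℝ), t ∈ Set.Ico (0 : ℝ) 1 → ∀ j,
        θ₀ (S.sidePoint s t) j = ((t * α s j : ℝ) : UnitAddCircle) := by
      rintro ⟨c, i⟩ t ht j
      have := stepDev_side (fun i => α ⟨c, i⟩ j) i ht
      simpa [θ₀, sidePoint] using this
    intro s t ht j
    rcases ht.2.lt_or_eq with h | rfl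
    · exact h1 s t ⟨ht.1, h⟩ j
    · rw [sidePoint_one, h1 _ 0 (by simp), zero_mul, one_mul]
      symm
      rw [AddCircle.coe_zero, AddCircle.coe_eq_zero_iff]
      exact ⟨α s j, by simp⟩
  refine ⟨Quot.lift θ₀ ?_, continuous_quot_lift _ ?_, ?_⟩
  · rintro _ _ ⟨s, t, ht⟩
    ext1 j
    rw [hside s t ht, hside _ (1 - t) ⟨by linarith [ht.2], by linarith [ht.1]⟩]
    -- The values `t * α` and `(1 - t) * (-α)` on paired sides differ by the integer `α`.
    have := congrFun (hα s) j
    rw [show α (S.pair s) j = - α s j from this, ← sub_eq_zero, ← AddCircle.coe_sub,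
      AddCircle.coe_eq_zero_iff]
    refine ⟨α s j, ?_⟩
    push_cast
    simp only [zsmul_eq_mul]
    ring
  · refine continuous_sigma fun c => continuous_pi fun j => ?_
    show Continuous fun a : UnitAddCircle × unitInterval => (∑ i, α ⟨c, i⟩ j) • a.1 +
      (((1 - (a.2 : ℝ)) * stepDev (fun i => α ⟨c, i⟩ j) a.1 : ℝ) : UnitAddCircle)
    refine Continuous.add ?_ ?_
    · exact (continuous_zsmul _).comp continuous_fst
    · refine (AddCircle.continuous_mk' 1).comp (Continuous.mul ?_ ?_)
      · fun_prop
      · exact (continuous_stepDev fun i => α ⟨c, i⟩ j).comp continuous_fst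
  · intro c x j
    show θ₀ ⟨c, x, 1⟩ j = _
    simp [θ₀, hsum']

end PolygonSurface

/-! ### Sublattices of the homology of fibres and boundary tori -/

section Lattices

open Matrix

theorem fiberIncl_apply (f : Fin 2 → ℤ) : fiberIncl f = ![0, f 0, f 1] := rfl

theorem mem_fiberGroup_iff (x : Fin 3 → ℤ) : x ∈ fiberGroup ↔ x 0 = 0 := by
  constructor
  · rintro ⟨f, rfl⟩; rfl
  · intro h
    refine ⟨![x 1, x 2], ?_⟩
    ext i
    fin_cases i
    · exact h.symm
    · rfl
    · rfl

/-- The matrix with block rows `(k, 0)` and `(f, C)`. -/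
def blk (k : ℤ) (f : Fin 2 → ℤ) (C : Matrix (Fin 2) (Fin 2) ℤ) : Matrix (Fin 3) (Fin 3) ℤ :=
  !![k, 0, 0; f 0, C 0 0, C 0 1; f 1, C 1 0, C 1 1]

theorem det_blk (k : ℤ) (f : Fin 2 → ℤ) (C : Matrix (Fin 2) (Fin 2) ℤ) :
    (blk k f C).det = k * C.det := by
  rw [det_fin_three, det_fin_two]
  simp [blk]
  ring

theorem blk_mulVec (k : ℤ) (f : Fin 2 → ℤ) (C : Matrix (Fin 2) (Fin 2) ℤ) (y : Fin 3 → ℤ) :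
    blk k f C *ᵥ y = y 0 • ![k, f 0, f 1] + fiberIncl (C *ᵥ ![y 1, y 2]) := by
  ext i
  fin_cases i <;> simp [blk, fiberIncl_apply, mulVec, dotProduct, Fin.sum_univ_succ] <;> ring

theorem blk_mulVec_fiberIncl (k : ℤ) (f : Fin 2 → ℤ) (C : Matrix (Fin 2) (Fin 2) ℤ)
    (y : Fin 2 → ℤ) : blk k f C *ᵥ fiberIncl y = fiberIncl (C *ᵥ y) := by
  rw [blk_mulVec, fiberIncl_apply]
  have : ![(![0, y 0, y 1] : Fin 3 → ℤ) 1, (![0, y 0, y 1] : Fin 3 → ℤ) 2] = y := by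
    ext i; fin_cases i <;> rfl
  rw [this]
  simp

theorem Int.exists_pos_generator (H : AddSubgroup ℤ) {x : ℤ} (hx : x ∈ H) (h0 : x ≠ 0) :
    ∃ k : ℕ, 0 < k ∧ ∀ y, y ∈ H ↔ (k : ℤ) ∣ y := by
  obtain ⟨a, rfl⟩ := Int.subgroup_cyclic H
  refine ⟨a.natAbs, ?_, fun y => ?_⟩
  · rw [Int.natAbs_pos]
    rintro rfl
    rw [AddSubgroup.mem_closure_singleton] at hx
    obtain ⟨n, rfl⟩ := hx
    simp at h0
  · rw [AddSubgroup.mem_closure_singleton, Int.natAbs_dvd]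
    exact ⟨fun ⟨n, hn⟩ => ⟨n, by rw [← hn]; simp [mul_comm]⟩,
      fun ⟨n, hn⟩ => ⟨n, by rw [hn]; simp [mul_comm]⟩⟩

/-- Hermite normal form: one basis vector projects to a generator of the first coordinates, the
other generates the part on the second axis. The multiples by `e` ensure that both diagonal entries
are nonzero. -/
theorem exists_basis_of_smul_mem (L : AddSubgroup (Fin 2 → ℤ)) (e : ℕ) (he : 0 < e)
    (hL : ∀ x, e • x ∈ L) :
    ∃ C : Matrix (Fin 2) (Fin 2) ℤ, 0 < C.det ∧ ∀ x, x ∈ L ↔ ∃ y, C *ᵥ y = x := by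
  have he0 : (e : ℤ) ≠ 0 := by exact_mod_cast he.ne'
  obtain ⟨p, hp, hp'⟩ := Int.exists_pos_generator
    (L.map (Pi.evalAddMonoidHom (fun _ : Fin 2 => ℤ) 0)) (x := e)
    ⟨e • ![1, 0], hL _, by simp⟩ he0
  obtain ⟨r, hr, hr'⟩ := Int.exists_pos_generator
    (L.comap (AddMonoidHom.single (fun _ : Fin 2 => ℤ) 1)) (x := e)
    (by
      have := hL ![0, 1]
      rw [AddSubgroup.mem_comap]
      convert this using 1
      ext i; fin_cases i <;> simp) he0
  obtain ⟨u, hu, hu0⟩ := (hp' p).2 dvd_rfl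
  simp only [Pi.evalAddMonoidHom_apply] at hu0
  have hr'' : ∀ y, ![0, y] ∈ L ↔ (r : ℤ) ∣ y := by
    intro y
    rw [← hr' y, AddSubgroup.mem_comap]
    have : (AddMonoidHom.single (fun _ : Fin 2 => ℤ) 1) y = ![0, y] := by
      ext i; fin_cases i <;> simp
    rw [this]
  refine ⟨!![p, 0; u 1, r], by rw [det_fin_two]; simp; positivity, fun x => ⟨fun hx => ?_, ?_⟩⟩
  · obtain ⟨a, ha⟩ := (hp' (x 0)).1 ⟨x, hx, rfl⟩
    have h1 : x - a • u = ![0, x 1 - a * u 1] := by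
      ext i; fin_cases i
      · simp [ha, hu0]; ring
      · simp
    obtain ⟨b, hb⟩ := (hr'' _).1 (h1 ▸ L.sub_mem hx (L.zsmul_mem hu a))
    refine ⟨![a, b], ?_⟩
    ext i
    fin_cases i
    · simp [ha, mul_comm]
    · simp
      linarith
  · rintro ⟨y, rfl⟩
    have : !![(p : ℤ), 0; u 1, r] *ᵥ y = y 0 • u + ![0, r * y 1] := by
      ext i; fin_cases i
      · simp [mulVec, dotProduct, Fin.sum_univ_succ, hu0]; ring
      · simp [mulVec, dotProduct, Fin.sum_univ_succ]; ring
    rw [this]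
    exact L.add_mem (L.zsmul_mem hu _) ((hr'' _).2 (dvd_mul_right _ _))

/-- The subgroup `L + A L'` of `ℤ³`. -/
def latticeSum (A : Matrix (Fin 3) (Fin 3) ℤ) (L L' : AddSubgroup (Fin 2 → ℤ)) :
    AddSubgroup (Fin 3 → ℤ) :=
  L.map fiberIncl ⊔ L'.map (A.mulVecLin.toAddMonoidHom.comp fiberIncl)

theorem mem_latticeSum {A : Matrix (Fin 3) (Fin 3) ℤ} {L L' : AddSubgroup (Fin 2 → ℤ)}
    {x : Fin 3 → ℤ} :
    x ∈ latticeSum A L L' ↔ ∃ l ∈ L, ∃ l' ∈ L', fiberIncl l + A *ᵥ fiberIncl l' = x := by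
  simp only [latticeSum, AddSubgroup.mem_sup, AddSubgroup.mem_map, exists_exists_and_eq_and]
  rfl

section Pair

variable {A A' : Matrix (Fin 3) (Fin 3) ℤ} {L L' : AddSubgroup (Fin 2 → ℤ)}

theorem mulVec_mem_latticeSum (hA : A * A' = 1) {x : Fin 3 → ℤ} (hx : x ∈ latticeSum A' L' L) :
    A *ᵥ x ∈ latticeSum A L L' := by
  obtain ⟨l', hl', l, hl, rfl⟩ := mem_latticeSum.1 hx
  refine mem_latticeSum.2 ⟨l, hl, l', hl', ?_⟩
  rw [mulVec_add, mulVec_mulVec, hA, one_mulVec, add_comm]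

/-- The difference `f - l` lies in both fibre groups, hence in the intersection lattice, which `hP`
puts into `L`. So adding the other fibre lattice does not enlarge the part in the fibre. -/
theorem mem_of_fiberIncl_mem_latticeSum (hA : A' * A = 1)
    (hP : ∀ f, (A' *ᵥ fiberIncl f) 0 = 0 → f ∈ L) {f : Fin 2 → ℤ}
    (h : fiberIncl f ∈ latticeSum A L L') : f ∈ L := by
  obtain ⟨l, hl, l', hl', h⟩ := mem_latticeSum.1 h
  have h1 : A *ᵥ fiberIncl l' = fiberIncl (f - l) := by
    rw [map_sub, ← h]; simp
  have h2 : f - l ∈ L := by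
    apply hP
    rw [← h1, mulVec_mulVec, hA, one_mulVec]
    rfl
  simpa using L.add_mem h2 hl

/-- The first coordinates of the lattice are the multiples of `k`, and the kernel of this projection
is `L`. A vector over `k` completes a basis of `L`, and it may be changed by any `g ∈ L`; this
freedom later makes the twists sum to zero. -/
theorem exists_basis_latticeSum (hA : A' * A = 1)
    (hP : ∀ f, (A' *ᵥ fiberIncl f) 0 = 0 → f ∈ L)
    {C : Matrix (Fin 2) (Fin 2) ℤ} (hC : ∀ x, x ∈ L ↔ ∃ y, C *ᵥ y = x)
    {l₀ : Fin 2 → ℤ} (hl₀ : l₀ ∈ L') (h0 : (A *ᵥ fiberIncl l₀) 0 ≠ 0) :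
    ∃ (k : ℕ) (f : Fin 2 → ℤ), 0 < k ∧ (∃ l' ∈ L', (A *ᵥ fiberIncl l') 0 = k) ∧
      ∀ g ∈ L, ∀ x, x ∈ latticeSum A L L' ↔ ∃ y, blk k (f + g) C *ᵥ y = x := by
  obtain ⟨k, hk, hk'⟩ := Int.exists_pos_generator
    ((latticeSum A L L').map (Pi.evalAddMonoidHom (fun _ : Fin 3 => ℤ) 0))
    ⟨_, mem_latticeSum.2 ⟨0, L.zero_mem, l₀, hl₀, by rw [map_zero, zero_add]⟩, rfl⟩ h0
  obtain ⟨u, hu, hu0⟩ := (hk' k).2 dvd_rfl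
  simp only [Pi.evalAddMonoidHom_apply] at hu0
  refine ⟨k, ![u 1, u 2], hk, ?_, fun g hg x => ⟨fun hx => ?_, ?_⟩⟩
  · obtain ⟨l, hl, l', hl', h⟩ := mem_latticeSum.1 hu
    refine ⟨l', hl', ?_⟩
    rw [← hu0, ← h]
    simp [fiberIncl_apply]
  · obtain ⟨a, ha⟩ := (hk' (x 0)).1 ⟨x, hx, rfl⟩
    have h1 : x - a • u = fiberIncl ![x 1 - a * u 1, x 2 - a * u 2] := by
      ext i; fin_cases i
      · simp [fiberIncl_apply, ha, hu0]; ring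
      · simp [fiberIncl_apply]
      · simp [fiberIncl_apply]
    have h2 := mem_of_fiberIncl_mem_latticeSum hA hP
      (h1 ▸ (latticeSum A L L').sub_mem hx ((latticeSum A L L').zsmul_mem hu a))
    obtain ⟨y, hy⟩ := (hC _).1 (L.sub_mem h2 (L.zsmul_mem hg a))
    refine ⟨![a, y 0, y 1], ?_⟩
    rw [blk_mulVec]
    have h3 : ![(![a, y 0, y 1] : Fin 3 → ℤ) 1, (![a, y 0, y 1] : Fin 3 → ℤ) 2] = y := by
      ext i; fin_cases i <;> rfl
    rw [h3, hy]
    ext i; fin_cases i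
    · simp [fiberIncl_apply, ha]; ring
    · simp [fiberIncl_apply, vecHead]; ring
    · simp [fiberIncl_apply, vecHead, vecTail]; ring
  · rintro ⟨y, rfl⟩
    rw [blk_mulVec]
    have h1 : ![(k : ℤ), (![u 1, u 2] + g) 0, (![u 1, u 2] + g) 1] = u + fiberIncl g := by
      ext i; fin_cases i
      · simp [fiberIncl_apply, hu0]
      · simp [fiberIncl_apply]
      · simp [fiberIncl_apply]
    have h2 : ∀ l ∈ L, fiberIncl l ∈ latticeSum A L L' := fun l hl =>
      mem_latticeSum.2 ⟨l, hl, 0, L'.zero_mem, by simp⟩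
    rw [h1]
    exact (latticeSum A L L').add_mem ((latticeSum A L L').zsmul_mem
      ((latticeSum A L L').add_mem hu (h2 g hg)) _) (h2 _ ((hC _).2 ⟨_, rfl⟩))

theorem exists_matrix_of_mulVec {B D : Matrix (Fin 3) (Fin 3) ℤ}
    (h : ∀ y, ∃ z, B *ᵥ z = D *ᵥ y) : ∃ X, B * X = D := by
  choose z hz using h
  refine ⟨Matrix.of fun i j => z (Pi.single j 1) i, ?_⟩
  ext i j
  have := congrFun (hz (Pi.single j 1)) i
  rw [mulVec_single_one] at this
  rw [mul_apply]
  exact this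

/-- In the new bases, the vector of `L'` whose image has first coordinate `k` becomes an integral
fibre vector whose image has first coordinate `1`. This is a Bézout relation for the first row of
`X`. -/
theorem gcd_eq_one_of_blk_mul {k k' : ℕ} (hk : 0 < k) {f f' : Fin 2 → ℤ}
    {C C' : Matrix (Fin 2) (Fin 2) ℤ} {X : Matrix (Fin 3) (Fin 3) ℤ}
    (hX : blk k f C * X = A * blk k' f' C') (hC' : ∀ x, x ∈ L' ↔ ∃ y, C' *ᵥ y = x)
    (hk' : ∃ l' ∈ L', (A *ᵥ fiberIncl l') 0 = k) : Int.gcd (X 0 1) (X 0 2) = 1 := by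
  obtain ⟨l', hl', h⟩ := hk'
  obtain ⟨y, rfl⟩ := (hC' _).1 hl'
  rw [← blk_mulVec_fiberIncl k' f' C', mulVec_mulVec, ← hX, ← mulVec_mulVec, blk_mulVec] at h
  simp only [fiberIncl_apply, Pi.add_apply, Pi.smul_apply, smul_eq_mul, cons_val_zero,
    add_zero] at h
  have hk0 : (k : ℤ) ≠ 0 := by exact_mod_cast hk.ne'
  have h1 : (X *ᵥ ![0, y 0, y 1]) 0 = 1 := by
    exact mul_right_cancel₀ hk0 (h.trans (one_mul _).symm)
  simp only [mulVec, dotProduct, Fin.sum_univ_succ, cons_val_zero, mul_zero, zero_add,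
    Fin.succ_zero_eq_one, cons_val_one, Fin.succ_one_eq_two, cons_val] at h1
  rw [← Int.isCoprime_iff_gcd_eq_one]
  refine ⟨y 0, y 1, ?_⟩
  rw [← h1]
  simp
  ring

end Pair

end Lattices

/-! ### Lifts of torus homeomorphisms to the universal covering -/

section TorusMaps

open Matrix Topology

theorem continuous_torusProj : Continuous torusProj :=
  continuous_pi fun i => (AddCircle.continuous_mk' 1).comp (continuous_apply i)

theorem torusProj_surjective : Function.Surjective torusProj := by
  intro y
  have : ∀ i, ∃ r : ℝ, (r : UnitAddCircle) = y i := fun i => QuotientAddGroup.mk_surjective (y i)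
  choose r hr using this
  exact ⟨r, funext hr⟩

theorem isOpenMap_torusProj : IsOpenMap torusProj := by
  have : torusProj = Pi.map fun (_ : Fin 3) (x : ℝ) => (x : UnitAddCircle) := rfl
  rw [this]
  exact (IsOpenQuotientMap.piMap fun _ => QuotientAddGroup.isOpenQuotientMap_mk).isOpenMap

theorem isQuotientMap_torusProj : IsQuotientMap torusProj :=
  isOpenMap_torusProj.isQuotientMap continuous_torusProj torusProj_surjective

theorem torusProj_eq_iff {x y : Fin 3 → ℝ} :
    torusProj x = torusProj y ↔ ∃ n : Fin 3 → ℤ, y = x + fun i => (n i : ℝ) := by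
  constructor
  · intro h
    have : ∀ i, ∃ n : ℤ, n • (1 : ℝ) = y i - x i := fun i => by
      rw [← AddCircle.coe_eq_zero_iff, AddCircle.coe_sub, sub_eq_zero]
      exact (congrFun h i).symm
    choose n hn using this
    refine ⟨n, funext fun i => ?_⟩
    have := hn i
    simp only [zsmul_eq_mul, mul_one] at this
    simp [this]
  · rintro ⟨n, rfl⟩
    ext1 i
    simp [torusProj]

/-- `H` is an equivariant diffeomorphism of the universal covering of the 3-torus with linear
part `A`. -/
structure IsLinearLift (H : (Fin 3 → ℝ) ≃ (Fin 3 → ℝ)) (A : Matrix (Fin 3) (Fin 3) ℤ) : Prop where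
  contDiff : ContDiff ℝ ∞ H
  contDiff_symm : ContDiff ℝ ∞ H.symm
  map_add : ∀ (x : Fin 3 → ℝ) (n : Fin 3 → ℤ),
      H (x + fun i => (n i : ℝ)) = H x + fun i => ((A.mulVec n i : ℤ) : ℝ)

theorem IsLinearLift.symm {H : (Fin 3 → ℝ) ≃ (Fin 3 → ℝ)} {A A' : Matrix (Fin 3) (Fin 3) ℤ}
    (h : IsLinearLift H A) (hA : A * A' = 1) : IsLinearLift H.symm A' where
  contDiff := h.contDiff_symm
  contDiff_symm := h.contDiff
  map_add x n := by
    rw [Equiv.symm_apply_eq, h.map_add, Equiv.apply_symm_apply, mulVec_mulVec, hA, one_mulVec]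

theorem IsLinearLift.exists_homeomorph {H : (Fin 3 → ℝ) ≃ (Fin 3 → ℝ)}
    {A A' : Matrix (Fin 3) (Fin 3) ℤ} (h : IsLinearLift H A) (hA : A * A' = 1) :
    ∃ φ : Torus3 ≃ₜ Torus3, ∀ x, torusProj (H x) = φ (torusProj x) := by
  have key : ∀ (H : (Fin 3 → ℝ) ≃ (Fin 3 → ℝ)) (A : Matrix (Fin 3) (Fin 3) ℤ), IsLinearLift H A →
      ∃ φ : Torus3 → Torus3, Continuous φ ∧ ∀ x, torusProj (H x) = φ (torusProj x) := by
    intro H A h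
    let φ : Torus3 → Torus3 := fun y => torusProj (H (Function.surjInv torusProj_surjective y))
    have hφ : ∀ x, torusProj (H x) = φ (torusProj x) := by
      intro x
      obtain ⟨n, hn⟩ := torusProj_eq_iff.1
        (Function.surjInv_eq torusProj_surjective (torusProj x)).symm
      simp only [φ]
      rw [hn, h.map_add]
      exact torusProj_eq_iff.2 ⟨_, rfl⟩
    refine ⟨φ, ?_, hφ⟩
    rw [isQuotientMap_torusProj.continuous_iff]
    have : φ ∘ torusProj = torusProj ∘ H := (funext hφ).symm
    rw [this]
    exact continuous_torusProj.comp h.contDiff.continuous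
  obtain ⟨φ, hφ, h1⟩ := key H A h
  obtain ⟨ψ, hψ, h2⟩ := key H.symm A' (h.symm hA)
  refine ⟨⟨⟨φ, ψ, fun y => ?_, fun y => ?_⟩, hφ, hψ⟩, h1⟩
  · obtain ⟨x, rfl⟩ := torusProj_surjective y
    rw [← h1, ← h2, Equiv.symm_apply_apply]
  · obtain ⟨x, rfl⟩ := torusProj_surjective y
    rw [← h2, ← h1, Equiv.apply_symm_apply]

/-- A lift of the identity of the torus is a translation. -/
theorem eq_add_const_of_torusProj_eq {H : (Fin 3 → ℝ) → (Fin 3 → ℝ)} (hH : Continuous H)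
    (h : ∀ x, torusProj (H x) = torusProj x) : ∃ c, ∀ x, H x = x + c := by
  refine ⟨H 0, fun x => ?_⟩
  have hc : Continuous fun x i => H x i - x i := by fun_prop
  have h1 : ∀ i, (fun x => H x i - x i) x = (fun x => H x i - x i) 0 := by
    intro i
    have hci : Continuous fun x => H x i - x i := by fun_prop
    have : ∀ x, ∃ n : ℤ, (n : ℝ) = H x i - x i := by
      intro x
      have := congrFun (h x) i
      simp only [torusProj] at this
      rw [← sub_eq_zero, ← AddCircle.coe_sub, AddCircle.coe_eq_zero_iff] at this
      obtain ⟨n, hn⟩ := this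
      exact ⟨n, by simpa using hn⟩
    choose n hn using this
    have hnc : Continuous n := by
      rw [Int.isClosedEmbedding_coe_real.isInducing.continuous_iff]
      have : ((↑) : ℤ → ℝ) ∘ n = fun x => H x i - x i := funext hn
      rw [this]; exact hci
    have := PreconnectedSpace.constant inferInstance hnc (x := x) (y := 0)
    simp only [← hn, this]
  ext i
  have := h1 i
  simp only [Pi.zero_apply, sub_zero] at this
  simp only [Pi.add_apply]
  linarith

/-- The composition of the two lifts covers the identity, so it is a translation and its linear part
is trivial. -/
theorem IsTorusDiffeo.mul_eq_one {h : Torus3 ≃ₜ Torus3} {A A' : Matrix (Fin 3) (Fin 3) ℤ}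
    (hA : IsTorusDiffeo h A) (hA' : IsTorusDiffeo h.symm A') : A' * A = 1 := by
  obtain ⟨H, h1, -, h3, h4⟩ := hA
  obtain ⟨H', h1', -, h3', h4'⟩ := hA'
  obtain ⟨c, hc⟩ := eq_add_const_of_torusProj_eq (H := H' ∘ H) (h1'.continuous.comp h1.continuous)
    (fun x => by simp only [Function.comp_apply]; rw [h3', h3, Homeomorph.symm_apply_apply])
  have key : ∀ n, (A' * A) *ᵥ n = n := by
    intro n
    have e1 := hc (0 + fun i => (n i : ℝ))
    have e0 := hc 0
    simp only [Function.comp_apply] at e0 e1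
    rw [h4, h4', e0, mulVec_mulVec] at e1
    ext i
    have := congrFun e1 i
    simp only [Pi.add_apply, zero_add] at this
    have h2 : (((A' * A) *ᵥ n) i : ℝ) = n i := by linarith
    exact_mod_cast h2
  ext i j
  have := congrFun (key (Pi.single j 1)) i
  rw [mulVec_single_one] at this
  rw [one_apply]
  refine this.trans ?_
  simp [Pi.single_apply]

end TorusMaps

/-! ### Gluing matrices and the lattices of the covering -/

namespace GraphGluing

open Matrix

variable (M : GraphGluing)

instance : Finite M.V := M.finite_V

theorem mat_op_mul_mat (w : M.W) : M.mat (M.op w) * M.mat w = 1 :=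
  (M.glue_diffeo w).mul_eq_one (M.glue_op w ▸ M.glue_diffeo (M.op w))

theorem mat_mul_mat_op (w : M.W) : M.mat w * M.mat (M.op w) = 1 := by
  have := M.mat_op_mul_mat (M.op w)
  rwa [M.op_op] at this

/-- A lift is chosen for one torus of each glued pair and inverted for the other. Independent
choices would be mutually inverse only up to translations. -/
theorem exists_lifts : ∃ H : M.W → (Fin 3 → ℝ) ≃ (Fin 3 → ℝ),
    (∀ w, H (M.op w) = (H w).symm) ∧ (∀ w, IsLinearLift (H w) (M.mat w)) ∧
      ∀ w x, torusProj (H w x) = M.glue w (torusProj x) := by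
  classical
  have h := M.glue_diffeo
  choose H h1 h2 h3 h4 using h
  have hH : ∀ w, IsLinearLift (H w) (M.mat w) := fun w => ⟨h1 w, h2 w, h4 w⟩
  let r : M.W → M.W → Prop := WellOrderingRel
  have hasymm : ∀ w, r w (M.op w) → ¬ r (M.op w) w := fun w h h' => asymm_of WellOrderingRel h h'
  have htri : ∀ w, ¬ r w (M.op w) → r (M.op w) w := fun w h => by
    rcases trichotomous_of WellOrderingRel w (M.op w) with h' | h' | h'
    · exact absurd h' h
    · exact absurd h'.symm (M.op_ne w)
    · exact h'
  refine ⟨fun w => if r w (M.op w) then H w else (H (M.op w)).symm, ?_, ?_, ?_⟩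
  · intro w
    simp only [M.op_op]
    by_cases hw : r w (M.op w)
    · rw [if_pos hw, if_neg (hasymm w hw)]
    · rw [if_neg hw, if_pos (htri w hw), Equiv.symm_symm]
  · intro w
    dsimp only
    split_ifs
    · exact hH w
    · exact (hH (M.op w)).symm (M.mat_op_mul_mat w)
  · intro w x
    dsimp only
    split_ifs
    · exact h3 w x
    · have := h3 (M.op w) ((H (M.op w)).symm x)
      rw [Equiv.apply_symm_apply, M.glue_op] at this
      rw [this, Homeomorph.apply_symm_apply]

theorem mem_fiberImage_iff {A A' : Matrix (Fin 3) (Fin 3) ℤ} (h : A * A' = 1) (h' : A' * A = 1)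
    (x : Fin 3 → ℤ) : x ∈ fiberImage A ↔ (A' *ᵥ x) 0 = 0 := by
  rw [← mem_fiberGroup_iff]
  constructor
  · rintro ⟨y, hy, rfl⟩
    show A' *ᵥ (A *ᵥ y) ∈ _
    rwa [mulVec_mulVec, h', one_mulVec]
  · intro hx
    exact ⟨_, hx, show A *ᵥ (A' *ᵥ x) = x by rw [mulVec_mulVec, h, one_mulVec]⟩

theorem mem_intersectionLattice_iff (w : M.W) (f : Fin 2 → ℤ) :
    f ∈ M.intersectionLattice w ↔ (M.mat (M.op w) *ᵥ fiberIncl f) 0 = 0 := by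
  rw [intersectionLattice, AddSubgroup.mem_comap, AddSubgroup.mem_inf,
    mem_fiberImage_iff (M.mat_mul_mat_op w) (M.mat_op_mul_mat w)]
  exact and_iff_right ⟨f, rfl⟩

theorem mulVec_fiberIncl_zero (A : Matrix (Fin 3) (Fin 3) ℤ) (f : Fin 2 → ℤ) :
    (A *ᵥ fiberIncl f) 0 = A 0 1 * f 0 + A 0 2 * f 1 := by
  simp [fiberIncl_apply, mulVec, dotProduct, Fin.sum_univ_succ]

theorem fiberImage_ne_of_ne {A : Matrix (Fin 3) (Fin 3) ℤ} (h : A 0 1 ≠ 0 ∨ A 0 2 ≠ 0) :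
    fiberImage A ≠ fiberGroup := by
  intro he
  have h1 : ∀ f, (A *ᵥ fiberIncl f) 0 = 0 := fun f => by
    rw [← mem_fiberGroup_iff, ← he]
    exact ⟨fiberIncl f, ⟨f, rfl⟩, rfl⟩
  have h2 := h1 ![1, 0]
  have h3 := h1 ![0, 1]
  rw [mulVec_fiberIncl_zero] at h2 h3
  simp at h2 h3
  tauto

/-- If the row `b_w` vanished, the matrix would preserve the condition of first coordinate zero, and
the fibre groups would coincide. -/
theorem mat_ne_zero (w : M.W) : M.mat w 0 1 ≠ 0 ∨ M.mat w 0 2 ≠ 0 := by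
  by_contra! h
  apply M.fiber_ne w
  have h1 := M.mat_mul_mat_op w
  set A := M.mat w
  set A' := M.mat (M.op w)
  have hA : ∀ x, (A *ᵥ x) 0 = A 0 0 * x 0 := fun x => by
    simp [mulVec, dotProduct, Fin.sum_univ_succ, h.1, h.2]
  have hA0 : A 0 0 * A' 0 0 = 1 := by
    have := congrFun (congrFun h1 0) 0
    simpa [mul_apply, Fin.sum_univ_succ, h.1, h.2] using this
  have hne : A 0 0 ≠ 0 := fun h0 => by rw [h0] at hA0; simp at hA0
  ext x
  rw [mem_fiberImage_iff h1 (M.mat_op_mul_mat w), mem_fiberGroup_iff]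
  have h2 := hA (A' *ᵥ x)
  rw [mulVec_mulVec, h1, one_mulVec] at h2
  rw [h2]
  simp [hne]

theorem intersectionLattice_le (w : M.W) : M.intersectionLattice w ≤ M.fiberIntersectionGroup w.1 := by
  unfold fiberIntersectionGroup
  split_ifs
  · exact le_iSup (fun b => M.intersectionLattice ⟨w.1, b⟩) w.2
  · exact le_top

/-- The lattices `a x + b y = 0` and `c x + d y = 0` agree or span a subgroup of finite index. -/
theorem smul_mem_sup_of_ne {K K' : AddSubgroup (Fin 2 → ℤ)} {a b c d : ℤ} (hab : a ≠ 0 ∨ b ≠ 0)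
    (hcd : c ≠ 0 ∨ d ≠ 0)
    (hK : ∀ f, f ∈ K ↔ a * f 0 + b * f 1 = 0) (hK' : ∀ f, f ∈ K' ↔ c * f 0 + d * f 1 = 0)
    (hne : K ≠ K') : a * d - b * c ≠ 0 ∧ ∀ x, (a * d - b * c) • x ∈ K ⊔ K' := by
  constructor
  · intro h0
    apply hne
    ext f
    rw [hK, hK']
    constructor
    · intro h
      have e1 : a * (c * f 0 + d * f 1) = 0 := by linear_combination c * h + f 1 * h0
      have e2 : b * (c * f 0 + d * f 1) = 0 := by linear_combination d * h - f 0 * h0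
      rcases hab with h | h
      · exact (mul_eq_zero.1 e1).resolve_left h
      · exact (mul_eq_zero.1 e2).resolve_left h
    · intro h
      have e1 : c * (a * f 0 + b * f 1) = 0 := by linear_combination a * h - f 1 * h0
      have e2 : d * (a * f 0 + b * f 1) = 0 := by linear_combination b * h + f 0 * h0
      rcases hcd with h | h
      · exact (mul_eq_zero.1 e1).resolve_left h
      · exact (mul_eq_zero.1 e2).resolve_left h
  · intro x
    -- Cramer's rule: `(b, -a)` lies in `K` and `(d, -c)` in `K'`.
    have : (a * d - b * c) • x = (-(c * x 0 + d * x 1)) • ![b, -a] + (a * x 0 + b * x 1) • ![d, -c] := by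
      ext i; fin_cases i
      · simp; ring
      · simp; ring
    rw [this]
    refine (K ⊔ K').add_mem ?_ ?_
    · exact AddSubgroup.zsmul_mem _ (AddSubgroup.mem_sup_left ((hK _).2 (by simp; ring))) _
    · exact AddSubgroup.zsmul_mem _ (AddSubgroup.mem_sup_right ((hK' _).2 (by simp; ring))) _

theorem exists_smul_mem_fiberIntersectionGroup (v : M.V) :
    ∃ e : ℕ, 0 < e ∧ ∀ x, e • x ∈ M.fiberIntersectionGroup v := by
  by_cases ht : 2 ≤ M.type v
  · obtain ⟨K, ⟨b, rfl⟩, K', ⟨b', rfl⟩, hne⟩ := (Set.one_lt_ncard (Set.finite_range _)).1 ht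
    have h1 : ∀ b f, f ∈ M.intersectionLattice ⟨v, b⟩ ↔
        M.mat (M.op ⟨v, b⟩) 0 1 * f 0 + M.mat (M.op ⟨v, b⟩) 0 2 * f 1 = 0 := fun b f => by
      rw [mem_intersectionLattice_iff, mulVec_fiberIncl_zero]
    obtain ⟨h2, h3⟩ := smul_mem_sup_of_ne (M.mat_ne_zero _) (M.mat_ne_zero _) (h1 b) (h1 b') hne
    refine ⟨_, Int.natAbs_pos.2 h2, fun x => ?_⟩
    have hle : M.intersectionLattice ⟨v, b⟩ ⊔ M.intersectionLattice ⟨v, b'⟩ ≤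
        M.fiberIntersectionGroup v :=
      sup_le (M.intersectionLattice_le ⟨v, b⟩) (M.intersectionLattice_le ⟨v, b'⟩)
    have h4 := hle (h3 x)
    rw [← natCast_zsmul, Int.natCast_natAbs]
    rcases abs_choice (M.mat (M.op ⟨v, b⟩) 0 1 * M.mat (M.op ⟨v, b'⟩) 0 2 -
      M.mat (M.op ⟨v, b⟩) 0 2 * M.mat (M.op ⟨v, b'⟩) 0 1) with h | h <;> rw [h]
    · exact h4
    · rw [neg_smul]; exact AddSubgroup.neg_mem _ h4
  · exact ⟨1, one_pos, fun x => by simp [fiberIntersectionGroup, ht]⟩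

/-- The gluing matrix carries the lattice at `op w` into the lattice at `w`, so it has an integral
expression `X` in their bases. The shifts `g`, `g'` change the bases but not the lattices, so they
are arbitrary. -/
theorem exists_lattice_data : ∃ (C : M.V → Matrix (Fin 2) (Fin 2) ℤ) (k : M.W → ℕ)
    (f : M.W → Fin 2 → ℤ) (e : ℕ), 0 < e ∧ (∀ v, 0 < (C v).det) ∧
      (∀ v x, x ∈ M.fiberIntersectionGroup v ↔ ∃ y, C v *ᵥ y = x) ∧
      (∀ v x, e • x ∈ M.fiberIntersectionGroup v) ∧ (∀ w, 0 < k w) ∧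
      ∀ w, ∀ g ∈ M.fiberIntersectionGroup w.1, ∀ g' ∈ M.fiberIntersectionGroup (M.op w).1,
        ∃ X, blk (k w) (f w + g) (C w.1) * X =
          M.mat w * blk (k (M.op w)) (f (M.op w) + g') (C (M.op w).1) ∧
            Int.gcd (X 0 1) (X 0 2) = 1 := by
  classical
  have := Fintype.ofFinite M.V
  choose e₀ he₀ he₀' using M.exists_smul_mem_fiberIntersectionGroup
  choose C hC hC' using fun v => exists_basis_of_smul_mem _ (e₀ v) (he₀ v) (he₀' v)
  have hb : ∀ w : M.W, ∃ l₀ ∈ M.fiberIntersectionGroup (M.op w).1,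
      (M.mat w *ᵥ fiberIncl l₀) 0 ≠ 0 := by
    intro w
    have he : e₀ (M.op w).1 ≠ 0 := (he₀ _).ne'
    rcases M.mat_ne_zero w with h | h
    · exact ⟨e₀ (M.op w).1 • ![1, 0], he₀' _ _, by simp [mulVec_fiberIncl_zero, h, he]⟩
    · exact ⟨e₀ (M.op w).1 • ![0, 1], he₀' _ _, by simp [mulVec_fiberIncl_zero, h, he]⟩
  choose l₀ hl₀ hl₀' using hb
  choose k f hk hk' hf using fun w => exists_basis_latticeSum (M.mat_op_mul_mat w)
    (fun f hf => M.intersectionLattice_le w ((M.mem_intersectionLattice_iff w f).2 hf))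
    (hC' w.1) (hl₀ w) (hl₀' w)
  refine ⟨C, k, f, ∏ v, e₀ v, Finset.prod_pos fun v _ => he₀ v, hC, hC', fun v x => ?_, hk,
    fun w g hg g' hg' => ?_⟩
  · obtain ⟨c, hc⟩ := Finset.dvd_prod_of_mem e₀ (Finset.mem_univ v)
    rw [hc, mul_comm, mul_smul]
    exact AddSubgroup.nsmul_mem _ (he₀' v x) c
  · obtain ⟨X, hX⟩ := exists_matrix_of_mulVec (B := blk (k w) (f w + g) (C w.1))
      (D := M.mat w * blk (k (M.op w)) (f (M.op w) + g') (C (M.op w).1)) (fun y => by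
        rw [← hf w g hg, ← mulVec_mulVec]
        refine mulVec_mem_latticeSum (M.mat_mul_mat_op w) ?_
        have h1 := (hf (M.op w) g' hg' (blk (k (M.op w)) (f (M.op w) + g') (C (M.op w).1) *ᵥ y)).2
          ⟨y, rfl⟩
        rwa [M.op_op] at h1)
    exact ⟨X, hX, gcd_eq_one_of_blk_mul (hk w) hX (hC' _) (hk' w)⟩

end GraphGluing

/-! ### Local path connectedness of the pieces -/

section Instances

open Topology

instance : LocallyPathConnectedSpace UnitAddCircle :=
  (QuotientAddGroup.isOpenQuotientMap_mk (N := AddSubgroup.zmultiples (1 : ℝ))).isQuotientMap.locallyPathConnectedSpace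

instance : LocallyPathConnectedSpace unitInterval :=
  (isQuotientMap_projIcc (a := (0 : ℝ)) (b := 1) (h := zero_le_one)).locallyPathConnectedSpace

instance : LocallyPathConnectedSpace (UnitAddTorus (Fin 2)) :=
  (IsOpenQuotientMap.piMap fun _ : Fin 2 => QuotientAddGroup.isOpenQuotientMap_mk
    (N := AddSubgroup.zmultiples (1 : ℝ))).isQuotientMap.locallyPathConnectedSpace

end Instances

/-! ### The topology of the glued manifold -/

namespace GraphGluing

open Topology

variable (M : GraphGluing)

theorem boundaryTorus_inj {w w' : M.W} {x x' : Torus3}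
    (h : M.boundaryTorus w x = M.boundaryTorus w' x') : w = w' ∧ x = x' := by
  obtain ⟨v, b⟩ := w
  obtain ⟨v', b'⟩ := w'
  simp only [boundaryTorus] at h
  obtain ⟨rfl, h1⟩ := Sigma.mk.inj h
  have h1 := eq_of_heq h1
  simp only [Prod.mk.injEq] at h1
  obtain ⟨rfl, h0⟩ := (M.surf v).boundaryPoint_inj h1.1
  refine ⟨rfl, ?_⟩
  ext1 i
  fin_cases i
  · exact h0
  · exact congrFun h1.2 0
  · exact congrFun h1.2 1

theorem rel_symm {a b : M.Blocks} (h : M.Rel a b) : M.Rel b a := by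
  obtain ⟨w, x⟩ := h
  have := Rel.glue (M := M) (M.op w) (M.glue w x)
  rwa [M.op_op, M.glue_op, Homeomorph.symm_apply_apply] at this

theorem eq_of_rel_rel {a b c : M.Blocks} (h : M.Rel a b) (h' : M.Rel b c) : a = c := by
  obtain ⟨w, x⟩ := h
  generalize hb : M.boundaryTorus w (M.glue w x) = b at h'
  obtain ⟨w', x'⟩ := h'
  obtain ⟨rfl, rfl⟩ := M.boundaryTorus_inj hb
  have : M.glue (M.op w') = (M.glue w').symm := M.glue_op w'
  rw [M.op_op, this, Homeomorph.apply_symm_apply]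

/-- Boundary tori are disjoint and each has a single partner, so two successive identifications
return to the starting point. -/
theorem mk_eq_mk_iff (a b : M.Blocks) : Quot.mk M.Rel a = Quot.mk M.Rel b ↔ a = b ∨ M.Rel a b := by
  constructor
  · intro h
    have h1 := Quot.eqvGen_exact h
    clear h
    induction h1 with
    | rel _ _ h => exact Or.inr h
    | refl _ => exact Or.inl rfl
    | symm _ _ _ ih => exact ih.imp Eq.symm M.rel_symm
    | trans _ _ _ _ _ ih1 ih2 =>
      rcases ih1 with rfl | h1
      · exact ih2
      · rcases ih2 with rfl | h2
        · exact Or.inr h1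
        · exact Or.inl (M.eq_of_rel_rel h1 h2)
  · rintro (rfl | h)
    · rfl
    · exact Quot.sound h

theorem continuous_boundaryTorus (w : M.W) : Continuous (M.boundaryTorus w) := by
  refine (continuous_sigmaMk (σ := fun v => (M.surf v).Space × UnitAddTorus (Fin 2))
    (i := w.1)).comp (Continuous.prodMk ?_ ?_)
  · exact continuous_quot_mk.comp ((continuous_sigmaMk
      (σ := fun _ : (M.surf w.1).B => UnitAddCircle × unitInterval) (i := w.2)).comp
      ((continuous_apply 0).prodMk continuous_const))
  · refine continuous_pi fun i => ?_
    fin_cases i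
    · exact continuous_apply 1
    · exact continuous_apply 2

/-- The parameter space of the pairs of equivalent points. -/
abbrev RelParam : Type := M.Blocks ⊕ (Σ _ : M.W, Torus3)

theorem compactSpace_blocks : CompactSpace M.Blocks := inferInstance

theorem compactSpace_relParam : CompactSpace M.RelParam := inferInstance

/-- The first of two equivalent points. -/
def relFst : M.RelParam → M.Blocks
  | .inl a => a
  | .inr x => M.boundaryTorus (M.op x.1) x.2

/-- The second of two equivalent points. -/
def relSnd : M.RelParam → M.Blocks
  | .inl a => a
  | .inr x => M.boundaryTorus x.1 (M.glue x.1 x.2)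

theorem continuous_relFst : Continuous M.relFst :=
  continuous_sum_dom.2 ⟨continuous_id, continuous_sigma fun w => M.continuous_boundaryTorus (M.op w)⟩

theorem continuous_relSnd : Continuous M.relSnd :=
  continuous_sum_dom.2 ⟨continuous_id, continuous_sigma fun w =>
    (M.continuous_boundaryTorus w).comp (M.glue w).continuous⟩

theorem mk_eq_mk_iff_exists (a b : M.Blocks) :
    Quot.mk M.Rel a = Quot.mk M.Rel b ↔ ∃ k, M.relFst k = a ∧ M.relSnd k = b := by
  rw [mk_eq_mk_iff]
  constructor
  · rintro (rfl | ⟨w, x⟩)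
    · exact ⟨.inl a, rfl, rfl⟩
    · exact ⟨.inr ⟨w, x⟩, rfl, rfl⟩
  · rintro ⟨a | ⟨w, x⟩, rfl, rfl⟩
    · exact Or.inl rfl
    · exact Or.inr ⟨w, x⟩

instance : T2Space M.Space :=
  t2Space_of_isQuotientMap_of_isClosed isQuotientMap_quot_mk
    (isClosed_setOf_ker_of_compact M.continuous_relFst M.continuous_relSnd M.mk_eq_mk_iff_exists)

instance : CompactSpace M.Space := Quot.compactSpace

instance : LocallyPathConnectedSpace M.Space := Quot.locallyPathConnectedSpace

theorem eq_univ_of_connected [ConnectedSpace M.Space] {T : Set M.V}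
    (hT : ∀ w : M.W, w.1 ∈ T → (M.op w).1 ∈ T) (hne : T.Nonempty) : T = Set.univ := by
  classical
  have hT' : ∀ w : M.W, (M.op w).1 ∈ T ↔ w.1 ∈ T :=
    fun w => ⟨fun h => by have := hT _ h; rwa [M.op_op] at this, hT w⟩
  let f : M.Space → Bool := Quot.lift (fun a => decide (a.1 ∈ T)) (by
    rintro _ _ ⟨w, x⟩
    exact decide_eq_decide.2 (hT' w))
  have hf : Continuous f := continuous_quot_lift _ (continuous_sigma fun v => by
    show Continuous fun _ => decide (v ∈ T)
    exact continuous_const)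
  obtain ⟨v₀, h0⟩ := hne
  have hn : ∀ v, Nonempty (M.surf v).Space := fun v => (M.surf_connected v).toNonempty
  ext v
  refine iff_of_true ?_ trivial
  have h1 : decide (v ∈ T) = decide (v₀ ∈ T) :=
    PreconnectedSpace.constant inferInstance hf (x := Quot.mk _ ⟨v, (hn v).some, 0⟩)
      (y := Quot.mk _ ⟨v₀, (hn v₀).some, 0⟩)
  exact (decide_eq_decide.1 h1).2 h0

theorem connectedSpace_of_forall_eq_univ [Nonempty M.V]
    (h : ∀ T : Set M.V, (∀ w : M.W, w.1 ∈ T → (M.op w).1 ∈ T) → T.Nonempty → T = Set.univ) :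
    ConnectedSpace M.Space := by
  obtain ⟨v₀⟩ := ‹Nonempty M.V›
  have hc := M.surf_connected
  have hn : ∀ v, Nonempty (M.surf v).Space := fun v => (M.surf_connected v).toNonempty
  have : PreconnectedSpace M.Space := by
    refine preconnectedSpace_of_forall_constant fun f hf => ?_
    have hconst : ∀ v (p p' : (M.surf v).Space × UnitAddTorus (Fin 2)),
        f (Quot.mk _ ⟨v, p⟩) = f (Quot.mk _ ⟨v, p'⟩) := by
      intro v p p'
      have hc : Continuous fun p : (M.surf v).Space × UnitAddTorus (Fin 2) =>
          f (Quot.mk M.Rel ⟨v, p⟩) := hf.comp (continuous_quot_mk.comp continuous_sigmaMk)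
      exact PreconnectedSpace.constant inferInstance hc
    let g : M.V → Bool := fun v => f (Quot.mk _ ⟨v, (hn v).some, 0⟩)
    have hs := h {v | g v = g v₀} (fun w hw => by
      have : g (M.op w).1 = g w.1 := by
        have h1 : Quot.mk M.Rel _ = Quot.mk M.Rel _ := Quot.sound (Rel.glue (M := M) w 0)
        exact (hconst _ _ _).trans ((congrArg f h1).trans (hconst _ _ _))
      exact this.trans hw) ⟨v₀, rfl⟩
    have hg : ∀ v, g v = g v₀ := fun v => (hs ▸ Set.mem_univ v : v ∈ {v | g v = g v₀})
    rintro ⟨v, p⟩ ⟨v', p'⟩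
    exact (hconst _ _ _).trans (((hg v).trans (hg v').symm).trans (hconst _ _ _))
  exact { toNonempty := ⟨Quot.mk _ ⟨v₀, (hn v₀).some, 0⟩⟩ }

end GraphGluing

/-- An involution lifts along a map with the same number of points over `x` and over `op x`. -/
theorem exists_lift_involution {X X' : Type} [Finite X'] (p : X' → X) (op : X → X)
    (hop : ∀ x, op (op x) = x)
    (hcard : ∀ x, Nat.card {x' // p x' = op x} = Nat.card {x' // p x' = x}) :
    ∃ op' : X' → X', (∀ x, op' (op' x) = x) ∧ ∀ x, p (op' x) = op (p x) := by
  classical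
  let R : X → ℕ := fun x => Nat.card {x' // p x' = x}
  have e : ∀ x, {x' // p x' = x} ≃ Fin (R x) := fun x => Finite.equivFin _
  let enum : X' → ℕ := fun x' => e (p x') ⟨x', rfl⟩
  let F : ∀ x (i : ℕ), i < R x → X' := fun x i hi => ((e x).symm ⟨i, hi⟩).1
  have hF : ∀ x i hi, p (F x i hi) = x := fun x i hi => ((e x).symm ⟨i, hi⟩).2
  have hlt : ∀ x', enum x' < R (p x') := fun x' => (e (p x') ⟨x', rfl⟩).2
  have hFe : ∀ x i hi, enum (F x i hi) = i := by
    intro x i hi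
    have : ∀ (y : {x' // p x' = x}), enum y.1 = e x y := by rintro ⟨y, rfl⟩; rfl
    rw [this, Equiv.apply_symm_apply]
  have heF : ∀ x' x (hx : p x' = x) i (hi : i < R x), enum x' = i → F x i hi = x' := by
    rintro x' _ rfl i hi rfl
    simp [F, enum]
  refine ⟨fun x' => F (op (p x')) (enum x') (by rw [show R (op (p x')) = R (p x') from hcard _]; exact hlt x'),
    fun x' => ?_, fun x' => hF _ _ _⟩
  dsimp only
  refine heF _ _ ?_ _ _ ?_
  · rw [hF, hop]
  · rw [hFe]

/-! ### Coverings of tori given by integer matrices -/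

section TorusHom

open Matrix Topology

variable {ι : Type} [Fintype ι]

/-- The endomorphism of a torus given by an integer matrix. -/
def torusHom (D : Matrix ι ι ℤ) : (ι → UnitAddCircle) →+ (ι → UnitAddCircle) where
  toFun t i := ∑ j, D i j • t j
  map_zero' := by ext; simp
  map_add' s t := by ext1 i; simp [smul_add, Finset.sum_add_distrib]

theorem torusHom_apply (D : Matrix ι ι ℤ) (t : ι → UnitAddCircle) (i : ι) :
    torusHom D t i = ∑ j, D i j • t j := rfl

theorem continuous_torusHom (D : Matrix ι ι ℤ) : Continuous (torusHom D) :=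
  continuous_pi fun i => continuous_finsetSum _ fun j _ =>
    (continuous_zsmul (D i j)).comp (continuous_apply j)

theorem torusHom_mul (D E : Matrix ι ι ℤ) (t : ι → UnitAddCircle) :
    torusHom (D * E) t = torusHom D (torusHom E t) := by
  ext1 i
  simp only [torusHom_apply, mul_apply, Finset.sum_smul, Finset.smul_sum, mul_smul]
  exact Finset.sum_comm

variable [DecidableEq ι]

theorem torusHom_smul_one (d : ℤ) (t : ι → UnitAddCircle) :
    torusHom (d • (1 : Matrix ι ι ℤ)) t = d • t := by
  ext1 i
  simp only [torusHom_apply, Matrix.smul_apply, one_apply, smul_eq_mul, mul_ite, mul_one, mul_zero,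
    ite_smul, zero_smul, Finset.sum_ite_eq, Finset.mem_univ, if_true, Pi.smul_apply]

theorem zsmul_surjective {d : ℤ} (hd : d ≠ 0) :
    Function.Surjective fun x : UnitAddCircle => d • x := by
  intro x
  obtain ⟨r, rfl⟩ := QuotientAddGroup.mk_surjective x
  refine ⟨((r / d : ℝ) : UnitAddCircle), ?_⟩
  have : (d : ℝ) ≠ 0 := by exact_mod_cast hd
  simp only [← AddCircle.coe_zsmul, zsmul_eq_mul, mul_div_cancel₀ r this]

/-- The adjugate is a right inverse up to multiplication by the determinant, which is surjective on
the torus. -/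
theorem torusHom_surjective {D : Matrix ι ι ℤ} (hD : D.det ≠ 0) :
    Function.Surjective (torusHom D) := by
  intro t
  choose s hs using fun i => zsmul_surjective hD (t i)
  refine ⟨torusHom D.adjugate s, ?_⟩
  rw [← torusHom_mul, mul_adjugate, torusHom_smul_one]
  exact funext hs

/-- By the adjugate, every element of the kernel is killed by the determinant. -/
theorem finite_ker_torusHom {D : Matrix ι ι ℤ} (hD : D.det ≠ 0) :
    ((torusHom D).ker : Set (ι → UnitAddCircle)).Finite := by
  have hfin : {x : UnitAddCircle | D.det • x = 0}.Finite := by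
    have := AddCircle.finite_torsion (1 : ℝ) (Int.natAbs_pos.2 hD)
    refine this.subset fun x hx => ?_
    simp only [Set.mem_ofPred_eq] at hx ⊢
    rw [← natCast_zsmul, Int.natCast_natAbs]
    rcases abs_choice D.det with h | h <;> rw [h]
    · exact hx
    · rw [neg_smul, hx, neg_zero]
  refine (Set.Finite.pi' fun _ : ι => hfin).subset fun t ht i => ?_
  have h : torusHom D t = 0 := ht
  have h1 := torusHom_mul D.adjugate D t
  rw [h, map_zero, adjugate_mul, torusHom_smul_one] at h1
  exact congrFun h1 i

theorem isOpenMap_torusHom {D : Matrix ι ι ℤ} (hD : D.det ≠ 0) : IsOpenMap (torusHom D) :=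
  (torusHom D).isOpenMap_of_sigmaCompact (torusHom_surjective hD) (continuous_torusHom D)

/-- The linear automorphism of `ℝ³` given by a nonsingular integer matrix. -/
noncomputable def linEquiv (D : Matrix (Fin 3) (Fin 3) ℤ) (hD : D.det ≠ 0) :
    (Fin 3 → ℝ) ≃ (Fin 3 → ℝ) :=
  have hu : IsUnit (D.map (Int.cast : ℤ → ℝ)).det := by
    have h : (D.map (Int.cast : ℤ → ℝ)).det = (D.det : ℝ) := (Int.cast_det D).symm
    rw [h, isUnit_iff_ne_zero]
    exact_mod_cast hD
  { toFun := fun x => D.map (Int.cast : ℤ → ℝ) *ᵥ x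
    invFun := fun x => (D.map (Int.cast : ℤ → ℝ))⁻¹ *ᵥ x
    left_inv := fun x => by dsimp only; rw [mulVec_mulVec, nonsing_inv_mul _ hu, one_mulVec]
    right_inv := fun x => by dsimp only; rw [mulVec_mulVec, mul_nonsing_inv _ hu, one_mulVec] }

theorem linEquiv_apply (D : Matrix (Fin 3) (Fin 3) ℤ) (hD : D.det ≠ 0) (x : Fin 3 → ℝ) :
    linEquiv D hD x = D.map (Int.cast : ℤ → ℝ) *ᵥ x := rfl

theorem contDiff_mulVec (D : Matrix (Fin 3) (Fin 3) ℝ) : ContDiff ℝ ∞ fun x => D *ᵥ x :=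
  (Matrix.toLin' D).toContinuousLinearMap.contDiff

theorem contDiff_linEquiv (D : Matrix (Fin 3) (Fin 3) ℤ) (hD : D.det ≠ 0) :
    ContDiff ℝ ∞ (linEquiv D hD) := contDiff_mulVec _

theorem contDiff_linEquiv_symm (D : Matrix (Fin 3) (Fin 3) ℤ) (hD : D.det ≠ 0) :
    ContDiff ℝ ∞ (linEquiv D hD).symm := contDiff_mulVec _

theorem linEquiv_add (D : Matrix (Fin 3) (Fin 3) ℤ) (hD : D.det ≠ 0) (x y : Fin 3 → ℝ) :
    linEquiv D hD (x + y) = linEquiv D hD x + linEquiv D hD y := by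
  simp only [linEquiv_apply, mulVec_add]

theorem linEquiv_intCast (D : Matrix (Fin 3) (Fin 3) ℤ) (hD : D.det ≠ 0) (n : Fin 3 → ℤ) :
    linEquiv D hD (fun i => (n i : ℝ)) = fun i => ((D *ᵥ n) i : ℝ) := by
  ext i
  simp [linEquiv_apply, mulVec, dotProduct]

theorem torusProj_linEquiv (D : Matrix (Fin 3) (Fin 3) ℤ) (hD : D.det ≠ 0) (x : Fin 3 → ℝ) :
    torusProj (linEquiv D hD x) = torusHom D (torusProj x) := by
  ext1 i
  show (((D.map (Int.cast : ℤ → ℝ) *ᵥ x) i : ℝ) : UnitAddCircle) = ∑ j, D i j • (x j : UnitAddCircle)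
  simp only [← AddCircle.coe_zsmul, mulVec, dotProduct, map_apply, zsmul_eq_mul]
  exact map_sum (QuotientAddGroup.mk' (AddSubgroup.zmultiples (1 : ℝ))) _ _

/-- The linear part of the conjugate is `B⁻¹ A B'`. That it equals the integral matrix `X` makes the
conjugate equivariant for `ℤ³`, so that it descends to a map of the covering tori. -/
theorem IsLinearLift.conj {H : (Fin 3 → ℝ) ≃ (Fin 3 → ℝ)} {A B B' X : Matrix (Fin 3) (Fin 3) ℤ}
    (h : IsLinearLift H A) (hB : B.det ≠ 0) (hB' : B'.det ≠ 0) (hX : B * X = A * B') :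
    IsLinearLift ((linEquiv B' hB').trans (H.trans (linEquiv B hB).symm)) X where
  contDiff := (contDiff_linEquiv_symm B hB).comp (h.contDiff.comp (contDiff_linEquiv B' hB'))
  contDiff_symm := (contDiff_linEquiv_symm B' hB').comp
    (h.contDiff_symm.comp (contDiff_linEquiv B hB))
  map_add x n := by
    simp only [Equiv.trans_apply]
    rw [Equiv.symm_apply_eq, linEquiv_add, linEquiv_add, linEquiv_intCast, linEquiv_intCast,
      h.map_add, Equiv.apply_symm_apply, mulVec_mulVec, mulVec_mulVec, hX]

end TorusHom

/-! ### The covering graph-manifold and its invariants -/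

namespace GraphGluing

open Matrix Topology

theorem iSup_comap_eq_top {ι ι' G H : Type*} [AddCommGroup G] [AddCommGroup H] {c : G →+ H}
    (hc : Function.Injective c) (P : ι → AddSubgroup H) {P' : ι' → AddSubgroup G} {φ : ι' → ι}
    (hφ : Function.Surjective φ) (hP : ∀ i, P' i = (P (φ i)).comap c)
    (hr : ∀ x, x ∈ ⨆ i, P i ↔ ∃ y, c y = x) : ⨆ i, P' i = ⊤ := by
  rw [eq_top_iff]
  intro f _
  have h2 : ⨆ i, P i ≤ (⨆ i, P' i).map c := by
    refine iSup_le fun b g hg => ?_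
    obtain ⟨b, rfl⟩ := hφ b
    obtain ⟨y, rfl⟩ := (hr g).1 (le_iSup P _ hg)
    exact ⟨y, le_iSup P' b (by rw [hP]; exact hg), rfl⟩
  obtain ⟨g, hg, hgf⟩ := h2 ((hr _).2 ⟨f, rfl⟩)
  rwa [← hc hgf]

/-- The data from which a covering of a graph-manifold is built: coverings of the base surfaces,
fibre lattices, twists, and a graph whose vertices and edges lie over those of the dual graph. -/
structure CoverData (M : GraphGluing) where
  S : M.V → PolygonSurface
  conn : ∀ v, ConnectedSpace (S v).Space
  eulerChar_neg : ∀ v, (S v).eulerChar < 0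
  π : ∀ v, PolygonSurface.Cover (S v) (M.surf v)
  φ_surjective : ∀ v, Function.Surjective (π v).φ
  n : ℕ
  n_pos : 0 < n
  C : M.V → Matrix (Fin 2) (Fin 2) ℤ
  det_C : ∀ v, 0 < (C v).det
  mem_iff : ∀ v x, x ∈ M.fiberIntersectionGroup v ↔ ∃ y, C v *ᵥ y = x
  k : M.W → ℕ
  k_pos : ∀ w, 0 < k w
  m_eq : ∀ v b, (π v).m b = n * k ⟨v, b⟩
  f : (Σ v, (S v).B) → Fin 2 → ℤ
  θ : ∀ v, (S v).Space → UnitAddTorus (Fin 2)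
  continuous_θ : ∀ v, Continuous (θ v)
  θ_boundaryPoint : ∀ v c x j, θ v ((S v).boundaryPoint c x) j = ((n : ℤ) * f ⟨v, c⟩ j) • x
  exists_mat : ∀ u u' : Σ v, (S v).B,
    (⟨u'.1, (π u'.1).φ u'.2⟩ : M.W) = M.op ⟨u.1, (π u.1).φ u.2⟩ →
      ∃ X, blk (k ⟨u.1, (π u.1).φ u.2⟩) (f u) (C u.1) * X =
        M.mat ⟨u.1, (π u.1).φ u.2⟩ * blk (k ⟨u'.1, (π u'.1).φ u'.2⟩) (f u') (C u'.1) ∧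
          Int.gcd (X 0 1) (X 0 2) = 1
  V : Type
  finite_V : Finite V
  nonempty_V : Nonempty V
  p : V → M.V
  p_surjective : Function.Surjective p
  op : (Σ x, (S (p x)).B) → (Σ x, (S (p x)).B)
  op_op : ∀ w, op (op w) = w
  p_op : ∀ w, (⟨p (op w).1, (π _).φ (op w).2⟩ : M.W) = M.op ⟨p w.1, (π _).φ w.2⟩
  eq_univ : ∀ T : Set V, (∀ w : Σ x, (S (p x)).B, w.1 ∈ T → (op w).1 ∈ T) → T.Nonempty →
    T = Set.univ

namespace CoverData

variable {M : GraphGluing} (𝒟 : CoverData M)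

/-- The directed edges of the covering graph. -/
abbrev W : Type := Σ x, (𝒟.S (𝒟.p x)).B

/-- The projection of directed edges. -/
def pW (w : 𝒟.W) : M.W := ⟨𝒟.p w.1, (𝒟.π _).φ w.2⟩

theorem pW_op (w : 𝒟.W) : 𝒟.pW (𝒟.op w) = M.op (𝒟.pW w) := 𝒟.p_op w

/-- The matrix of the covering of a boundary torus, up to the factor `n`. -/
def B (w : 𝒟.W) : Matrix (Fin 3) (Fin 3) ℤ :=
  blk (𝒟.k (𝒟.pW w)) (𝒟.f ⟨𝒟.p w.1, w.2⟩) (𝒟.C (𝒟.p w.1))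

theorem det_B_pos (w : 𝒟.W) : 0 < (𝒟.B w).det := by
  rw [B, det_blk]
  have := 𝒟.k_pos (𝒟.pW w)
  have := 𝒟.det_C (𝒟.p w.1)
  positivity

theorem det_nB_ne (w : 𝒟.W) : ((𝒟.n : ℤ) • 𝒟.B w).det ≠ 0 := by
  rw [det_smul]
  have := 𝒟.n_pos
  have := 𝒟.det_B_pos w
  positivity

theorem exists_mat' (w : 𝒟.W) : ∃ X, 𝒟.B w * X = M.mat (𝒟.pW w) * 𝒟.B (𝒟.op w) ∧
    Int.gcd (X 0 1) (X 0 2) = 1 :=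
  𝒟.exists_mat ⟨𝒟.p w.1, w.2⟩ ⟨𝒟.p (𝒟.op w).1, (𝒟.op w).2⟩ (𝒟.pW_op w)

/-- The gluing matrices of the covering. -/
noncomputable def mat (w : 𝒟.W) : Matrix (Fin 3) (Fin 3) ℤ := (𝒟.exists_mat' w).choose

theorem B_mul_mat (w : 𝒟.W) : 𝒟.B w * 𝒟.mat w = M.mat (𝒟.pW w) * 𝒟.B (𝒟.op w) :=
  (𝒟.exists_mat' w).choose_spec.1

theorem gcd_mat (w : 𝒟.W) : Int.gcd (𝒟.mat w 0 1) (𝒟.mat w 0 2) = 1 :=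
  (𝒟.exists_mat' w).choose_spec.2

theorem mat_mul_mat_op (w : 𝒟.W) : 𝒟.mat w * 𝒟.mat (𝒟.op w) = 1 := by
  have h : 𝒟.B w * (𝒟.mat w * 𝒟.mat (𝒟.op w)) = 𝒟.B w * 1 := by
    rw [← mul_assoc, B_mul_mat, mul_assoc, B_mul_mat, pW_op, 𝒟.op_op, ← mul_assoc,
      M.mat_mul_mat_op, one_mul, mul_one]
  have h2 := congrArg (fun Y => (𝒟.B w).adjugate * Y) h
  simp only [← mul_assoc, adjugate_mul, smul_mul, one_mul] at h2
  exact smul_right_injective _ (𝒟.det_B_pos w).ne' h2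

/-- Invertibility leaves only the signs `±1`. The coordinate changes have positive determinant, so
the sign is that of the gluing in `M`. -/
theorem det_mat (w : 𝒟.W) : (𝒟.mat w).det = -1 := by
  have h1 := congrArg det (𝒟.mat_mul_mat_op w)
  rw [det_mul, det_one] at h1
  have h2 := congrArg det (𝒟.B_mul_mat w)
  rw [det_mul, det_mul, M.det_mat] at h2
  have h3 := 𝒟.det_B_pos w
  have h4 := 𝒟.det_B_pos (𝒟.op w)
  rcases Int.eq_one_or_neg_one_of_mul_eq_one h1 with h | h
  · rw [h] at h2; linarith
  · exact h

theorem fiber_ne (w : 𝒟.W) : fiberImage (𝒟.mat w) ≠ fiberGroup := by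
  apply fiberImage_ne_of_ne
  by_contra! h
  have := 𝒟.gcd_mat w
  rw [h.1, h.2] at this
  simp at this

/-- The lifts of the gluing maps of the covering to the universal coverings of the tori. -/
noncomputable def lift (w : 𝒟.W) : (Fin 3 → ℝ) ≃ (Fin 3 → ℝ) :=
  (linEquiv _ (𝒟.det_nB_ne (𝒟.op w))).trans
    ((M.exists_lifts.choose (𝒟.pW w)).trans (linEquiv _ (𝒟.det_nB_ne w)).symm)

theorem isLinearLift_lift (w : 𝒟.W) : IsLinearLift (𝒟.lift w) (𝒟.mat w) :=
  (M.exists_lifts.choose_spec.2.1 (𝒟.pW w)).conj _ _ (by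
    rw [smul_mul, B_mul_mat, Matrix.mul_smul])

theorem lift_op (w : 𝒟.W) : 𝒟.lift (𝒟.op w) = (𝒟.lift w).symm := by
  have h : ∀ w' w'' u, w' = w'' → M.exists_lifts.choose u = (M.exists_lifts.choose (𝒟.pW w)).symm →
    (linEquiv _ (𝒟.det_nB_ne w')).trans
    ((M.exists_lifts.choose u).trans (linEquiv _ (𝒟.det_nB_ne (𝒟.op w))).symm) =
    ((linEquiv _ (𝒟.det_nB_ne (𝒟.op w))).trans
    ((M.exists_lifts.choose (𝒟.pW w)).trans (linEquiv _ (𝒟.det_nB_ne w'')).symm)).symm := by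
    rintro w' _ u rfl h
    rw [h]
    rfl
  refine h _ _ _ (𝒟.op_op w) ?_
  rw [pW_op, M.exists_lifts.choose_spec.1]

/-- The gluing maps of the covering. -/
noncomputable def glue (w : 𝒟.W) : Torus3 ≃ₜ Torus3 :=
  ((𝒟.isLinearLift_lift w).exists_homeomorph (𝒟.mat_mul_mat_op w)).choose

theorem torusProj_lift (w : 𝒟.W) (x : Fin 3 → ℝ) :
    torusProj (𝒟.lift w x) = 𝒟.glue w (torusProj x) :=
  ((𝒟.isLinearLift_lift w).exists_homeomorph (𝒟.mat_mul_mat_op w)).choose_spec x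

theorem glue_op (w : 𝒟.W) : 𝒟.glue (𝒟.op w) = (𝒟.glue w).symm := by
  ext1 y
  rw [Homeomorph.eq_symm_apply]
  obtain ⟨x, rfl⟩ := torusProj_surjective y
  rw [← torusProj_lift, ← torusProj_lift, lift_op, Equiv.apply_symm_apply]

theorem torusHom_glue (w : 𝒟.W) (y : Torus3) :
    torusHom ((𝒟.n : ℤ) • 𝒟.B w) (𝒟.glue w y) =
      M.glue (𝒟.pW w) (torusHom ((𝒟.n : ℤ) • 𝒟.B (𝒟.op w)) y) := by
  obtain ⟨x, rfl⟩ := torusProj_surjective y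
  rw [← torusProj_lift, ← torusProj_linEquiv _ (𝒟.det_nB_ne _), ← torusProj_linEquiv _ (𝒟.det_nB_ne _),
    ← M.exists_lifts.choose_spec.2.2]
  simp only [lift, Equiv.trans_apply, Equiv.apply_symm_apply]

/-- The covering graph-manifold. -/
noncomputable abbrev cover : GraphGluing where
  V := 𝒟.V
  finite_V := 𝒟.finite_V
  surf x := 𝒟.S (𝒟.p x)
  surf_connected x := 𝒟.conn _
  surf_eulerChar x := 𝒟.eulerChar_neg _
  op := 𝒟.op
  op_op := 𝒟.op_op
  op_ne w h := M.op_ne (𝒟.pW w) (by rw [← pW_op, h])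
  glue := 𝒟.glue
  glue_op := 𝒟.glue_op
  mat := 𝒟.mat
  glue_diffeo w := ⟨𝒟.lift w, (𝒟.isLinearLift_lift w).contDiff,
    (𝒟.isLinearLift_lift w).contDiff_symm, 𝒟.torusProj_lift w, (𝒟.isLinearLift_lift w).map_add⟩
  det_mat := 𝒟.det_mat
  fiber_ne := 𝒟.fiber_ne

theorem connectedSpace_cover : ConnectedSpace 𝒟.cover.Space := by
  have : Nonempty 𝒟.cover.V := 𝒟.nonempty_V
  exact 𝒟.cover.connectedSpace_of_forall_eq_univ 𝒟.eq_univ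

theorem intersectionNumber_cover (w : 𝒟.cover.W) : 𝒟.cover.intersectionNumber w = 1 := 𝒟.gcd_mat w

/-- In `B_mul_mat` for `op w`, the first coordinates of the two sides applied to a fibre vector
agree up to the nonzero factor `k`. -/
theorem mem_intersectionLattice_cover (w : 𝒟.W) (f : Fin 2 → ℤ) :
    f ∈ 𝒟.cover.intersectionLattice w ↔ 𝒟.C (𝒟.p w.1) *ᵥ f ∈ M.intersectionLattice (𝒟.pW w) := by
  refine (mem_intersectionLattice_iff 𝒟.cover w f).trans ?_
  rw [mem_intersectionLattice_iff, ← pW_op]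
  have h := congrArg (fun Y => (Y *ᵥ fiberIncl f) 0) (𝒟.B_mul_mat (𝒟.op w))
  simp only [𝒟.op_op] at h
  rw [← mulVec_mulVec, ← mulVec_mulVec, B, B, blk_mulVec_fiberIncl, blk_mulVec] at h
  simp only [fiberIncl_apply _, Pi.add_apply, Pi.smul_apply, cons_val_zero, smul_eq_mul,
    add_zero] at h
  have hk : 𝒟.k (𝒟.pW (𝒟.op w)) ≠ 0 := (𝒟.k_pos _).ne'
  rw [fiberIncl_apply, fiberIncl_apply, ← h]
  show (𝒟.mat (𝒟.op w) *ᵥ _) 0 = 0 ↔ _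
  simp [hk]

/-- The lattices upstairs are preimages under `C` of those below. Type at least two therefore
persists below, where the lattices generate exactly the image of `C`; pulled back, they generate
everything. -/
theorem secondaryIntersectionNumber_cover (x : 𝒟.cover.V) :
    𝒟.cover.secondaryIntersectionNumber x = 1 := by
  rw [secondaryIntersectionNumber, AddSubgroup.index_eq_one]
  unfold fiberIntersectionGroup
  split_ifs with ht
  swap
  · rfl
  let v := 𝒟.p x
  let c : (Fin 2 → ℤ) →+ (Fin 2 → ℤ) := (𝒟.C v).mulVecLin.toAddMonoidHom
  have hc : ∀ f, c f = 𝒟.C v *ᵥ f := fun f => rfl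
  have hcinj : Function.Injective c := mulVec_injective_of_det_ne_zero (𝒟.det_C v).ne'
  have hcomap : ∀ b : (𝒟.cover.surf x).B, 𝒟.cover.intersectionLattice ⟨x, b⟩ =
      (M.intersectionLattice ⟨v, (𝒟.π v).φ b⟩).comap c := fun b => by
    ext f
    exact 𝒟.mem_intersectionLattice_cover ⟨x, b⟩ f
  have ht' : 2 ≤ M.type v := by
    obtain ⟨K, ⟨b, rfl⟩, K', ⟨b', rfl⟩, hne⟩ := (Set.one_lt_ncard (Set.finite_range _)).1 ht
    refine (Set.one_lt_ncard (Set.finite_range _)).2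
      ⟨_, ⟨(𝒟.π v).φ b, rfl⟩, _, ⟨(𝒟.π v).φ b', rfl⟩, fun h => hne ?_⟩
    dsimp only at h ⊢
    rw [hcomap, hcomap, h]
  refine iSup_comap_eq_top hcinj (fun b => M.intersectionLattice ⟨v, b⟩) (𝒟.φ_surjective v) hcomap
    fun x => ?_
  have h := 𝒟.mem_iff v x
  rwa [fiberIntersectionGroup, if_pos ht'] at h

end CoverData

end GraphGluing

/-- The shear `(x, g) ↦ (x, θ x + g)`. -/
def Homeomorph.shearAdd {X G : Type*} [TopologicalSpace X] [TopologicalSpace G] [AddGroup G]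
    [IsTopologicalAddGroup G] (θ : X → G) (hθ : Continuous θ) : X × G ≃ₜ X × G where
  toFun a := (a.1, θ a.1 + a.2)
  invFun a := (a.1, -θ a.1 + a.2)
  left_inv a := by simp
  right_inv a := by simp
  continuous_toFun := by fun_prop
  continuous_invFun := by fun_prop

/-! ### The covering map onto the given graph-manifold -/

namespace GraphGluing

namespace CoverData

open Matrix Topology

variable {M : GraphGluing} (𝒟 : CoverData M)

theorem det_nC_ne (v : M.V) : ((𝒟.n : ℤ) • 𝒟.C v).det ≠ 0 := by
  rw [det_smul]
  have := 𝒟.n_pos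
  have := 𝒟.det_C v
  positivity

/-- The covering of a block. -/
def blockMap (v : M.V) (a : (𝒟.S v).Space × UnitAddTorus (Fin 2)) :
    (M.surf v).Space × UnitAddTorus (Fin 2) :=
  ((𝒟.π v).map a.1, 𝒟.θ v a.1 + torusHom ((𝒟.n : ℤ) • 𝒟.C v) a.2)

theorem isCoveringMap_π (v : M.V) : IsCoveringMap (𝒟.π v).map :=
  (𝒟.π v).isCoveringMap_map (𝒟.φ_surjective v)

theorem blockMap_eq (v : M.V) : 𝒟.blockMap v =
    (Prod.map (𝒟.π v).map id) ∘ (Homeomorph.shearAdd (𝒟.θ v) (𝒟.continuous_θ v)) ∘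
      Prod.map id (torusHom ((𝒟.n : ℤ) • 𝒟.C v)) := rfl

theorem continuous_blockMap (v : M.V) : Continuous (𝒟.blockMap v) := by
  rw [blockMap_eq]
  exact ((𝒟.isCoveringMap_π v).continuous.prodMap continuous_id).comp
    ((Homeomorph.continuous _).comp (continuous_id.prodMap (continuous_torusHom _)))

theorem isOpenMap_blockMap (v : M.V) : IsOpenMap (𝒟.blockMap v) := by
  rw [blockMap_eq]
  exact ((𝒟.isCoveringMap_π v).isLocalHomeomorph.isOpenMap.prodMap IsOpenMap.id).comp
    ((Homeomorph.isOpenMap _).comp (IsOpenMap.id.prodMap (isOpenMap_torusHom (𝒟.det_nC_ne v))))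

theorem isLocallyInjective_blockMap (v : M.V) : IsLocallyInjective (𝒟.blockMap v) := by
  rw [blockMap_eq]
  have hid : ∀ {X : Type} [TopologicalSpace X], IsLocallyInjective (id : X → X) :=
    Function.injective_id.IsLocallyInjective
  refine ((𝒟.isCoveringMap_π v).isLocalHomeomorph.isLocallyInjective'.prodMap' hid).comp'
    (IsLocallyInjective.comp' (Homeomorph.injective _).IsLocallyInjective
      (hid.prodMap' ?_) ?_) ?_
  · exact AddMonoidHom.isLocallyInjective_of_finite_ker _ (finite_ker_torusHom (𝒟.det_nC_ne v))
  · exact continuous_id.prodMap (continuous_torusHom _)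
  · exact (Homeomorph.continuous _).comp (continuous_id.prodMap (continuous_torusHom _))

theorem blockMap_surjective (v : M.V) : Function.Surjective (𝒟.blockMap v) := by
  rintro ⟨y, t⟩
  obtain ⟨⟨b, x, s⟩, rfl⟩ := Quot.exists_rep y
  obtain ⟨c, rfl⟩ := 𝒟.φ_surjective v b
  obtain ⟨x', rfl⟩ := PolygonSurface.Cover.nsmul_surjective ((𝒟.π v).m_pos ((𝒟.π v).φ c)) x
  let y' : (𝒟.S v).Space := Quot.mk _ ⟨c, x', s⟩
  obtain ⟨t', ht'⟩ := torusHom_surjective (𝒟.det_nC_ne v) (t - 𝒟.θ v y')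
  refine ⟨(y', t'), Prod.ext rfl ?_⟩
  simp only [blockMap, ht', add_sub_cancel]

/-- The covering of the disjoint union of the blocks. -/
def blocksMap : 𝒟.cover.Blocks → M.Blocks := Sigma.map 𝒟.p fun x => 𝒟.blockMap (𝒟.p x)

/-- The degree `n k` on the circle, the twist `n f` and the fibre matrix `n C` are the blocks of `n
B`. Together with `torusHom_glue` this makes the block coverings compatible with the gluings. -/
theorem blocksMap_boundaryTorus (w : 𝒟.W) (X : Torus3) :
    𝒟.blocksMap (𝒟.cover.boundaryTorus w X) =
      M.boundaryTorus (𝒟.pW w) (torusHom ((𝒟.n : ℤ) • 𝒟.B w) X) := by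
  simp only [blocksMap, boundaryTorus, Sigma.map, pW, blockMap]
  congr 1
  refine Prod.ext ?_ ?_
  · simp only [PolygonSurface.Cover.map_boundaryPoint]
    congr 1
    rw [𝒟.m_eq, torusHom_apply, Fin.sum_univ_three]
    simp [B, blk, pW, mul_smul]
  · ext1 i
    simp only [Pi.add_apply, 𝒟.θ_boundaryPoint, torusHom_apply, Matrix.smul_apply, smul_eq_mul]
    fin_cases i
    · simp [Fin.sum_univ_succ, B, blk]
    · simp [Fin.sum_univ_succ, B, blk]

theorem exists_of_blocksMap_eq {a : 𝒟.cover.Blocks} {u : M.W} {X : Torus3}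
    (h : 𝒟.blocksMap a = M.boundaryTorus u X) :
    ∃ (w : 𝒟.W) (X' : Torus3), a = 𝒟.cover.boundaryTorus w X' ∧ 𝒟.pW w = u ∧
      torusHom ((𝒟.n : ℤ) • 𝒟.B w) X' = X := by
  obtain ⟨x, y, t⟩ := a
  obtain ⟨v, b⟩ := u
  have h' := h
  simp only [blocksMap, boundaryTorus, Sigma.map] at h'
  obtain ⟨rfl, h1⟩ := Sigma.mk.inj h'
  have h1 := congrArg Prod.fst (eq_of_heq h1)
  obtain ⟨c, x', rfl, -, -⟩ := (𝒟.π (𝒟.p x)).exists_of_map_eq_boundaryPoint h1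
  have e : (⟨x, (𝒟.S (𝒟.p x)).boundaryPoint c x', t⟩ : 𝒟.cover.Blocks) =
      𝒟.cover.boundaryTorus ⟨x, c⟩ ![x', t 0, t 1] := by
    simp only [boundaryTorus]
    congr 2
    ext1 i
    fin_cases i <;> rfl
  rw [e] at h ⊢
  rw [blocksMap_boundaryTorus] at h
  obtain ⟨h2, h3⟩ := M.boundaryTorus_inj h
  exact ⟨_, _, rfl, h2, h3⟩

theorem rel_blocksMap {a b : 𝒟.cover.Blocks} (h : 𝒟.cover.Rel a b) :
    M.Rel (𝒟.blocksMap a) (𝒟.blocksMap b) := by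
  obtain ⟨w, x⟩ := h
  have h1 := 𝒟.blocksMap_boundaryTorus (𝒟.op w) x
  have h2 := 𝒟.blocksMap_boundaryTorus w (𝒟.glue w x)
  rw [𝒟.torusHom_glue] at h2
  rw [pW_op] at h1
  exact (h1.trans rfl : 𝒟.blocksMap (𝒟.cover.boundaryTorus (𝒟.cover.op w) x) = _) ▸
    (h2.trans rfl : 𝒟.blocksMap (𝒟.cover.boundaryTorus w (𝒟.cover.glue w x)) = _) ▸
      Rel.glue _ _

/-- The covering of graph-manifolds. -/
def map : 𝒟.cover.Space → M.Space :=
  Quot.map 𝒟.blocksMap fun _ _ h => 𝒟.rel_blocksMap h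

/-- On the blocks the map is open and locally injective. Points over boundary tori lie on boundary
tori, and each of these has a unique partner, so the gluing relation lifts uniquely. -/
theorem isCoveringMap_map : IsCoveringMap 𝒟.map := by
  have : CompactSpace 𝒟.cover.RelParam := compactSpace_relParam 𝒟.cover
  have : CompactSpace 𝒟.cover.Blocks := compactSpace_blocks 𝒟.cover
  refine (isCoveringMap_of_quotient (A := M.Blocks) (A' := 𝒟.cover.Blocks)
    (K := 𝒟.cover.RelParam) isQuotientMap_quot_mk isQuotientMap_quot_mk (pre := 𝒟.blocksMap) (p := 𝒟.map)
    ?_ ?_ ?_ ?_ (fun a => rfl) 𝒟.cover.continuous_relFst 𝒟.cover.continuous_relSnd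
    𝒟.cover.mk_eq_mk_iff_exists ?_ ?_).2.2
  · exact Continuous.sigma_map fun x => 𝒟.continuous_blockMap (𝒟.p x)
  · exact isOpenMap_sigma_map.2 fun x => 𝒟.isOpenMap_blockMap (𝒟.p x)
  · exact isLocallyInjective_sigmaMap _ _ fun x => 𝒟.isLocallyInjective_blockMap (𝒟.p x)
  · rintro ⟨v, a⟩
    obtain ⟨x, rfl⟩ := 𝒟.p_surjective v
    obtain ⟨a', rfl⟩ := 𝒟.blockMap_surjective _ a
    exact ⟨⟨x, a'⟩, rfl⟩
  · intro a c h
    have key : ∃ b, (a = b ∨ 𝒟.cover.Rel a b) ∧ 𝒟.blocksMap b = c := by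
      rcases (M.mk_eq_mk_iff _ _).1 h with h | h
      · exact ⟨a, Or.inl rfl, h⟩
      · generalize ha : 𝒟.blocksMap a = a' at h
        obtain ⟨u, X⟩ := h
        obtain ⟨w, X', rfl, hu, rfl⟩ := 𝒟.exists_of_blocksMap_eq ha
        have hr : 𝒟.cover.Rel (𝒟.cover.boundaryTorus (𝒟.op (𝒟.op w)) X')
          (𝒟.cover.boundaryTorus (𝒟.op w) (𝒟.glue (𝒟.op w) X')) := Rel.glue (M := 𝒟.cover) (𝒟.op w) X'
        rw [𝒟.op_op] at hr
        refine ⟨_, Or.inr hr, ?_⟩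
        rw [blocksMap_boundaryTorus, torusHom_glue, pW_op, hu, M.op_op, 𝒟.op_op]
    obtain ⟨b, hb, rfl⟩ := key
    obtain ⟨k, h1, rfl⟩ := (𝒟.cover.mk_eq_mk_iff_exists a b).1 ((𝒟.cover.mk_eq_mk_iff a b).2 hb)
    exact ⟨k, h1, rfl⟩
  · intro a b h hab
    rcases (𝒟.cover.mk_eq_mk_iff a b).1 h with h | h
    · exact h
    · have h1 := 𝒟.rel_blocksMap h
      rw [hab] at h1
      generalize h3 : 𝒟.blocksMap b = c at h1
      clear hab h3 h
      generalize hc : c = c' at h1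
      have h2 : ∀ c c', M.Rel c c' → c ≠ c' := by
        rintro _ _ ⟨w, x⟩ h
        exact M.op_ne w (M.boundaryTorus_inj h).1
      exact absurd rfl (h2 _ _ (hc ▸ h1))

end CoverData

end GraphGluing

/-! ### Existence of the covering data -/

namespace GraphGluing

open Matrix

variable (M : GraphGluing)

/-- A connected finite graph over the dual graph whose vertices have the prescribed links. -/
theorem exists_graph_cover [ConnectedSpace M.Space] (S : M.V → PolygonSurface)
    (φ : ∀ v, (S v).B → (M.surf v).B) (hφ : ∀ v, Function.Surjective (φ v)) (K : M.V → ℕ)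
    (hK : ∀ v, 0 < K v)
    (hcard : ∀ w : M.W, K (M.op w).1 * Nat.card {c // φ _ c = (M.op w).2} =
      K w.1 * Nat.card {c // φ _ c = w.2}) :
    ∃ (V : Type) (_ : Finite V) (_ : Nonempty V) (p : V → M.V) (_ : Function.Surjective p)
      (op : (Σ x, (S (p x)).B) → (Σ x, (S (p x)).B)), (∀ w, op (op w) = w) ∧
      (∀ w, (⟨p (op w).1, φ _ (op w).2⟩ : M.W) = M.op ⟨p w.1, φ _ w.2⟩) ∧
      ∀ T : Set V, (∀ w : Σ x, (S (p x)).B, w.1 ∈ T → (op w).1 ∈ T) → T.Nonempty →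
        T = Set.univ := by
  let V₀ : Type := Σ v, Fin (K v)
  let W₀ : Type := Σ x : V₀, (S x.1).B
  let q : W₀ → M.W := fun w => ⟨w.1.1, φ _ w.2⟩
  have hq : ∀ w : M.W, Nat.card {x // q x = w} = K w.1 * Nat.card {c // φ _ c = w.2} := by
    intro w
    let g : Fin (K w.1) × {c // φ _ c = w.2} → {x // q x = w} := fun y =>
      ⟨⟨⟨w.1, y.1⟩, y.2.1⟩, by simp only [q]; rw [y.2.2]⟩
    have hg : Function.Bijective g := by
      constructor
      · rintro ⟨i, c, hc⟩ ⟨i', c', hc'⟩ h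
        obtain ⟨h1, h2⟩ := Sigma.mk.inj (congrArg Subtype.val h)
        obtain ⟨-, h1⟩ := Sigma.mk.inj h1
        obtain rfl := eq_of_heq h1
        obtain rfl := eq_of_heq h2
        rfl
      · rintro ⟨x, rfl⟩
        exact ⟨(x.1.2, ⟨x.2, rfl⟩), rfl⟩
    rw [← Nat.card_eq_of_bijective g hg, Nat.card_prod]
    simp
  have : Finite V₀ := inferInstanceAs (Finite (Σ v, Fin (K v)))
  have : Finite W₀ := inferInstanceAs (Finite (Σ x : V₀, (S x.1).B))
  obtain ⟨op₀, hop₀, hq₀⟩ := exists_lift_involution q M.op M.op_op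
    (fun w => by rw [hq, hq, hcard])
  have hne₀ : Nonempty V₀ := by
    obtain ⟨y⟩ := (inferInstance : Nonempty M.Space)
    obtain ⟨a, -⟩ := Quot.exists_rep y
    exact ⟨⟨a.1, ⟨0, hK _⟩⟩⟩
  -- A minimal nonempty set of vertices closed under adjacency is a connected component.
  obtain ⟨T, ⟨hT, hTne⟩, hmin⟩ := (Set.toFinite {T : Set V₀ |
    (∀ w : W₀, w.1 ∈ T → (op₀ w).1 ∈ T) ∧ T.Nonempty}).exists_minimal
      ⟨Set.univ, fun _ _ => trivial, Set.univ_nonempty⟩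
  let ι : (Σ x : T, (S x.1.1).B) → W₀ := fun w => ⟨w.1.1, w.2⟩
  have hι : Function.Injective ι := by
    rintro ⟨⟨x, hx⟩, c⟩ ⟨⟨x', hx'⟩, c'⟩ h
    obtain ⟨rfl, h⟩ := Sigma.mk.inj h
    obtain rfl := eq_of_heq h
    rfl
  let op : (Σ x : T, (S x.1.1).B) → (Σ x : T, (S x.1.1).B) := fun w =>
    ⟨⟨(op₀ (ι w)).1, hT (ι w) w.1.2⟩, (op₀ (ι w)).2⟩
  have hopι : ∀ w, ι (op w) = op₀ (ι w) := fun w => rfl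
  refine ⟨T, inferInstance, hTne.to_subtype, fun x => x.1.1, ?_, op, ?_, ?_, ?_⟩
  · have h := M.eq_univ_of_connected (T := Set.range fun x : T => x.1.1) ?_ ?_
    · exact Set.range_eq_univ.1 h
    · rintro ⟨v, b⟩ ⟨x, rfl⟩
      obtain ⟨c, rfl⟩ := hφ _ b
      have := hq₀ (ι ⟨x, c⟩)
      exact ⟨⟨_, hT (ι ⟨x, c⟩) x.2⟩, congrArg Sigma.fst this⟩
    · have := hTne.to_subtype
      exact Set.range_nonempty _
  · intro w
    apply hι
    rw [hopι, hopι, hop₀]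
  · exact fun w => hq₀ (ι w)
  · intro T' hT' hne
    have h1 : T ⊆ Subtype.val '' T' := by
      refine hmin ⟨?_, hne.image _⟩ (by rintro _ ⟨x, -, rfl⟩; exact x.2)
      rintro ⟨x, c⟩ ⟨x', hx', rfl⟩
      exact ⟨_, hT' ⟨x', c⟩ hx', rfl⟩
    ext x
    refine iff_of_true ?_ trivial
    obtain ⟨x', hx', h⟩ := h1 x.2
    rwa [← Subtype.ext h]

/-- Integrality of `X` and `X'` makes the two positive determinants divide each other. Each is the
index of the lattice in the homology of its torus. -/
theorem eq_of_blk_mul_eq {k k' : ℤ} {g g' : Fin 2 → ℤ} {C C' : Matrix (Fin 2) (Fin 2) ℤ}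
    {A A' X X' : Matrix (Fin 3) (Fin 3) ℤ} (hA : A.det = -1) (hA' : A'.det = -1)
    (h : blk k g C * X = A * blk k' g' C') (h' : blk k' g' C' * X' = A' * blk k g C)
    (hp : 0 < k * C.det) (hp' : 0 < k' * C'.det) : k * C.det = k' * C'.det := by
  have e := congrArg det h
  have e' := congrArg det h'
  rw [det_mul, det_mul, det_blk, det_blk, hA] at e
  rw [det_mul, det_mul, det_blk, det_blk, hA'] at e'
  have h1 : k' * C'.det ∣ k * C.det := ⟨-X'.det, by linarith⟩
  have h2 : k * C.det ∣ k' * C'.det := ⟨-X.det, by linarith⟩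
  exact Int.dvd_antisymm hp.le hp'.le h2 h1

/-- Each value of `f₀` occurs a multiple of `e` times, so the total lies in `L` and can be
subtracted at a single boundary circle. -/
theorem exists_twist_values {B B' : Type} [Fintype B] [Fintype B'] [Nonempty B'] (φ : B' → B)
    (L : AddSubgroup (Fin 2 → ℤ)) {e : ℕ} (hL : ∀ x, e • x ∈ L) (f₀ : B → Fin 2 → ℤ)
    (he : ∀ b, e ∣ Nat.card {c // φ c = b}) :
    ∃ f : B' → Fin 2 → ℤ, (∀ c, ∃ g ∈ L, f c = f₀ (φ c) + g) ∧ ∑ c, f c = 0 := by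
  classical
  obtain ⟨c₀⟩ := ‹Nonempty B'›
  have hmem : ∑ c, f₀ (φ c) ∈ L := by
    rw [← Finset.sum_fiberwise Finset.univ φ]
    refine sum_mem fun b _ => ?_
    rw [Finset.sum_congr rfl (g := fun _ => f₀ b)]
    · rw [Finset.sum_const]
      obtain ⟨r, hr⟩ := he b
      rw [Nat.card_eq_fintype_card, Fintype.card_subtype] at hr
      rw [hr, mul_comm, mul_smul]
      exact L.nsmul_mem (hL _) r
    · intro c hc
      rw [(Finset.mem_filter.1 hc).2]
  refine ⟨fun c => f₀ (φ c) + if c = c₀ then -∑ c, f₀ (φ c) else 0, fun c => ⟨_, ?_, rfl⟩, ?_⟩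
  · split_ifs
    · exact L.neg_mem hmem
    · exact L.zero_mem
  · rw [Finset.sum_add_distrib, Finset.sum_ite_eq' Finset.univ c₀]
    simp

theorem exists_coverData [ConnectedSpace M.Space] : Nonempty (CoverData M) := by
  classical
  have := Fintype.ofFinite M.V
  have : ∀ v, Fintype (M.surf v).B := fun v => Fintype.ofFinite _
  obtain ⟨C, k, f₀, e, he, hC, hmem, hemem, hk, hX⟩ := M.exists_lattice_data
  -- Evenness is needed for the surface coverings, divisibility by `e * k w` for the twists.
  obtain ⟨n, hn, hn2, hkn⟩ : ∃ n, 0 < n ∧ 2 ∣ n ∧ ∀ w, e * k w ∣ n :=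
    ⟨2 * e * ∏ w, k w, Nat.mul_pos (Nat.mul_pos two_pos he) (Finset.prod_pos fun w _ => hk w),
      ⟨e * ∏ w, k w, by ring⟩, fun w =>
      Nat.mul_dvd_mul (dvd_mul_left e 2) (Finset.dvd_prod_of_mem k (Finset.mem_univ w))⟩
  have hS := fun v =>
    have := M.surf_connected v
    (M.surf v).exists_cover (M.surf_eulerChar v) (fun b => k ⟨v, b⟩) (fun b => hk _) n hn hn2
  choose S π N hconn heuler hm hN hNdvd hcard using hS
  have : ∀ v, Fintype (S v).B := fun v => Fintype.ofFinite _
  have hφ : ∀ v, Function.Surjective (π v).φ := by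
    intro v b
    by_contra! h
    have : IsEmpty {c // (π v).φ c = b} := ⟨fun c => h c.1 c.2⟩
    have h1 := hcard v b
    rw [Nat.card_of_isEmpty, zero_mul] at h1
    exact absurd h1.symm (hN v).ne'
  -- The degree `N v` is the number of circles over `b` times `n * k`, and is divisible by `n ^ 2`.
  -- Hence `n`, and with it `e * k`, divides the number of circles times `k`.
  have hedvd : ∀ v b, e ∣ Nat.card {c // (π v).φ c = b} := by
    intro v b
    have h1 := hNdvd v
    rw [← hcard v b, pow_two, mul_comm n (k _), ← mul_assoc] at h1
    have h2 := (hkn ⟨v, b⟩).trans (Nat.dvd_of_mul_dvd_mul_right hn h1)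
    exact Nat.dvd_of_mul_dvd_mul_right (hk _) h2
  have hne : ∀ v, Nonempty (S v).B := fun v => by
    obtain ⟨y⟩ := (hconn v).toNonempty
    obtain ⟨a, -⟩ := Quot.exists_rep y
    exact ⟨a.1⟩
  choose f hf hfsum using fun v => exists_twist_values (π v).φ (M.fiberIntersectionGroup v)
    (hemem v) (fun b => f₀ ⟨v, b⟩) (hedvd v)
  choose θ hθ hθb using fun v => (S v).exists_twist (fun c => (n : ℤ) • f v c)
    (by rw [← Finset.smul_sum, hfsum, smul_zero])
  have hkC : ∀ w : M.W, (k (M.op w) : ℤ) * (C (M.op w).1).det = k w * (C w.1).det := by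
    intro w
    obtain ⟨X, h1, -⟩ := hX w 0 (zero_mem _) 0 (zero_mem _)
    obtain ⟨X', h2, -⟩ := hX (M.op w) 0 (zero_mem _) 0 (zero_mem _)
    simp only [M.op_op] at h2
    have h3 : ∀ w : M.W, 0 < (k w : ℤ) * (C w.1).det := fun w => by
      have := hk w
      have := hC w.1
      positivity
    exact (eq_of_blk_mul_eq (M.det_mat w) (M.det_mat _) h1 h2 (h3 w) (h3 _)).symm
  -- Up to the factor `n ^ 2`, the degree of the block covering. Taking `K v` copies gives all
  -- blocks the same total degree, and by `hKcard` equally many boundary tori over `w` and `M.op w`.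
  let d : M.V → ℕ := fun v => N v * (C v).det.toNat
  have hd : ∀ v, 0 < d v := fun v => Nat.mul_pos (hN v) (by have := hC v; omega)
  let K : M.V → ℕ := fun v => ∏ u ∈ Finset.univ.erase v, d u
  have hK : ∀ v, 0 < K v := fun v => Finset.prod_pos fun u _ => hd u
  have hKd : ∀ v, K v * d v = ∏ u, d u := fun v => Finset.prod_erase_mul _ _ (Finset.mem_univ v)
  have hcount : ∀ w : M.W, (K w.1 * Nat.card {c // (π w.1).φ c = w.2}) *
      (n * (k w * (C w.1).det.toNat)) = ∏ u, d u := by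
    intro w
    rw [← hKd w.1]
    simp only [d]
    rw [← hcard w.1 w.2]
    ring
  have hKcard : ∀ w : M.W, K (M.op w).1 * Nat.card {c // (π _).φ c = (M.op w).2} =
      K w.1 * Nat.card {c // (π _).φ c = w.2} := by
    intro w
    have h1 : k (M.op w) * (C (M.op w).1).det.toNat = k w * (C w.1).det.toNat := by
      have h := hkC w
      rw [← Int.toNat_of_nonneg (hC w.1).le, ← Int.toNat_of_nonneg (hC (M.op w).1).le] at h
      exact_mod_cast h
    have h2 := (hcount (M.op w)).trans (hcount w).symm
    rw [h1] at h2
    refine Nat.eq_of_mul_eq_mul_right (Nat.mul_pos hn (Nat.mul_pos (hk w) ?_)) h2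
    have := hC w.1
    omega
  obtain ⟨V, hVf, hVn, p, hp, op, hop, hpop, huniv⟩ :=
    M.exists_graph_cover S (fun v => (π v).φ) hφ K hK hKcard
  refine ⟨{
    S := S
    conn := hconn
    eulerChar_neg := heuler
    π := π
    φ_surjective := hφ
    n := n
    n_pos := hn
    C := C
    det_C := hC
    mem_iff := hmem
    k := k
    k_pos := hk
    m_eq := hm
    f := fun u => f u.1 u.2
    θ := θ
    continuous_θ := hθ
    θ_boundaryPoint := fun v c x j => by rw [hθb]; rfl
    exists_mat := ?_
    V := V
    finite_V := hVf
    nonempty_V := hVn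
    p := p
    p_surjective := hp
    op := op
    op_op := hop
    p_op := hpop
    eq_univ := huniv }⟩
  intro u u' huu
  obtain ⟨g, hg, hfg⟩ := hf u.1 u.2
  obtain ⟨g', hg', hfg'⟩ := hf u'.1 u'.2
  rw [hfg, hfg']
  have key : ∀ w' : M.W, w' = M.op ⟨u.1, (π u.1).φ u.2⟩ → ∀ g' ∈ M.fiberIntersectionGroup w'.1,
      ∃ X, blk (k ⟨u.1, (π u.1).φ u.2⟩) (f₀ ⟨u.1, (π u.1).φ u.2⟩ + g) (C u.1) * X =
        M.mat ⟨u.1, (π u.1).φ u.2⟩ * blk (k w') (f₀ w' + g') (C w'.1) ∧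
          Int.gcd (X 0 1) (X 0 2) = 1 := by
    rintro _ rfl g' hg'
    exact hX ⟨u.1, (π u.1).φ u.2⟩ g hg g' hg'
  exact key _ huu g' hg'

end GraphGluing

/-! ### Contractions of circles and tori -/

section Contraction

open Topology Set

/-- The representative in `(-1/2, 1/2]` of a point of the circle. -/
noncomputable def circleRep (x : UnitAddCircle) : ℝ := AddCircle.equivIoc 1 (-1 / 2) x

/-- The point of the circle where `circleRep` jumps. -/
noncomputable def circleHalf : UnitAddCircle := ((-1 / 2 : ℝ) : UnitAddCircle)

theorem coe_circleRep (x : UnitAddCircle) : (circleRep x : UnitAddCircle) = x :=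
  (AddCircle.equivIoc 1 (-1 / 2 : ℝ)).symm_apply_apply x

theorem circleRep_coe {r : ℝ} (hr : r ∈ Ioc (-1 / 2 : ℝ) (1 / 2)) :
    circleRep (r : UnitAddCircle) = r := by
  have hr' : r ∈ Ioc (-1 / 2 : ℝ) (-1 / 2 + 1) := ⟨hr.1, by linarith [hr.2]⟩
  have h := (AddCircle.equivIoc 1 (-1 / 2 : ℝ)).apply_symm_apply ⟨r, hr'⟩
  exact congrArg Subtype.val h

theorem continuousAt_circleRep {x : UnitAddCircle} (hx : x ≠ circleHalf) :
    ContinuousAt circleRep x :=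
  continuous_subtype_val.continuousAt.comp (AddCircle.continuousAt_equivIoc 1 (-1 / 2 : ℝ) hx)

/-- The motion of the circle that contracts the complement of the points `x` with
`m • (x - c) = 1/2` to the points `x` with `m • x = m • c`. -/
noncomputable def circleContr (m : ℕ) (c x : UnitAddCircle) (t : ℝ) : UnitAddCircle :=
  x - ((t * circleRep (m • (x - c)) / m : ℝ) : UnitAddCircle)

theorem circleContr_zero (m : ℕ) (c x : UnitAddCircle) : circleContr m c x 0 = x := by
  simp [circleContr]

theorem nsmul_circleContr_one {m : ℕ} (hm : 0 < m) (c x : UnitAddCircle) :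
    m • circleContr m c x 1 = m • c := by
  have hm' : (m : ℝ) ≠ 0 := by exact_mod_cast hm.ne'
  rw [circleContr, smul_sub, ← AddCircle.coe_nsmul, nsmul_eq_mul, one_mul, mul_div_cancel₀ _ hm',
    coe_circleRep, smul_sub, sub_sub_cancel]

/-- In side coordinates the motion depends only on the representative `ρ` of `r - δ`, not on the
index `i`: all sides are moved in the same way. -/
theorem circleContr_coe (m : ℕ) {δ r ρ : ℝ} (i : ℕ) (z : ℤ) (hz : r - δ = ρ + z)
    (hρ : ρ ∈ Ioc (-1 / 2 : ℝ) (1 / 2)) (hm : 0 < m) (t : ℝ) :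
    circleContr m ((δ / m : ℝ) : UnitAddCircle) (((i + r) / m : ℝ) : UnitAddCircle) t =
      (((i + (r - t * ρ)) / m : ℝ) : UnitAddCircle) := by
  have hm' : (m : ℝ) ≠ 0 := by exact_mod_cast hm.ne'
  have h : m • ((((i + r) / m : ℝ) : UnitAddCircle) - ((δ / m : ℝ) : UnitAddCircle)) =
      (ρ : UnitAddCircle) := by
    rw [← AddCircle.coe_sub, ← AddCircle.coe_nsmul, ← sub_eq_zero, ← AddCircle.coe_sub,
      AddCircle.coe_eq_zero_iff]
    refine ⟨i + z, ?_⟩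
    simp only [zsmul_eq_mul, nsmul_eq_mul]
    push_cast
    field_simp
    linarith
  rw [circleContr, h, circleRep_coe hρ, ← AddCircle.coe_sub]
  congr 1
  ring

theorem continuousAt_circleContr {m : ℕ} {c x : UnitAddCircle} {t : ℝ}
    (h : m • (x - c) ≠ circleHalf) :
    ContinuousAt (fun p : UnitAddCircle × ℝ => circleContr m c p.1 p.2) (x, t) := by
  have h1 : ContinuousAt (fun p : UnitAddCircle × ℝ => circleRep (m • (p.1 - c))) (x, t) :=
    ContinuousAt.comp (f := fun p : UnitAddCircle × ℝ => m • (p.1 - c))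
      (continuousAt_circleRep h) (by fun_prop)
  have h2 : ContinuousAt (fun p : UnitAddCircle × ℝ => p.2 * circleRep (m • (p.1 - c)) / m)
      (x, t) := (continuousAt_snd.mul h1).div_const _
  exact continuousAt_fst.sub ((AddCircle.continuous_mk' 1).continuousAt.comp h2)

/-- The contraction of `circleContr` in every coordinate of a torus. -/
noncomputable def torusContr (m : Fin 3 → ℕ) (c X : Torus3) (t : unitInterval) : Torus3 :=
  fun i => circleContr (m i) (c i) (X i) t

/-- The set where `torusContr` is continuous. -/
def torusBall (m : Fin 3 → ℕ) (c : Torus3) : Set Torus3 := {X | ∀ i, m i • (X i - c i) ≠ circleHalf}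

theorem isOpen_torusBall (m : Fin 3 → ℕ) (c : Torus3) : IsOpen (torusBall m c) := by
  have : torusBall m c = ⋂ i, {X | m i • (X i - c i) ≠ circleHalf} := by
    ext; simp [torusBall]
  rw [this]
  exact isOpen_iInter_of_finite fun i => isOpen_ne.preimage
    (f := fun X : Torus3 => m i • (X i - c i)) (by fun_prop)

theorem continuousAt_torusContr {m : Fin 3 → ℕ} {c X : Torus3} (t : unitInterval)
    (h : X ∈ torusBall m c) :
    ContinuousAt (fun p : Torus3 × unitInterval => torusContr m c p.1 p.2) (X, t) := by
  refine continuousAt_pi.2 fun i => ?_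
  exact ContinuousAt.comp (x := (X, t)) (f := fun p : Torus3 × unitInterval => (p.1 i, (p.2 : ℝ)))
    (g := fun p : UnitAddCircle × ℝ => circleContr (m i) (c i) p.1 p.2)
    (continuousAt_circleContr (h i)) (by fun_prop)

theorem torusContr_zero (m : Fin 3 → ℕ) (c X : Torus3) : torusContr m c X 0 = X :=
  funext fun _ => circleContr_zero _ _ _

theorem finite_range_torusContr_one {m : Fin 3 → ℕ} (hm : ∀ i, 0 < m i) (c : Torus3) :
    (range fun X => torusContr m c X 1).Finite := by
  refine (Set.Finite.pi' (t := fun i => {x : UnitAddCircle | m i • (x - c i) = 0}) fun i => ?_).subset ?_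
  · have h1 := AddCircle.finite_torsion (1 : ℝ) (hm i)
    exact h1.preimage (f := fun x => x - c i) (sub_left_injective.injOn)
  · rintro _ ⟨X, rfl⟩ i
    simp only [mem_ofPred_eq, torusContr, smul_sub, Set.Icc.coe_one, sub_eq_zero]
    exact nsmul_circleContr_one (hm i) _ _

theorem continuousOn_sigma_prod {ι X Y T : Type*} [TopologicalSpace X] [TopologicalSpace Y]
    [TopologicalSpace T] (g : ι → X → T → Y) (N : Set (Σ _ : ι, X))
    (hg : ∀ i x t, (⟨i, x⟩ : Σ _ : ι, X) ∈ N →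
      ContinuousAt (fun p : X × T => g i p.1 p.2) (x, t)) :
    ContinuousOn (fun x : (Σ _ : ι, X) × T => (⟨x.1.1, g x.1.1 x.1.2 x.2⟩ : Σ _ : ι, Y))
      (N ×ˢ univ) := by
  rintro ⟨⟨i, x⟩, t⟩ ⟨hx, -⟩
  have he : IsOpenEmbedding (Prod.map (Sigma.mk (β := fun _ : ι => X) i) (id : T → T)) :=
    IsOpenEmbedding.sigmaMk.prodMap IsOpenEmbedding.id
  refine ContinuousAt.continuousWithinAt ?_
  refine (he.continuousAt_iff (x := (x, t))).1 ?_
  exact (continuous_sigmaMk (σ := fun _ : ι => Y) (i := i)).continuousAt.comp (hg i x t hx)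

/-- If a neighbourhood of a fibre of a quotient map can be deformed into a finite set, compatibly
with the equivalence relation, then the point of the quotient has a neighbourhood that is
contractible in the quotient. -/
theorem exists_pathsHomotopicIn_of_finite_contraction {A Y : Type*} [TopologicalSpace A]
    [TopologicalSpace Y] [CompactSpace A] [T2Space Y] {q : A → Y}
    (hq : Continuous q) (hqs : Function.Surjective q) {N : Set A} (hN : IsOpen N)
    (h : A → unitInterval → A)
    (hc : ContinuousOn (fun x : A × unitInterval => h x.1 x.2) (N ×ˢ univ))
    (h0 : ∀ a ∈ N, h a 0 = a) (h1 : ((fun a => h a 1) '' N).Finite)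
    (hcomp : ∀ a ∈ N, ∀ b ∈ N, q a = q b → ∀ t, q (h a t) = q (h b t)) (y : Y)
    (hfib : ∀ a, q a = y → a ∈ N) : ∃ U ∈ 𝓝 y, PathsHomotopicIn U := by
  obtain ⟨a₀, ha₀⟩ := hqs y
  let z := q (h a₀ 1)
  let N' : Set A := {a ∈ N | q (h a 1) = z}
  have hN' : IsOpen N' := by
    have h2 : ContinuousOn (fun a => q (h a 1)) N :=
      hq.comp_continuousOn (hc.comp (f := fun a => (a, (1 : unitInterval))) (by fun_prop)
        fun a ha => ⟨ha, trivial⟩)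
    -- The end points of the deformation form a finite set, so reaching `z` rather than another of
    -- them is an open condition.
    have h3 : IsClosed ((q '' ((fun a => h a 1) '' N)) \ {z}) :=
      ((h1.image q).subset sdiff_subset).isClosed
    have h4 : N' = N ∩ (fun a => q (h a 1)) ⁻¹' ((q '' ((fun a => h a 1) '' N)) \ {z})ᶜ := by
      ext a
      refine and_congr_right fun ha => ⟨fun h h' => h'.2 h, fun h => ?_⟩
      by_contra hne
      exact h ⟨⟨_, ⟨a, ha, rfl⟩, rfl⟩, hne⟩
    rw [h4]
    exact h2.isOpen_inter_preimage hN h3.isOpen_compl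
  refine exists_pathsHomotopicIn_of_contraction hq hqs z hN' h
    (hc.mono (prod_mono (sep_subset _ _) subset_rfl)) (fun a ha => h0 a ha.1) (fun a ha => ha.2)
    (fun a ha b hb => hcomp a ha.1 b hb.1) y fun a ha => ⟨hfib a ha, ?_⟩
  exact hcomp a (hfib a ha) a₀ (hfib a₀ ha₀) (ha.trans ha₀.symm) 1

end Contraction

theorem coe_sub_half_eq_iff (r : ℝ) :
    ((r - 1 / 2 : ℝ) : UnitAddCircle) = circleHalf ↔ (r : UnitAddCircle) = 0 := by
  rw [circleHalf, ← sub_eq_zero, ← AddCircle.coe_sub]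
  congr! 2
  ring

theorem zero_ne_circleHalf : (0 : UnitAddCircle) ≠ circleHalf := by
  intro h
  have h1 := (coe_sub_half_eq_iff (1 / 2)).1 (by simpa using h)
  rw [AddCircle.coe_eq_zero_iff_of_mem_Ico (by constructor <;> norm_num)] at h1
  norm_num at h1

theorem coe_half_eq_circleHalf : ((1 / 2 : ℝ) : UnitAddCircle) = circleHalf := by
  have := (coe_sub_half_eq_iff 1).2 (AddCircle.coe_period 1)
  rw [← this]
  norm_num

/-! ### Contractible neighbourhoods in the glued manifold -/

namespace GraphGluing

open Topology Set

variable (M : GraphGluing)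

/-- The points of the blocks in the coordinates of the collars of the boundary tori. -/
def blockPoint (a : Σ _ : M.W, Torus3 × unitInterval) : M.Blocks :=
  ⟨a.1.1, Quot.mk _ ⟨a.1.2, a.2.1 0, a.2.2⟩, ![a.2.1 1, a.2.1 2]⟩

/-- The points of the manifold in the coordinates of the collars of the boundary tori. -/
def chart (a : Σ _ : M.W, Torus3 × unitInterval) : M.Space := Quot.mk _ (M.blockPoint a)

theorem continuous_chart : Continuous M.chart := by
  refine continuous_quot_mk.comp (continuous_sigma fun w => ?_)
  show Continuous fun p : Torus3 × unitInterval =>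
    (⟨w.1, Quot.mk _ ⟨w.2, p.1 0, p.2⟩, ![p.1 1, p.1 2]⟩ : M.Blocks)
  refine (continuous_sigmaMk (σ := fun v => (M.surf v).Space × UnitAddTorus (Fin 2))
    (i := w.1)).comp (Continuous.prodMk ?_ ?_)
  · exact continuous_quot_mk.comp ((continuous_sigmaMk
      (σ := fun _ : (M.surf w.1).B => UnitAddCircle × unitInterval) (i := w.2)).comp
      (((continuous_apply 0).comp continuous_fst).prodMk continuous_snd))
  · refine continuous_pi fun i => ?_
    fin_cases i
    · exact (continuous_apply 1).comp continuous_fst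
    · exact (continuous_apply 2).comp continuous_fst

theorem chart_surjective : Function.Surjective M.chart := by
  intro y
  obtain ⟨⟨v, p, t⟩, rfl⟩ := Quot.exists_rep y
  obtain ⟨⟨b, x, s⟩, rfl⟩ := Quot.exists_rep p
  refine ⟨⟨⟨v, b⟩, ![x, t 0, t 1], s⟩, ?_⟩
  simp only [chart, blockPoint]
  congr 3
  ext1 i
  fin_cases i <;> rfl

/-- The point at parameter `r` of a side, times a point of the fibre. -/
noncomputable def sideChart (v : M.V) (s : (M.surf v).Side) (r : ℝ) (τ : Fin 2 → UnitAddCircle) :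
    Σ _ : M.W, Torus3 × unitInterval :=
  ⟨⟨v, s.1⟩, ![((((s.2 : ℕ) + r) / (M.surf v).len s.1 : ℝ) : UnitAddCircle), τ 0, τ 1], 0⟩

/-- The identifications along the sides, in the coordinates of the collars. -/
def SideRel (a b : Σ _ : M.W, Torus3 × unitInterval) : Prop :=
  ∃ (v : M.V) (s s' : (M.surf v).Side) (r r' : ℝ) (τ : Fin 2 → UnitAddCircle),
    r ∈ Ico (0 : ℝ) 1 ∧ r' ∈ Ico (0 : ℝ) 1 ∧ a = M.sideChart v s r τ ∧ b = M.sideChart v s' r' τ ∧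
      ((r = 0 ∧ r' = 0 ∧ (M.surf v).ribbon.vx.SameCycle s s') ∨
        (0 < r ∧ s' = (M.surf v).pair s ∧ r' = 1 - r))

theorem eq_or_sideRel_of_blockPoint_eq {a b : Σ _ : M.W, Torus3 × unitInterval}
    (h : M.blockPoint a = M.blockPoint b) : a = b ∨ M.SideRel a b := by
  obtain ⟨⟨v, c⟩, X, s⟩ := a
  obtain ⟨⟨v', c'⟩, X', s'⟩ := b
  simp only [blockPoint] at h
  obtain ⟨rfl, h1⟩ := Sigma.mk.inj h
  have h1 := eq_of_heq h1
  simp only [Prod.mk.injEq] at h1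
  obtain ⟨h1, h2⟩ := h1
  have e1 : X 1 = X' 1 := congrFun h2 0
  have e2 : X 2 = X' 2 := congrFun h2 1
  have hX : ∀ Y : Torus3, Y = ![Y 0, Y 1, Y 2] := fun Y => by ext1 i; fin_cases i <;> rfl
  rcases ((M.surf v).mk_eq_mk_iff _ _).1 h1 with h1 | ⟨u, u', r, r', hr, hr', h3, h4, h5⟩
  · left
    obtain ⟨rfl, h3⟩ := Sigma.mk.inj h1
    have h3 := eq_of_heq h3
    simp only [Prod.mk.injEq] at h3
    obtain ⟨e0, rfl⟩ := h3
    rw [hX X, hX X', e0, e1, e2]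
  · right
    refine ⟨v, u, u', r, r', ![X 1, X 2], hr, hr', ?_, ?_, h5⟩
    · obtain ⟨u, i⟩ := u
      obtain ⟨rfl, h3⟩ := Sigma.mk.inj h3
      have h3 := eq_of_heq h3
      simp only [Prod.mk.injEq] at h3
      obtain ⟨e0, rfl⟩ := h3
      rw [hX X, e0]
      rfl
    · obtain ⟨u', i⟩ := u'
      obtain ⟨rfl, h3⟩ := Sigma.mk.inj h4
      have h3 := eq_of_heq h3
      simp only [Prod.mk.injEq] at h3
      obtain ⟨e0, rfl⟩ := h3
      rw [hX X', e0, ← e1, ← e2]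
      rfl

theorem eq_of_blockPoint_eq_boundaryTorus {a : Σ _ : M.W, Torus3 × unitInterval} {w : M.W}
    {X : Torus3} (h : M.blockPoint a = M.boundaryTorus w X) : a = ⟨w, X, 1⟩ := by
  rcases M.eq_or_sideRel_of_blockPoint_eq (b := ⟨w, X, 1⟩) h with h | ⟨v, s, s', r, r', τ, -, -, -, h, -⟩
  · exact h
  · have := congrArg (fun x => x.2.2) h
    exact absurd this one_ne_zero

theorem chart_eq_chart {a b : Σ _ : M.W, Torus3 × unitInterval} (h : M.chart a = M.chart b) :
    a = b ∨ M.SideRel a b ∨ ∃ w X, a = ⟨M.op w, X, 1⟩ ∧ b = ⟨w, M.glue w X, 1⟩ := by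
  rcases (M.mk_eq_mk_iff _ _).1 h with h | h
  · exact (M.eq_or_sideRel_of_blockPoint_eq h).imp_right Or.inl
  · right; right
    generalize ha : M.blockPoint a = a' at h
    generalize hb : M.blockPoint b = b' at h
    obtain ⟨w, X⟩ := h
    exact ⟨w, X, M.eq_of_blockPoint_eq_boundaryTorus ha, M.eq_of_blockPoint_eq_boundaryTorus hb⟩

/-- The number of centres of the contraction in each coordinate. -/
def contrMul (w : M.W) : Fin 3 → ℕ := ![(M.surf w.1).len w.2, 1, 1]

theorem contrMul_pos (w : M.W) (i : Fin 3) : 0 < M.contrMul w i := by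
  fin_cases i
  · exact (M.surf w.1).len_pos w.2
  · exact one_pos
  · exact one_pos

/-- The centre of the contraction. -/
noncomputable def contrCenter (δ : ℝ) (τ : Fin 2 → UnitAddCircle) (w : M.W) : Torus3 :=
  ![((δ / (M.surf w.1).len w.2 : ℝ) : UnitAddCircle), τ 0, τ 1]

/-- The contraction away from the boundary tori, along the sides to the vertices (`δ = 0`) or to
the midpoints of the sides (`δ = 1/2`). -/
noncomputable def innerContr (δ : ℝ) (τ : Fin 2 → UnitAddCircle)
    (a : Σ _ : M.W, Torus3 × unitInterval) (t : unitInterval) : Σ _ : M.W, Torus3 × unitInterval :=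
  ⟨a.1, torusContr (M.contrMul a.1) (M.contrCenter δ τ a.1) a.2.1 t, unitInterval.symm t * a.2.2⟩

/-- The domain of the contraction away from the boundary tori. -/
def innerSet (δ : ℝ) (τ : Fin 2 → UnitAddCircle) : Set (Σ _ : M.W, Torus3 × unitInterval) :=
  {a | a.2.1 ∈ torusBall (M.contrMul a.1) (M.contrCenter δ τ a.1) ∧ a.2.2 < 1}

theorem chart_innerContr_side (δ : ℝ) (τ : Fin 2 → UnitAddCircle) (v : M.V) (s : (M.surf v).Side)
    {r ρ : ℝ} (z : ℤ) (hz : r - δ = ρ + z) (hρ : ρ ∈ Ioc (-1 / 2 : ℝ) (1 / 2))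
    (τ' : Fin 2 → UnitAddCircle) (t : unitInterval) :
    M.chart (M.innerContr δ τ (M.sideChart v s r τ') t) =
      Quot.mk _ ⟨v, Quot.mk _ ((M.surf v).sidePoint s (r - t * ρ)),
        ![circleContr 1 (τ 0) (τ' 0) t, circleContr 1 (τ 1) (τ' 1) t]⟩ := by
  have h := circleContr_coe ((M.surf v).len s.1) s.2 z hz hρ ((M.surf v).len_pos _) t
  simp only [chart, blockPoint, innerContr, sideChart, torusContr, contrMul, contrCenter, mul_zero,
    PolygonSurface.sidePoint]
  rw [← h]
  rfl

theorem sideChart_mem_innerSet_iff (δ : ℝ) (τ : Fin 2 → UnitAddCircle) (v : M.V)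
    (s : (M.surf v).Side) (r : ℝ) (τ' : Fin 2 → UnitAddCircle) :
    M.sideChart v s r τ' ∈ M.innerSet δ τ ↔ ((r - δ : ℝ) : UnitAddCircle) ≠ circleHalf ∧
      τ' 0 - τ 0 ≠ circleHalf ∧ τ' 1 - τ 1 ≠ circleHalf := by
  have hm : ((M.surf v).len s.1 : ℝ) ≠ 0 := by exact_mod_cast ((M.surf v).len_pos _).ne'
  have h : (M.surf v).len s.1 • (((((s.2 : ℕ) + r) / (M.surf v).len s.1 : ℝ) : UnitAddCircle) -
      ((δ / (M.surf v).len s.1 : ℝ) : UnitAddCircle)) = ((r - δ : ℝ) : UnitAddCircle) := by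
    rw [← AddCircle.coe_sub, ← AddCircle.coe_nsmul, ← sub_eq_zero, ← AddCircle.coe_sub,
      AddCircle.coe_eq_zero_iff]
    refine ⟨(s.2 : ℕ), ?_⟩
    simp only [zsmul_eq_mul, nsmul_eq_mul, Int.cast_natCast]
    field_simp
    ring
  rw [← h]
  simp only [innerSet, torusBall, sideChart, contrMul, contrCenter, Fin.forall_fin_succ,
    mem_ofPred_eq, zero_lt_one, and_true]
  simp

theorem isOpen_innerSet (δ : ℝ) (τ : Fin 2 → UnitAddCircle) : IsOpen (M.innerSet δ τ) := by
  refine isOpen_sigma_iff.2 fun w => ?_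
  show IsOpen ({p : Torus3 × unitInterval | p.1 ∈ torusBall (M.contrMul w) (M.contrCenter δ τ w)} ∩
    {p | p.2 < 1})
  exact ((isOpen_torusBall _ _).preimage continuous_fst).inter
    (isOpen_lt continuous_snd continuous_const)

theorem continuousOn_innerContr (δ : ℝ) (τ : Fin 2 → UnitAddCircle) :
    ContinuousOn (fun x : (Σ _ : M.W, Torus3 × unitInterval) × unitInterval =>
      M.innerContr δ τ x.1 x.2) (M.innerSet δ τ ×ˢ univ) := by
  refine continuousOn_sigma_prod (fun w (p : Torus3 × unitInterval) t =>
    (torusContr (M.contrMul w) (M.contrCenter δ τ w) p.1 t, unitInterval.symm t * p.2)) _ ?_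
  rintro w ⟨X, s⟩ t ⟨hX, -⟩
  refine ContinuousAt.prodMk ?_ ?_
  · exact ContinuousAt.comp (x := ((X, s), t))
      (f := fun p : (Torus3 × unitInterval) × unitInterval => (p.1.1, p.2))
      (g := fun p : Torus3 × unitInterval => torusContr (M.contrMul w) (M.contrCenter δ τ w) p.1 p.2)
      (continuousAt_torusContr t hX) (by fun_prop)
  · fun_prop

/-- Paired sides run in opposite directions, and the centres of the contraction, ends or midpoints
of sides, are symmetric under `r ↦ 1 - r`. So paired points stay paired. -/
theorem chart_innerContr_eq {δ : ℝ} (hδ : δ = 0 ∨ δ = 1 / 2) (τ : Fin 2 → UnitAddCircle)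
    {a b : Σ _ : M.W, Torus3 × unitInterval} (ha : a ∈ M.innerSet δ τ)
    (h : M.chart a = M.chart b) (t : unitInterval) :
    M.chart (M.innerContr δ τ a t) = M.chart (M.innerContr δ τ b t) := by
  rcases M.chart_eq_chart h with rfl | ⟨v, s, s', r, r', τ', hr, hr', rfl, rfl, hrel⟩ | ⟨w, X, rfl, -⟩
  · rfl
  · rw [sideChart_mem_innerSet_iff] at ha
    have ht0 := t.2.1
    have ht1 := t.2.2
    have key : ∀ (ρ ρ' : ℝ) (z z' : ℤ), r - δ = ρ + z → r' - δ = ρ' + z' →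
        ρ ∈ Ioc (-1 / 2 : ℝ) (1 / 2) → ρ' ∈ Ioc (-1 / 2 : ℝ) (1 / 2) →
        (Quot.mk (M.surf v).Rel ((M.surf v).sidePoint s (r - t * ρ)) =
          Quot.mk (M.surf v).Rel ((M.surf v).sidePoint s' (r' - t * ρ'))) →
        M.chart (M.innerContr δ τ (M.sideChart v s r τ') t) =
          M.chart (M.innerContr δ τ (M.sideChart v s' r' τ') t) := by
      intro ρ ρ' z z' hz hz' hρ hρ' he
      rw [M.chart_innerContr_side δ τ v s z hz hρ, M.chart_innerContr_side δ τ v s' z' hz' hρ', he]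
    have hpair : ∀ x x' : ℝ, x ∈ Icc (0 : ℝ) 1 → x' = 1 - x →
        Quot.mk (M.surf v).Rel ((M.surf v).sidePoint s x) =
          Quot.mk (M.surf v).Rel ((M.surf v).sidePoint ((M.surf v).pair s) x') := by
      rintro x _ hx rfl
      exact (M.surf v).mk_sidePoint_pair s hx
    rcases hδ with rfl | rfl
    · rcases hrel with ⟨rfl, rfl, hs⟩ | ⟨h0, rfl, rfl⟩
      · refine key 0 0 0 0 (by simp) (by simp) (by constructor <;> norm_num)
          (by constructor <;> norm_num) ?_
        simp only [mul_zero, sub_zero]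
        exact (M.surf v).mk_sidePoint_sameCycle hs
      -- Below `1/2` the point moves to the start of its side and its partner to the end, above
      -- `1/2` conversely. The midpoint is outside the domain.
      · rcases lt_trichotomy r (1 / 2) with hlt | rfl | hgt
        · refine key r (-r) 0 1 (by simp) (by push_cast; ring) ⟨by linarith, hlt.le⟩
            ⟨by linarith, by linarith⟩ (hpair _ _ ⟨?_, ?_⟩ (by ring))
          · nlinarith
          · nlinarith
        · exact absurd (by rw [sub_zero]; exact coe_half_eq_circleHalf) ha.1
        · have := hr.2
          refine key (r - 1) (1 - r) 1 0 (by push_cast; ring) (by push_cast; ring)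
            ⟨by linarith, by linarith⟩ ⟨by linarith, by linarith⟩ (hpair _ _ ⟨?_, ?_⟩ (by ring))
          · nlinarith
          · nlinarith
    · rcases hrel with ⟨rfl, rfl, hs⟩ | ⟨h0, rfl, rfl⟩
      · exact absurd ((coe_sub_half_eq_iff 0).2 (AddCircle.coe_zero _)) ha.1
      · have := hr.2
        refine key (r - 1 / 2) (1 / 2 - r) 0 0 (by push_cast; ring) (by push_cast; ring)
          ⟨by linarith, by linarith⟩ ⟨by linarith, by linarith⟩ (hpair _ _ ⟨?_, ?_⟩ (by ring))
        · nlinarith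
        · nlinarith
  · exact absurd ha.2 (lt_irrefl _)

theorem exists_pathsHomotopicIn_inner {δ : ℝ} (hδ : δ = 0 ∨ δ = 1 / 2) (τ : Fin 2 → UnitAddCircle)
    (y : M.Space) (hfib : ∀ a, M.chart a = y → a ∈ M.innerSet δ τ) :
    ∃ U ∈ 𝓝 y, PathsHomotopicIn U := by
  refine exists_pathsHomotopicIn_of_finite_contraction M.continuous_chart M.chart_surjective
    (M.isOpen_innerSet δ τ) (M.innerContr δ τ) (M.continuousOn_innerContr δ τ) ?_ ?_
    (fun a ha b _ h t => M.chart_innerContr_eq hδ τ ha h t) y hfib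
  · rintro ⟨w, X, s⟩ -
    simp [innerContr, torusContr_zero]
  · have hf : (⋃ w : M.W, (fun X : Torus3 => (⟨w, X, 0⟩ : Σ _ : M.W, Torus3 × unitInterval)) ''
        (range fun X => torusContr (M.contrMul w) (M.contrCenter δ τ w) X 1)).Finite :=
      finite_iUnion fun w => (finite_range_torusContr_one (M.contrMul_pos w) _).image _
    refine hf.subset ?_
    rintro _ ⟨⟨w, X, s⟩, -, rfl⟩
    refine mem_iUnion.2 ⟨w, _, ⟨X, rfl⟩, ?_⟩
    simp [innerContr]

/-- One torus of each glued pair serves as common model for both, which gives coordinates on a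
two-sided collar. -/
theorem exists_trivialization : ∃ φ : M.W → Torus3 ≃ₜ Torus3,
    ∀ w X, φ (M.op w) X = φ w (M.glue w X) := by
  classical
  let r : M.W → M.W → Prop := WellOrderingRel
  have hasymm : ∀ w, r w (M.op w) → ¬ r (M.op w) w := fun w h h' => asymm_of WellOrderingRel h h'
  have htri : ∀ w, ¬ r w (M.op w) → r (M.op w) w := fun w h => by
    rcases trichotomous_of WellOrderingRel w (M.op w) with h' | h' | h'
    · exact absurd h' h
    · exact absurd h'.symm (M.op_ne w)
    · exact h'
  refine ⟨fun w => if r w (M.op w) then Homeomorph.refl _ else M.glue (M.op w), fun w X => ?_⟩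
  simp only [M.op_op]
  by_cases hw : r w (M.op w)
  · rw [if_neg (hasymm w hw), if_pos hw]; rfl
  · rw [if_pos (htri w hw), if_neg hw, M.glue_op, Homeomorph.symm_apply_apply]; rfl

theorem exists_pathsHomotopicIn_collar (w₀ : M.W) (X₀ : Torus3) :
    ∃ U ∈ 𝓝 (M.chart ⟨w₀, X₀, 1⟩), PathsHomotopicIn U := by
  obtain ⟨φ, hφ⟩ := M.exists_trivialization
  let P := φ w₀ X₀
  let m : Fin 3 → ℕ := fun _ => 1
  -- The collar coordinate becomes `1 - (1 - t) (1 - s)`, so points are pushed onto the boundary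
  -- torus while the common torus coordinate contracts to `P`.
  let g : M.W → Torus3 × unitInterval → unitInterval → Torus3 × unitInterval := fun w p t =>
    ((φ w).symm (torusContr m P (φ w p.1) t),
      unitInterval.symm (unitInterval.symm t * unitInterval.symm p.2))
  let h : (Σ _ : M.W, Torus3 × unitInterval) → unitInterval → Σ _ : M.W, Torus3 × unitInterval :=
    fun a t => ⟨a.1, g a.1 a.2 t⟩
  let N : Set (Σ _ : M.W, Torus3 × unitInterval) := {a | φ a.1 a.2.1 ∈ torusBall m P ∧ 0 < a.2.2}
  have hP : P ∈ torusBall m P := fun i => by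
    rw [sub_self, smul_zero]; exact zero_ne_circleHalf
  refine exists_pathsHomotopicIn_of_finite_contraction M.continuous_chart M.chart_surjective
    (N := N) ?_ h ?_ ?_ ?_ ?_ _ ?_
  · refine isOpen_sigma_iff.2 fun w => ?_
    show IsOpen ({p : Torus3 × unitInterval | φ w p.1 ∈ torusBall m P} ∩ {p | 0 < p.2})
    exact ((isOpen_torusBall m P).preimage ((φ w).continuous.comp continuous_fst)).inter
      (isOpen_lt continuous_const continuous_snd)
  · refine continuousOn_sigma_prod g _ ?_
    rintro w ⟨X, s⟩ t ⟨hX, -⟩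
    refine ContinuousAt.prodMk ?_ ?_
    · refine (φ w).symm.continuous.continuousAt.comp ?_
      exact ContinuousAt.comp (x := ((X, s), t))
        (f := fun p : (Torus3 × unitInterval) × unitInterval => (φ w p.1.1, p.2))
        (g := fun p : Torus3 × unitInterval => torusContr m P p.1 p.2)
        (continuousAt_torusContr t hX) (by have := (φ w).continuous; fun_prop)
    · fun_prop
  · rintro ⟨w, X, s⟩ -
    simp [h, g, torusContr_zero]
  · have hf : (⋃ w : M.W, (fun X : Torus3 => (⟨w, (φ w).symm X, 1⟩ :
        Σ _ : M.W, Torus3 × unitInterval)) '' (range fun X => torusContr m P X 1)).Finite :=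
      finite_iUnion fun w => (finite_range_torusContr_one (fun _ => one_pos) _).image _
    refine hf.subset ?_
    rintro _ ⟨⟨w, X, s⟩, -, rfl⟩
    refine mem_iUnion.2 ⟨w, _, ⟨φ w X, rfl⟩, ?_⟩
    simp [h, g]
  · intro a ha b hb hab t
    rcases M.chart_eq_chart hab with rfl | ⟨v, s, s', r, r', τ', hr, hr', rfl, rfl, -⟩ |
      ⟨w, X, rfl, rfl⟩
    · rfl
    · exact absurd ha.2 (lt_irrefl _)
    · simp only [h, g, unitInterval.symm_one, mul_zero, unitInterval.symm_zero, hφ]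
      have hr := Rel.glue (M := M) w ((φ (M.op w)).symm (torusContr m P (φ w (M.glue w X)) t))
      have e : M.glue w ((φ (M.op w)).symm (torusContr m P (φ w (M.glue w X)) t)) =
          (φ w).symm (torusContr m P (φ w (M.glue w X)) t) := by
        rw [Homeomorph.eq_symm_apply, ← hφ, Homeomorph.apply_symm_apply]
      rw [e] at hr
      exact Quot.sound hr
  · intro a ha
    rcases M.chart_eq_chart ha with rfl | ⟨v, s, s', r, r', τ', hr, hr', -, h1, -⟩ |
      ⟨w, X, rfl, h1⟩
    · exact ⟨hP, one_pos⟩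
    · exact absurd (congrArg (fun x => x.2.2) h1) one_ne_zero
    · obtain ⟨rfl, h2⟩ := Sigma.mk.inj h1
      have h2 := eq_of_heq h2
      simp only [Prod.mk.injEq, and_true] at h2
      refine ⟨?_, one_pos⟩
      show φ (M.op w₀) X ∈ _
      rw [hφ, ← h2]
      exact hP

theorem exists_pathsHomotopicIn (y : M.Space) : ∃ U ∈ 𝓝 y, PathsHomotopicIn U := by
  obtain ⟨⟨w, X, s⟩, rfl⟩ := M.chart_surjective y
  rcases unitInterval.le_one' (t := s).eq_or_lt with rfl | hs
  · exact M.exists_pathsHomotopicIn_collar w X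
  let τ : Fin 2 → UnitAddCircle := ![X 1, X 2]
  have hself : ∀ δ : ℝ, (M.surf w.1).len w.2 • (X 0 - ((δ / (M.surf w.1).len w.2 : ℝ) :
      UnitAddCircle)) ≠ circleHalf → (⟨w, X, s⟩ : Σ _ : M.W, Torus3 × unitInterval) ∈
        M.innerSet δ τ := by
    intro δ h
    refine ⟨fun i => ?_, hs⟩
    fin_cases i
    · exact h
    · show 1 • (X 1 - X 1) ≠ _
      rw [sub_self, smul_zero]; exact zero_ne_circleHalf
    · show 1 • (X 2 - X 2) ≠ _
      rw [sub_self, smul_zero]; exact zero_ne_circleHalf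
  have hm : ((M.surf w.1).len w.2 : ℝ) ≠ 0 := by exact_mod_cast ((M.surf w.1).len_pos _).ne'
  have hside : ∀ (v : M.V) (u : (M.surf v).Side) (r : ℝ) (τ' : Fin 2 → UnitAddCircle),
      (⟨w, X, s⟩ : Σ _ : M.W, Torus3 × unitInterval) = M.sideChart v u r τ' →
        (M.surf w.1).len w.2 • X 0 = (r : UnitAddCircle) ∧ τ' = τ := by
    rintro v u r τ' h
    obtain ⟨rfl, h1⟩ := Sigma.mk.inj h
    have h1 := eq_of_heq h1
    simp only [Prod.mk.injEq] at h1
    obtain ⟨rfl, -⟩ := h1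
    constructor
    · show (M.surf v).len u.1 • (((((u.2 : ℕ) + r) / (M.surf v).len u.1 : ℝ) : UnitAddCircle)) = _
      rw [← AddCircle.coe_nsmul, ← sub_eq_zero, ← AddCircle.coe_sub, AddCircle.coe_eq_zero_iff]
      refine ⟨(u.2 : ℕ), ?_⟩
      simp only [zsmul_eq_mul, nsmul_eq_mul, Int.cast_natCast]
      have hm : ((M.surf v).len u.1 : ℝ) ≠ 0 := hm
      field_simp
      ring
    · ext1 i; fin_cases i <;> rfl
  have hmem : ∀ (δ : ℝ) (v : M.V) (u : (M.surf v).Side) (r : ℝ),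
      ((r - δ : ℝ) : UnitAddCircle) ≠ circleHalf → M.sideChart v u r τ ∈ M.innerSet δ τ := by
    intro δ v u r h
    rw [sideChart_mem_innerSet_iff, sub_self, sub_self]
    exact ⟨h, zero_ne_circleHalf, zero_ne_circleHalf⟩
  have hne : ∀ r : ℝ, 0 < r → r < 1 → (r : UnitAddCircle) ≠ 0 := fun r h0 h1 h => by
    rw [AddCircle.coe_eq_zero_iff_of_mem_Ico ⟨h0.le, h1⟩] at h
    exact h0.ne' h
  -- A point whose circle coordinate lies at a corner of the polygon is contracted to the vertices.
  -- For all others the midpoints serve, since the contraction with `δ = 1/2` omits exactly the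
  -- corner directions.
  by_cases hX : (M.surf w.1).len w.2 • X 0 = 0
  · refine M.exists_pathsHomotopicIn_inner (δ := 0) (Or.inl rfl) τ _ fun a ha => ?_
    rcases M.chart_eq_chart ha.symm with rfl | ⟨v, u, u', r, r', τ', hr, hr', h1, rfl, h⟩ |
      ⟨w', X', h1, rfl⟩
    · refine hself 0 ?_
      rw [zero_div, AddCircle.coe_zero, sub_zero, hX]
      exact zero_ne_circleHalf
    · obtain ⟨h2, rfl⟩ := hside _ _ _ _ h1
      rcases h with ⟨rfl, rfl, -⟩ | ⟨h0, rfl, rfl⟩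
      · refine hmem _ _ _ _ ?_
        rw [sub_zero, AddCircle.coe_zero]
        exact zero_ne_circleHalf
      · exact absurd (h2.symm.trans hX) (hne r h0 hr.2)
    · exact absurd (congrArg (fun x => x.2.2) h1) hs.ne
  · refine M.exists_pathsHomotopicIn_inner (δ := 1 / 2) (Or.inr rfl) τ _ fun a ha => ?_
    rcases M.chart_eq_chart ha.symm with rfl | ⟨v, u, u', r, r', τ', hr, hr', h1, rfl, h⟩ |
      ⟨w', X', h1, rfl⟩
    · refine hself (1 / 2) ?_
      rw [smul_sub, ← AddCircle.coe_nsmul, nsmul_eq_mul, mul_div_cancel₀ _ hm,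
        coe_half_eq_circleHalf]
      intro h
      apply hX
      rw [sub_eq_iff_eq_add, circleHalf, ← AddCircle.coe_add] at h
      rw [h, show (-1 / 2 + -1 / 2 : ℝ) = -1 by norm_num, AddCircle.coe_neg, AddCircle.coe_period,
        neg_zero]
    · obtain ⟨h2, rfl⟩ := hside _ _ _ _ h1
      rcases h with ⟨rfl, rfl, -⟩ | ⟨h0, rfl, rfl⟩
      · exact absurd (h2.trans (AddCircle.coe_zero _)) hX
      · refine hmem _ _ _ _ ?_
        rw [Ne, coe_sub_half_eq_iff]
        exact hne _ (by linarith [hr.2]) (by linarith)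
    · exact absurd (congrArg (fun x => x.2.2) h1) hs.ne

theorem fg_fundamentalGroup [ConnectedSpace M.Space] (y : M.Space) :
    Group.FG (FundamentalGroup M.Space y) := by
  have : PathConnectedSpace M.Space := pathConnectedSpace_iff_connectedSpace.2 inferInstance
  exact fundamentalGroup_fg M.exists_pathsHomotopicIn y

end GraphGluing

/-- Every 4-dimensional graph-manifold has a finite-sheeted cover by a graph-manifold all of whose
intersection numbers and secondary intersection numbers are `1`; the fundamental groups of the two
are quasi-isometric. -/
theorem lemma3p1 (M : GraphManifold) :
    ∃ N : GraphManifold,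
      (∃ p : N.Space → M.Space, IsCoveringMap p ∧
        ∃ d : ℕ, 0 < d ∧ ∀ y : M.Space, (p ⁻¹' {y}).ncard = d) ∧
      (∀ w : N.W, N.intersectionNumber w = 1) ∧
      (∀ v : N.V, N.secondaryIntersectionNumber v = 1) ∧
      ∀ (x : N.Space) (y : M.Space),
        QuasiIsometricGroups (FundamentalGroup N.Space x) (FundamentalGroup M.Space y) := by
  have := M.connected
  have : PathConnectedSpace M.Space := pathConnectedSpace_iff_connectedSpace.2 inferInstance
  obtain ⟨𝒟⟩ := M.toGraphGluing.exists_coverData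
  have hN := 𝒟.connectedSpace_cover
  have := GraphGluing.compactSpace_blocks 𝒟.cover
  have : CompactSpace 𝒟.cover.Space := Quot.compactSpace
  have hcov := 𝒟.isCoveringMap_map
  exact ⟨⟨𝒟.cover, hN⟩, ⟨𝒟.map, hcov, hcov.exists_ncard_fiber⟩, 𝒟.intersectionNumber_cover,
    𝒟.secondaryIntersectionNumber_cover, fun x y =>
      hcov.quasiIsometricGroups hcov.finite_fiber x y (M.toGraphGluing.fg_fundamentalGroup y)⟩
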